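/- **Setting.** Let $(M,g)$ be a smooth Lorentzian manifold of dimension $1+2$ (signature $(-,+,+)$). Let $(t,z)\in(-T,T)\times Z$, $Z\subset\mathbb R^2$ open with $0\in Z$, be local coordinates on $M$ in which $g=-dt^2+g'(t,z)$, with $g'(t,\cdot)$ a Riemannian metric on $Z$ depending smoothly on $t$; put $h=g'(0,\cdot)$. Let $A\subset\mathbb R$ be open with $0\in A$, and let $(z,a)\mapsto(z,\theta(z,a))$, $(z,a)\in Z\times A$, be a smooth local coordinate map of the $h$-unit circle bundle of $Z$ (so $|\theta|_h=1$, $\partial_a\theta\neq0$, and $\theta(z,\cdot)$ is injective). Let $\ell>0$ and let $\gamma_{z,a}:[0,\ell]\to M$ be the (lightlike) geodesics with $\gamma_{z,a}(0)=(0,z)$, $\dot\gamma_{z,a}(0)=(1,\theta(z,a))$, assumed to be defined on $[0,\ell]$ for all $(z,a)\in\mathcal M:=Z\times A$ and to depend smoothly on $(z,a,s)$. Let $\Omega\subset M$ be open and relatively compact, with $\gamma_{z,a}(0),\gamma_{z,a}(\ell)\notin\overline\Omega$. The canonical relation is $$C=\Big\{\big((z,a,\zeta,\alpha),(x,\xi)\big):\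 \xi\in T_x^*\Omega\setminus0,\ \exists s\in(0,\ell):\ x=\gamma_{z,a}(s),\ \langle\xi,\dot\gamma_{z,a}(s)\rangle=0,\ \zeta_j=\langle\xi,\partial_{z^j}\gamma_{z,a}(s)\rangle\ (j=1,2),\ \alpha=\langle\xi,\partial_a\gamma_{z,a}(s)\rangle\Big\},$$ and $C(x,\xi)$ denotes the set of all $(z,a,\zeta,\alpha)$ that are related to $(x,\xi)$ by $C$. For a covector $\xi\in T^*_xM$ let $\xi_*\in T_xM$ be the vector with $g(\xi_*,\cdot)=\xi$; $\xi$ is spacelike if $g(\xi_*,\xi_*)>0$. A prime on a vector field along a curve denotes the covariant derivative along it. **Linked covectors.** Say that $(x,\xi)$ and $(y,\eta)$ are *linked along* $\gamma_{z,a}$ if there are $s_1,s_2\in(0,\ell)$ such that the reparametrized segment $\gamma(r)=\gamma_{z,a}(s_1+r(s_2-s_1))$, $r\in[0,1]$, is a lightlike geodesic with $\gamma(0)=x$, $\gamma(1)=y$, and (a) $x$ and $y$ are conjugate to each other along $\gamma$, that is, there is a nonzero Jacobi field along $\gamma$ that vanishes at $0$ and at $1$; (b) $\xi_*=J'(0)+\lambda\dot\gamma(0)$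 and $\eta_*=J'(1)+\lambda\dot\gamma(1)$ for some $\lambda\in\mathbb R$ and some Jacobi field $J$ along $\gamma$ with $J(0)=J(1)=0$. **Proposition.** Let $(x,\xi)\ne(y,\eta)$ be spacelike covectors with $x,y\in\Omega$. Then: 1. For every $(z,a)\in\mathcal M$, the sets $C(x,\xi)$ and $C(y,\eta)$ have a common element of the form $(z,a,\zeta,\alpha)$ if and only if $(x,\xi)$ and $(y,\eta)$ are linked along $\gamma_{z,a}$. 2. If $C(x,\xi)=C(y,\eta)$ and this set is nonempty, then $(x,\xi)$ and $(y,\eta)$ are linked along $\gamma_{z,a}$ for some $(z,a)\in\mathcal M$. 3. If $C$ is single-valued at $(x,\xi)$ and at $(y,\eta)$ (each of $C(x,\xi)$, $C(y,\eta)$ has exactly one element), then $C(x,\xi)=C(y,\eta)$ if and only if $(x,\xi)$ and $(y,\eta)$ are linked along $\gamma_{z,a}$ for some $(z,a)\in\mathcal M$. -/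

import Mathlib

open Set Manifold Bundle Topology
open scoped ContDiff

noncomputable section

section Lorentz

variable {E : Type*} [NormedAddCommGroup E] [NormedSpace ℝ E]
  {M : Type*} [TopologicalSpace M] [ChartedSpace E M]

/-- A covector `(x, ξ)`, that is, a point of the cotangent bundle of `M`. -/
abbrev Covector (E M : Type*) [NormedAddCommGroup E] [NormedSpace ℝ E] [TopologicalSpace M]
    [ChartedSpace E M] : Type _ :=
  Σ x : M, (TangentSpace 𝓘(ℝ, E) x →L[ℝ] ℝ)

variable (E M) in
/-- A smooth Lorentzian metric of signature `(-, +, …, +)` on `M`: at every point there is a vector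
of negative square on whose orthogonal complement the form is positive definite. -/
structure LorentzMetric [IsManifold 𝓘(ℝ, E) ∞ M] where
  form (x : M) : TangentSpace 𝓘(ℝ, E) x →L[ℝ] TangentSpace 𝓘(ℝ, E) x →L[ℝ] ℝ
  symm (x : M) (v w : TangentSpace 𝓘(ℝ, E) x) : form x v w = form x w v
  signature (x : M) : ∃ v : TangentSpace 𝓘(ℝ, E) x, form x v v < 0 ∧
    ∀ w : TangentSpace 𝓘(ℝ, E) x, form x v w = 0 → w ≠ 0 → 0 < form x w w
  smooth : ContMDiff 𝓘(ℝ, E) ((𝓘(ℝ, E)).prod 𝓘(ℝ, E →L[ℝ] E →L[ℝ] ℝ)) ∞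
    (fun x : M ↦ TotalSpace.mk' (E →L[ℝ] E →L[ℝ] ℝ)
      (E := fun x : M ↦ TangentSpace 𝓘(ℝ, E) x →L[ℝ] TangentSpace 𝓘(ℝ, E) x →L[ℝ] ℝ) x (form x))

/-- The coordinates of a tangent vector `v ∈ T_x M` in the chart around `p`. -/
def chartVec (p x : M) (v : TangentSpace 𝓘(ℝ, E) x) : E :=
  mfderiv 𝓘(ℝ, E) 𝓘(ℝ, E) (extChartAt 𝓘(ℝ, E) p) x v

/-- `T_p M` is the model space through the chart around `p`: in that chart, the coordinates of a
vector of `T_p M` are the vector itself. -/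
theorem chartVec_self [IsManifold 𝓘(ℝ, E) ∞ M] (p : M) (v : TangentSpace 𝓘(ℝ, E) p) :
    chartVec p p v = v := by
  have : IsManifold 𝓘(ℝ, E) 1 M := IsManifold.of_le (n := ∞) (by simp)
  rw [chartVec, mfderiv_extChartAt_self]
  rfl

variable (E) in
/-- The velocity `γ̇(s) ∈ T_{γ(s)} M` of a curve. -/
def velocity (γ : ℝ → M) (s : ℝ) : TangentSpace 𝓘(ℝ, E) (γ s) :=
  mfderiv 𝓘(ℝ, ℝ) 𝓘(ℝ, E) γ s (1 : ℝ)

namespace LorentzMetric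

variable [IsManifold 𝓘(ℝ, E) ∞ M] (g : LorentzMetric E M)

/-- The vector `ξ_* ∈ T_x M` that corresponds to the covector `ξ` at `x` under the metric,
`g (ξ_*, w) = ξ w` for all `w`. -/
def sharp (p : Covector E M) : TangentSpace 𝓘(ℝ, E) p.1 :=
  (g.form p.1).inverse p.2

/-- A covector `(x, ξ)` is spacelike if `g (ξ_*, ξ_*) > 0`. -/
def IsSpacelike (p : Covector E M) : Prop :=
  0 < g.form p.1 (g.sharp p) (g.sharp p)

/-- The matrix field of the metric in the chart around `p`, as a bilinear form on the model
space depending on the coordinate `u`. -/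
def coordForm (p : M) (u : E) : E →L[ℝ] E →L[ℝ] ℝ :=
  let B : E →L[ℝ] E →L[ℝ] ℝ := g.form ((extChartAt 𝓘(ℝ, E) p).symm u)
  let D : E →L[ℝ] E := mfderiv 𝓘(ℝ, E) 𝓘(ℝ, E) (extChartAt 𝓘(ℝ, E) p).symm u
  B.bilinearComp D D

/-- The Christoffel symbols of the Levi-Civita connection in the chart around `p`:
`Γ(v, w)` has the components `Γᵏᵢⱼ vⁱ wʲ` with
`2 gₖₗ Γᵏᵢⱼ = ∂ᵢ gⱼₗ + ∂ⱼ gᵢₗ - ∂ₗ gᵢⱼ`. -/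
def christoffel (p : M) (u v w : E) : E :=
  (g.coordForm p u).inverse
    ((1 / 2 : ℝ) • (fderiv ℝ (g.coordForm p) u v w + fderiv ℝ (g.coordForm p) u w v
      - ((fderiv ℝ (g.coordForm p) u).flip v).flip w))

/-- The Riemann curvature `R(x, y) z = ∇ₓ ∇_y z - ∇_y ∇ₓ z - ∇_{[x, y]} z` in the chart
around `p`. -/
def coordCurvature (p : M) (u x y z : E) : E :=
  fderiv ℝ (fun u' ↦ g.christoffel p u' y z) u x - fderiv ℝ (fun u' ↦ g.christoffel p u' x z) u y
    + g.christoffel p u x (g.christoffel p u y z) - g.christoffel p u y (g.christoffel p u x z)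

/-- The curvature `R(X, Y) Z` at a point `p`, computed in the chart around `p`. -/
def curvature (p : M) (X Y Z : TangentSpace 𝓘(ℝ, E) p) : TangentSpace 𝓘(ℝ, E) p :=
  g.coordCurvature p (extChartAt 𝓘(ℝ, E) p p) (chartVec p p X) (chartVec p p Y) (chartVec p p Z)

/-- The covariant derivative `V'(s) = ∇_{γ̇} V (s)` of a vector field `V` along a curve `γ`,
computed in the chart around `γ(s)`: `V̇ᵏ + Γᵏᵢⱼ γ̇ⁱ Vʲ`. -/
def covDeriv (γ : ℝ → M) (V : (s : ℝ) → TangentSpace 𝓘(ℝ, E) (γ s)) (s : ℝ) :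
    TangentSpace 𝓘(ℝ, E) (γ s) :=
  (deriv (fun r ↦ chartVec (γ s) (γ r) (V r)) s
    + g.christoffel (γ s) (extChartAt 𝓘(ℝ, E) (γ s) (γ s))
        (chartVec (γ s) (γ s) (velocity E γ s)) (chartVec (γ s) (γ s) (V s)) : E)

/-- `γ` is a smooth solution of the geodesic equation `∇_{γ̇} γ̇ = 0` on the set `S` of
parameters (smooth in a neighbourhood of `S`). -/
def IsGeodesicOn (γ : ℝ → M) (S : Set ℝ) : Prop :=
  ∀ s ∈ S, ContMDiffAt 𝓘(ℝ, ℝ) 𝓘(ℝ, E) ∞ γ s ∧ g.covDeriv γ (velocity E γ) s = 0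

/-- `γ` is a lightlike geodesic on `S`: its velocity is nonzero of square zero. -/
def IsLightlikeGeodesicOn (γ : ℝ → M) (S : Set ℝ) : Prop :=
  g.IsGeodesicOn γ S ∧
    ∀ s ∈ S, velocity E γ s ≠ 0 ∧ g.form (γ s) (velocity E γ s) (velocity E γ s) = 0

/-- `J` is a smooth solution of the Jacobi equation `J'' + R(J, γ̇) γ̇ = 0` along `γ` on `S`. -/
def IsJacobiOn (γ : ℝ → M) (J : (s : ℝ) → TangentSpace 𝓘(ℝ, E) (γ s)) (S : Set ℝ) : Prop :=
  ∀ s ∈ S,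
    ContMDiffAt 𝓘(ℝ, ℝ) (𝓘(ℝ, E)).tangent ∞ (fun r ↦ (⟨γ r, J r⟩ : TangentBundle 𝓘(ℝ, E) M)) s ∧
    g.covDeriv γ (g.covDeriv γ J) s
      + g.curvature (γ s) (J s) (velocity E γ s) (velocity E γ s) = 0

/-- The points `γ(0)` and `γ(1)` are conjugate along `γ : [0, 1] → M`: there is a nonzero Jacobi
field that vanishes at both. -/
def AreConjugate (γ : ℝ → M) : Prop :=
  ∃ J : (s : ℝ) → TangentSpace 𝓘(ℝ, E) (γ s), g.IsJacobiOn γ J (Icc 0 1) ∧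
    J 0 = 0 ∧ J 1 = 0 ∧ ∃ s ∈ Icc (0 : ℝ) 1, J s ≠ 0

end LorentzMetric

/-- The local setting for the light ray transform near the lightlike geodesic segment
`γ₀ = γ_{0,0} : [0, ℓ] → M`: semigeodesic coordinates `(t, z) ∈ (-T, T) × Z` associated to a
spacelike hypersurface `H = {t = 0}` through `γ₀(0)`, local coordinates `(z, a) ∈ Z × A` on the
bundle of unit vectors `θ(z, a)` tangent to `H`, and the geodesics `γ_{z,a}` on `[0, ℓ]` with
`γ_{z,a}(0) = (0, z)` and `γ̇_{z,a}(0) = (1, θ(z, a))`. -/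
structure LightRayFamily [IsManifold 𝓘(ℝ, E) ∞ M] (g : LorentzMetric E M) where
  (T ℓ : ℝ)
  /-- The coordinate domain of `z = (z¹, z²)`. -/
  (Z : Set (Fin 2 → ℝ))
  (A : Set ℝ)
  ℓ_pos : 0 < ℓ
  T_pos : 0 < T
  isOpen_Z : IsOpen Z
  isOpen_A : IsOpen A
  zero_mem_Z : 0 ∈ Z
  zero_mem_A : 0 ∈ A
  /-- The coordinates `(t, z)`, as a map from the coordinate domain to `M`. -/
  Ψ : OpenPartialHomeomorph (ℝ × (Fin 2 → ℝ)) M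
  source_Ψ : Ψ.source = Ioo (-T) T ×ˢ Z
  smooth_Ψ : ContMDiffOn 𝓘(ℝ, ℝ × (Fin 2 → ℝ)) 𝓘(ℝ, E) ∞ Ψ Ψ.source
  smooth_Ψ_symm : ContMDiffOn 𝓘(ℝ, E) 𝓘(ℝ, ℝ × (Fin 2 → ℝ)) ∞ Ψ.symm Ψ.target
  /-- `g = -dt² + g'(t, z)` in these coordinates, with `g'(t, z)` positive definite. -/
  semigeodesic : ∀ u ∈ Ψ.source, ∀ (v₀ : ℝ) (v : Fin 2 → ℝ),
    g.form (Ψ u) (mfderiv 𝓘(ℝ, ℝ × (Fin 2 → ℝ)) 𝓘(ℝ, E) Ψ u (v₀, v))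
        (mfderiv 𝓘(ℝ, ℝ × (Fin 2 → ℝ)) 𝓘(ℝ, E) Ψ u (v₀, v))
      = -v₀ ^ 2 + g.form (Ψ u) (mfderiv 𝓘(ℝ, ℝ × (Fin 2 → ℝ)) 𝓘(ℝ, E) Ψ u ((0 : ℝ), v))
        (mfderiv 𝓘(ℝ, ℝ × (Fin 2 → ℝ)) 𝓘(ℝ, E) Ψ u ((0 : ℝ), v))
  spacelike : ∀ u ∈ Ψ.source, ∀ v : Fin 2 → ℝ, v ≠ 0 →
    0 < g.form (Ψ u) (mfderiv 𝓘(ℝ, ℝ × (Fin 2 → ℝ)) 𝓘(ℝ, E) Ψ u ((0 : ℝ), v))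
        (mfderiv 𝓘(ℝ, ℝ × (Fin 2 → ℝ)) 𝓘(ℝ, E) Ψ u ((0 : ℝ), v))
  /-- The coordinate map `(z, a) ↦ (z, θ(z, a))` of the unit circle bundle of `H`. -/
  θ : (Fin 2 → ℝ) × ℝ → Fin 2 → ℝ
  smooth_θ : ContDiffOn ℝ ∞ θ (Z ×ˢ A)
  unit_θ : ∀ z ∈ Z, ∀ a ∈ A,
    g.form (Ψ ((0 : ℝ), z)) (mfderiv 𝓘(ℝ, ℝ × (Fin 2 → ℝ)) 𝓘(ℝ, E) Ψ ((0 : ℝ), z) ((0 : ℝ), θ (z, a)))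
        (mfderiv 𝓘(ℝ, ℝ × (Fin 2 → ℝ)) 𝓘(ℝ, E) Ψ ((0 : ℝ), z) ((0 : ℝ), θ (z, a))) = 1
  injOn_θ : ∀ z ∈ Z, InjOn (fun a ↦ θ (z, a)) A
  deriv_θ_ne : ∀ z ∈ Z, ∀ a ∈ A, deriv (fun b ↦ θ (z, b)) a ≠ 0
  /-- The geodesics `γ_{z,a}(s)`. -/
  γ : (Fin 2 → ℝ) × ℝ → ℝ → M
  /-- The family is smooth in `(z, a, s)` up to both end points of `[0, ℓ]`. -/
  smooth_γ : ∀ z ∈ Z, ∀ a ∈ A, ∀ s ∈ Icc 0 ℓ,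
    ContMDiffAt 𝓘(ℝ, ((Fin 2 → ℝ) × ℝ) × ℝ) 𝓘(ℝ, E) ∞ (fun q : ((Fin 2 → ℝ) × ℝ) × ℝ ↦ γ q.1 q.2) ((z, a), s)
  geodesic : ∀ z ∈ Z, ∀ a ∈ A, g.IsGeodesicOn (γ (z, a)) (Icc 0 ℓ)
  initial : ∀ z ∈ Z, ∀ a ∈ A,
    (⟨γ (z, a) 0, velocity E (γ (z, a)) 0⟩ : TangentBundle 𝓘(ℝ, E) M)
      = ⟨Ψ ((0 : ℝ), z), mfderiv 𝓘(ℝ, ℝ × (Fin 2 → ℝ)) 𝓘(ℝ, E) Ψ ((0 : ℝ), z) ((1 : ℝ), θ (z, a))⟩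
  /-- The relatively compact open set that carries the functions to be integrated; the end
  points of the geodesics lie outside its closure. -/
  Ω : Set M
  isOpen_Ω : IsOpen Ω
  isCompact_closure_Ω : IsCompact (closure Ω)
  start_notMem : ∀ z ∈ Z, ∀ a ∈ A, γ (z, a) 0 ∉ closure Ω
  end_notMem : ∀ z ∈ Z, ∀ a ∈ A, γ (z, a) ℓ ∉ closure Ω

namespace LightRayFamily

variable [IsManifold 𝓘(ℝ, E) ∞ M] {g : LorentzMetric E M} (F : LightRayFamily g)

/-- The variation fields `M_j(s; z, a) = ∂γ_{z,a}(s) / ∂z^j`, `j = 1, 2`. -/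
def fieldM (j : Fin 2) (z : Fin 2 → ℝ) (a s : ℝ) : TangentSpace 𝓘(ℝ, E) (F.γ (z, a) s) :=
  mfderiv 𝓘(ℝ, (Fin 2 → ℝ)) 𝓘(ℝ, E) (fun z' ↦ F.γ (z', a) s) z (Pi.single j (1 : ℝ))

/-- The variation field `J_1(s; z, a) = ∂γ_{z,a}(s) / ∂a`. -/
def fieldJ (z : Fin 2 → ℝ) (a s : ℝ) : TangentSpace 𝓘(ℝ, E) (F.γ (z, a) s) :=
  mfderiv 𝓘(ℝ, ℝ) 𝓘(ℝ, E) (fun a' ↦ F.γ (z, a') s) a (1 : ℝ)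

/-- The cotangent bundle of the parameter space `Z × A`, with points `(z, a, ζ, α)` where `ζ` and
`α` are the components of the covector dual to `z` and `a`. -/
structure ParamCovector where
  z : Fin 2 → ℝ
  a : ℝ
  ζ : Fin 2 → ℝ
  α : ℝ

/-- The canonical relation `C`, the (twisted) conormal bundle of the point-geodesic relation
`{(z, a, x) : x = γ_{z,a}(s) for some s ∈ (0, ℓ)}` in `(Z × A) × Ω`, as a set of pairs
`((z, a, ζ, α), (x, ξ))`. -/
def canonicalRelation : Set (ParamCovector × Covector E M) :=
  {c | c.1.z ∈ F.Z ∧ c.1.a ∈ F.A ∧ c.2.1 ∈ F.Ω ∧ c.2.2 ≠ 0 ∧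
    ∃ s ∈ Ioo 0 F.ℓ, ∃ ξ : TangentSpace 𝓘(ℝ, E) (F.γ (c.1.z, c.1.a) s) →L[ℝ] ℝ,
      c.2 = ⟨F.γ (c.1.z, c.1.a) s, ξ⟩ ∧
      ξ (velocity E (F.γ (c.1.z, c.1.a)) s) = 0 ∧
      (∀ j, c.1.ζ j = ξ (F.fieldM j c.1.z c.1.a s)) ∧
      c.1.α = ξ (F.fieldJ c.1.z c.1.a s)}

/-- The multivalued map `C(x, ξ) = π_𝓜 (π_M⁻¹ (x, ξ))`. -/
def C (p : Covector E M) : Set ParamCovector :=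
  {q | (q, p) ∈ F.canonicalRelation}

/-- The lightlike geodesic `[0, 1] → M` obtained from `γ_{z,a}`, by an affine change of parameter
that takes `0` to `s₁` and `1` to `s₂`. -/
def segment (z : Fin 2 → ℝ) (a s₁ s₂ : ℝ) : ℝ → M :=
  fun r ↦ F.γ (z, a) (s₁ + r * (s₂ - s₁))

/-- The covectors `(x, ξ)` and `(y, η)` are linked by a curve `γ : [0, 1] → M`: it is a lightlike
geodesic from `γ(0) = x` to `γ(1) = y` such that
(a) `x` and `y` are conjugate along `γ`, and
(b) `ξ_* = J'(0) + λ γ̇(0)` and `η_* = J'(1) + λ γ̇(1)` for some `λ ∈ ℝ` and some Jacobi field `J`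
along `γ` with `J(0) = J(1) = 0`. -/
def _root_.LorentzMetric.Linked (g : LorentzMetric E M) (p₁ p₂ : Covector E M) (γ : ℝ → M) : Prop :=
  g.IsLightlikeGeodesicOn γ (Icc 0 1) ∧ γ 0 = p₁.1 ∧ γ 1 = p₂.1 ∧
  g.AreConjugate γ ∧
  ∃ (J : (s : ℝ) → TangentSpace 𝓘(ℝ, E) (γ s)) (c : ℝ),
    g.IsJacobiOn γ J (Icc 0 1) ∧ J 0 = 0 ∧ J 1 = 0 ∧
    (⟨p₁.1, g.sharp p₁⟩ : TangentBundle 𝓘(ℝ, E) M) = ⟨γ 0, g.covDeriv γ J 0 + c • velocity E γ 0⟩ ∧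
    (⟨p₂.1, g.sharp p₂⟩ : TangentBundle 𝓘(ℝ, E) M) = ⟨γ 1, g.covDeriv γ J 1 + c • velocity E γ 1⟩

/-- The covectors `p₁` and `p₂` are linked along `γ_{z,a}`: some segment of this geodesic, affinely
reparametrized over `[0, 1]`, links them. -/
def LinkedAlong (p₁ p₂ : Covector E M) (z : Fin 2 → ℝ) (a : ℝ) : Prop :=
  ∃ s₁ ∈ Ioo 0 F.ℓ, ∃ s₂ ∈ Ioo 0 F.ℓ, g.Linked p₁ p₂ (F.segment z a s₁ s₂)

end LightRayFamily

end Lorentz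

end

noncomputable section

/-! ### Christoffel symbols and curvature of a metric on an open set of a vector space -/

section Coordinates

variable {E : Type*} [NormedAddCommGroup E] [NormedSpace ℝ E]

/-! The proof is symplectic linear algebra on Jacobi fields along one geodesic `γ = γ_{z,a}`. The
derivatives of the family in `(z, a)` together with the fields `(c + s d) γ̇` form a 5-dimensional
space `Λ` of Jacobi fields. All geodesics of the family are lightlike, so `K' ⊥ γ̇` for `K ∈ Λ`, and
the Cauchy data `(K(s), K'(s))` lie in `T × γ̇^⊥`, where `T` is the 3-dimensional tangent space;
this has dimension `3 + 2 = 5`. The data map is injective at `s = 0` by the initial conditions, and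
at every other `s` because the Wronskian `g(V', W) - g(V, W')` is conserved. So the data fill `T ×
γ̇^⊥` at every time (`cauchyData_injective`, `exists_apply_eq_of_orthogonal`).

If `ξ(γ̇) = 0`, then `ζ` and `α` record exactly the functional `K ↦ ξ(K(s))` on `Λ`. A common
element over `(z, a)` therefore means `ξ(K(s₁)) = η(K(s₂))` for all `K ∈ Λ`, with `ξ` and `η`
annihilating `γ̇`. If `s₁ = s₂`, then `ξ = η`, which is excluded. Otherwise take `k ∈ Λ` with data
`(0, ξ_*)` at `s₁`. Pairing `k` with all of `Λ` and comparing at `s₂` gives `k'(s₂) = η_*` and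
`k(s₂) ∈ (γ̇^⊥)^⊥ = ℝ γ̇` (`exists_of_symplectic`). Subtracting a multiple of `(s - s₁) γ̇` makes
the field vanish at both ends and changes its derivative by the same multiple of `γ̇` at both ends:
this is `λ`. The field is not zero because `ξ_*`, being spacelike, is not a multiple of `γ̇`
(`linkedAlong_of_cauchyData`).

Conversely, for a linking field `J`, the Wronskian of `J` with `K ∈ Λ` gives `g(J', K)` the same
value at both ends, and `g(γ̇, K)` is constant. Hence `ξ` and `η` induce the same functional on `Λ`;
testing with `γ̇` and `s γ̇` gives `ξ(γ̇) = η(γ̇) = 0` (`exists_mem_of_form_jacobiField_eq`).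
Assertions 2 and 3 follow formally from assertion 1.

The geometric input is metric compatibility, self-adjointness of `X ↦ R(X, γ̇) γ̇`, and the Jacobi
equation for variations of geodesics. These are proved in coordinates and carried to the manifold by
the invariance of the covariant derivative under chart changes (`chartVec_covDeriv`). -/

instance bilinearForm.instNormedAddCommGroup : NormedAddCommGroup (E →L[ℝ] E →L[ℝ] ℝ) :=
  ContinuousLinearMap.toNormedAddCommGroup

instance bilinearForm.instNormedSpace : NormedSpace ℝ (E →L[ℝ] E →L[ℝ] ℝ) :=
  ContinuousLinearMap.toNormedSpace

instance bilinearMap.instNormedAddCommGroup : NormedAddCommGroup (E →L[ℝ] E →L[ℝ] E) :=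
  ContinuousLinearMap.toNormedAddCommGroup

instance bilinearMap.instNormedSpace : NormedSpace ℝ (E →L[ℝ] E →L[ℝ] E) :=
  ContinuousLinearMap.toNormedSpace

/-- A smooth field of nondegenerate symmetric bilinear forms on an open subset of a vector space. -/
structure IsMetricOn (G : E → E →L[ℝ] E →L[ℝ] ℝ) (U : Set E) : Prop where
  isOpen : IsOpen U
  contDiffOn : ContDiffOn ℝ ∞ G U
  symm : ∀ u ∈ U, ∀ v w, G u v w = G u w v
  invertible : ∀ u ∈ U, (G u).IsInvertible

/-- The lowered Christoffel symbols `½ (∂ᵢ gⱼₗ + ∂ⱼ gᵢₗ - ∂ₗ gᵢⱼ)`. -/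
def loweredChristoffel (G : E → E →L[ℝ] E →L[ℝ] ℝ) (u v w x : E) : ℝ :=
  1 / 2 * (fderiv ℝ G u v w x + fderiv ℝ G u w v x - fderiv ℝ G u x v w)

/-- The Christoffel symbols of a field of bilinear forms. -/
def christoffelOf (G : E → E →L[ℝ] E →L[ℝ] ℝ) (u v w : E) : E :=
  (G u).inverse ((1 / 2 : ℝ) • (fderiv ℝ G u v w + fderiv ℝ G u w v
    - ((fderiv ℝ G u).flip v).flip w))

theorem ContDiffAt.fderiv_apply_const {V F : Type*} [NormedAddCommGroup V] [NormedSpace ℝ V]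
    [NormedAddCommGroup F] [NormedSpace ℝ F] {f : V → F} {u : V} (hf : ContDiffAt ℝ ∞ f u) (v : V) :
    ContDiffAt ℝ ∞ (fun u ↦ fderiv ℝ f u v) u :=
  (hf.fderiv_right (m := ∞) (by simp)).clm_apply contDiffAt_const

theorem minSmoothness_le_infty : minSmoothness ℝ 2 ≤ (∞ : WithTop ℕ∞) := by
  simpa using WithTop.coe_le_coe.mpr (le_top : (2 : ℕ∞) ≤ ⊤)

/-- The product rule for the evaluation of bilinear maps. -/
theorem HasDerivAt.bilin_apply {V W F : Type*} [NormedAddCommGroup V] [NormedSpace ℝ V]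
    [NormedAddCommGroup W] [NormedSpace ℝ W] [NormedAddCommGroup F] [NormedSpace ℝ F]
    {B : ℝ → V →L[ℝ] W →L[ℝ] F} {B' : V →L[ℝ] W →L[ℝ] F} {v : ℝ → V} {v' : V} {w : ℝ → W} {w' : W}
    {t : ℝ} (hB : HasDerivAt B B' t) (hv : HasDerivAt v v' t) (hw : HasDerivAt w w' t) :
    HasDerivAt (fun t ↦ B t (v t) (w t)) (B' (v t) (w t) + B t v' (w t) + B t (v t) w') t := by
  simpa [add_assoc] using (hB.clm_apply hv).clm_apply hw

theorem hasDerivAt_along {V F : Type*} [NormedAddCommGroup V] [NormedSpace ℝ V]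
    [NormedAddCommGroup F] [NormedSpace ℝ F] {f : V → F} {u : V} (hf : DifferentiableAt ℝ f u)
    (x : V) : HasDerivAt (fun t : ℝ ↦ f (u + t • x)) (fderiv ℝ f u x) 0 := by
  have h1 : HasDerivAt (fun t : ℝ ↦ u + t • x) x 0 := by
    simpa using ((hasDerivAt_id (0 : ℝ)).smul_const x).const_add u
  exact HasFDerivAt.comp_hasDerivAt_of_eq 0 hf.hasFDerivAt h1 (by simp)

theorem ContDiffAt.clm_flip_apply_const {V X Y Z : Type*} [NormedAddCommGroup V] [NormedSpace ℝ V]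
    [NormedAddCommGroup X] [NormedSpace ℝ X] [NormedAddCommGroup Y] [NormedSpace ℝ Y]
    [NormedAddCommGroup Z] [NormedSpace ℝ Z] {A : V → X →L[ℝ] Y →L[ℝ] Z} {u : V}
    (hA : ContDiffAt ℝ ∞ A u) (y : Y) : ContDiffAt ℝ ∞ (fun u ↦ (A u).flip y) u :=
  contDiffAt_const (c := ContinuousLinearMap.apply ℝ Z y).clm_comp hA

/-- In finite dimension the space of linear maps out of `X` is a finite power of `Y`, by evaluation
on a basis. -/
theorem ContDiffAt.of_forall_clm_apply {V X Y : Type*} [NormedAddCommGroup V] [NormedSpace ℝ V]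
    [NormedAddCommGroup X] [NormedSpace ℝ X] [NormedAddCommGroup Y] [NormedSpace ℝ Y]
    [FiniteDimensional ℝ X] {A : V → X →L[ℝ] Y} {u : V}
    (hA : ∀ x, ContDiffAt ℝ ∞ (fun u ↦ A u x) u) : ContDiffAt ℝ ∞ A u := by
  have hd : Module.finrank ℝ X = Module.finrank ℝ (Fin (Module.finrank ℝ X) → ℝ) :=
    (Module.finrank_fin_fun ℝ).symm
  let e₁ := ContinuousLinearEquiv.ofFinrankEq hd
  let e₂ := (e₁.arrowCongr (1 : Y ≃L[ℝ] Y)).trans (ContinuousLinearEquiv.piRing _)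
  rw [← Function.id_comp A, ← e₂.symm_comp_self]
  exact e₂.symm.contDiff.contDiffAt.comp u (contDiffAt_pi.mpr fun i ↦ hA _)

theorem eq_of_forall_form_eq {B : E →L[ℝ] E →L[ℝ] ℝ} (hB : B.IsInvertible) {v w : E}
    (h : ∀ x, B v x = B w x) : v = w := by
  have : B v = B w := ContinuousLinearMap.ext h
  simpa [hB.inverse_apply_self] using congrArg B.inverse this

theorem christoffelOf_add_left (G : E → E →L[ℝ] E →L[ℝ] ℝ) (u v v' w : E) :
    christoffelOf G u (v + v') w = christoffelOf G u v w + christoffelOf G u v' w := by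
  rw [christoffelOf, christoffelOf, christoffelOf, ← map_add]
  congr 1
  ext x
  simp
  ring

theorem christoffelOf_smul_left (G : E → E →L[ℝ] E →L[ℝ] ℝ) (c : ℝ) (u v w : E) :
    christoffelOf G u (c • v) w = c • christoffelOf G u v w := by
  rw [christoffelOf, christoffelOf, ← map_smul]
  congr 1
  ext x
  simp
  ring

theorem christoffelOf_add_right (G : E → E →L[ℝ] E →L[ℝ] ℝ) (u v w w' : E) :
    christoffelOf G u v (w + w') = christoffelOf G u v w + christoffelOf G u v w' := by
  rw [christoffelOf, christoffelOf, christoffelOf, ← map_add]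
  congr 1
  ext x
  simp
  ring

theorem christoffelOf_smul_right (G : E → E →L[ℝ] E →L[ℝ] ℝ) (c : ℝ) (u v w : E) :
    christoffelOf G u v (c • w) = c • christoffelOf G u v w := by
  rw [christoffelOf, christoffelOf, ← map_smul]
  congr 1
  ext x
  simp
  ring

/-- The Christoffel symbols as a bilinear map. -/
def christoffelMap [FiniteDimensional ℝ E] (G : E → E →L[ℝ] E →L[ℝ] ℝ) (u : E) :
    E →L[ℝ] E →L[ℝ] E :=
  LinearMap.toContinuousBilinearMap (LinearMap.mk₂ ℝ (christoffelOf G u)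
    (christoffelOf_add_left G u) (fun c ↦ christoffelOf_smul_left G c u)
    (christoffelOf_add_right G u) (fun c ↦ christoffelOf_smul_right G c u))

@[simp]
theorem christoffelMap_apply [FiniteDimensional ℝ E] (G : E → E →L[ℝ] E →L[ℝ] ℝ) (u v w : E) :
    christoffelMap G u v w = christoffelOf G u v w := rfl

/-- The expression `R(x, y) z` of the curvature in terms of the Christoffel symbols. -/
def curvatureOf (G : E → E →L[ℝ] E →L[ℝ] ℝ) (u x y z : E) : E :=
  fderiv ℝ (fun u' ↦ christoffelOf G u' y z) u x - fderiv ℝ (fun u' ↦ christoffelOf G u' x z) u y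
    + christoffelOf G u x (christoffelOf G u y z) - christoffelOf G u y (christoffelOf G u x z)

namespace IsMetricOn

variable {G : E → E →L[ℝ] E →L[ℝ] ℝ} {U : Set E} (hG : IsMetricOn G U) {u : E}
include hG

theorem contDiffAt (hu : u ∈ U) : ContDiffAt ℝ ∞ G u :=
  hG.contDiffOn.contDiffAt (hG.isOpen.mem_nhds hu)

theorem differentiableAt (hu : u ∈ U) : DifferentiableAt ℝ G u :=
  (hG.contDiffAt hu).differentiableAt (by simp)

theorem contDiffAt_apply (hu : u ∈ U) (v w : E) : ContDiffAt ℝ ∞ (fun u ↦ G u v w) u :=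
  ((hG.contDiffAt hu).clm_apply contDiffAt_const).clm_apply contDiffAt_const

theorem fderiv_eq (hu : u ∈ U) (x v w : E) :
    fderiv ℝ G u x v w = fderiv ℝ (fun u ↦ G u v w) u x := by
  have h1 := (hasDerivAt_along (hG.differentiableAt hu) x).bilin_apply
    (hasDerivAt_const 0 v) (hasDerivAt_const 0 w)
  have h2 := hasDerivAt_along ((hG.contDiffAt_apply hu v w).differentiableAt (by simp)) x
  simpa using h1.unique h2

theorem fderiv_symm (hu : u ∈ U) (x v w : E) : fderiv ℝ G u x v w = fderiv ℝ G u x w v := by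
  rw [hG.fderiv_eq hu, hG.fderiv_eq hu]
  congr 1
  refine Filter.EventuallyEq.fderiv_eq ?_
  filter_upwards [hG.isOpen.mem_nhds hu] with y hy using hG.symm y hy v w

theorem form_christoffelOf (hu : u ∈ U) (v w x : E) :
    G u (christoffelOf G u v w) x = loweredChristoffel G u v w x := by
  simp [christoffelOf, loweredChristoffel, (hG.invertible u hu).self_apply_inverse]

theorem christoffelOf_symm (hu : u ∈ U) (v w : E) :
    christoffelOf G u v w = christoffelOf G u w v := by
  refine eq_of_forall_form_eq (hG.invertible u hu) fun x ↦ ?_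
  rw [hG.form_christoffelOf hu, hG.form_christoffelOf hu, loweredChristoffel,
    loweredChristoffel, hG.fderiv_symm hu x w v]
  ring

/-- Metric compatibility of the Christoffel symbols. -/
theorem fderiv_apply (hu : u ∈ U) (x v w : E) :
    fderiv ℝ G u x v w = G u (christoffelOf G u x v) w + G u v (christoffelOf G u x w) := by
  rw [hG.symm u hu v, hG.form_christoffelOf hu, hG.form_christoffelOf hu,
    loweredChristoffel, loweredChristoffel, hG.fderiv_symm hu x w v,
    hG.fderiv_symm hu v x w, hG.fderiv_symm hu w x v]
  ring

theorem contDiffAt_fderiv_apply (hu : u ∈ U) (x v w : E) :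
    ContDiffAt ℝ ∞ (fun u ↦ fderiv ℝ G u x v w) u :=
  (((hG.contDiffAt hu).fderiv_apply_const x).clm_apply contDiffAt_const).clm_apply contDiffAt_const

theorem contDiffAt_loweredChristoffel (hu : u ∈ U) (v w x : E) :
    ContDiffAt ℝ ∞ (fun u ↦ loweredChristoffel G u v w x) u :=
  contDiffAt_const.mul (((hG.contDiffAt_fderiv_apply hu v w x).add
    (hG.contDiffAt_fderiv_apply hu w v x)).sub (hG.contDiffAt_fderiv_apply hu x v w))

theorem fderiv_loweredChristoffel (hu : u ∈ U) (a v w x : E) :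
    fderiv ℝ (fun u ↦ loweredChristoffel G u v w x) u a
      = 1 / 2 * (fderiv ℝ (fun u ↦ fderiv ℝ G u v w x) u a
        + fderiv ℝ (fun u ↦ fderiv ℝ G u w v x) u a
        - fderiv ℝ (fun u ↦ fderiv ℝ G u x v w) u a) := by
  have e (p q r : E) :=
    hasDerivAt_along ((hG.contDiffAt_fderiv_apply hu p q r).differentiableAt (by simp)) a
  exact (hasDerivAt_along ((hG.contDiffAt_loweredChristoffel hu v w x).differentiableAt
    (by simp)) a).unique ((((e v w x).add (e w v x)).sub (e x v w)).const_mul (1 / 2))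

theorem fderiv_fderiv_comm (hu : u ∈ U) (a b p q : E) :
    fderiv ℝ (fun u ↦ fderiv ℝ G u b p q) u a = fderiv ℝ (fun u ↦ fderiv ℝ G u a p q) u b := by
  have e (a b : E) : fderiv ℝ (fun u ↦ fderiv ℝ G u b p q) u a
      = fderiv ℝ (fderiv ℝ fun u ↦ G u p q) u a b := by
    have h : (fun u ↦ fderiv ℝ G u b p q) =ᶠ[𝓝 u] fun u ↦ fderiv ℝ (fun u ↦ G u p q) u b := by
      filter_upwards [hG.isOpen.mem_nhds hu] with y hy using hG.fderiv_eq hy b p q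
    have h2 := ((hG.contDiffAt_apply hu p q).fderiv_right (m := ∞) (by simp)).differentiableAt
      (by simp)
    rw [h.fderiv_eq]
    have h3 := hasDerivAt_along (((hG.contDiffAt_apply hu p q).fderiv_apply_const b).differentiableAt
      (by simp)) a
    simpa using h3.unique ((hasDerivAt_along h2 a).clm_apply (hasDerivAt_const 0 b))
  rw [e, e]
  exact (hG.contDiffAt_apply hu p q).isSymmSndFDerivAt minSmoothness_le_infty a b

theorem contDiffAt_christoffelOf [CompleteSpace E] (hu : u ∈ U) (v w : E) :
    ContDiffAt ℝ ∞ (fun u ↦ christoffelOf G u v w) u := by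
  have hi : ContDiffAt ℝ ∞ (fun u ↦ (G u).inverse) u :=
    ((hG.invertible u hu).contDiffAt_map_inverse).comp u (hG.contDiffAt hu)
  have h (p q : E) : ContDiffAt ℝ ∞ (fun u ↦ fderiv ℝ G u p q) u :=
    ((hG.contDiffAt hu).fderiv_apply_const p).clm_apply contDiffAt_const
  have hf : ContDiffAt ℝ ∞ (fun u ↦ ((fderiv ℝ G u).flip v).flip w) u :=
    (((hG.contDiffAt hu).fderiv_right (m := ∞) (by simp)).clm_flip_apply_const v).clm_flip_apply_const w
  exact hi.clm_apply ((((h v w).add (h w v)).sub hf).const_smul (1 / 2 : ℝ))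

theorem contDiffAt_christoffelMap [FiniteDimensional ℝ E] (hu : u ∈ U) :
    ContDiffAt ℝ ∞ (christoffelMap G) u := by
  have : CompleteSpace E := FiniteDimensional.complete ℝ E
  exact .of_forall_clm_apply fun v ↦ .of_forall_clm_apply fun w ↦ hG.contDiffAt_christoffelOf hu v w

/-- This is the relation between `christoffelOf` and `loweredChristoffel`, differentiated along `x`,
with `∂ₓ G` rewritten by metric compatibility. The left side is half of the lowered curvature. -/
theorem form_fderiv_christoffelOf [CompleteSpace E] (hu : u ∈ U) (x y z w : E) :
    G u (fderiv ℝ (fun u ↦ christoffelOf G u y z) u x) w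
        + G u (christoffelOf G u x (christoffelOf G u y z)) w
      = fderiv ℝ (fun u ↦ loweredChristoffel G u y z w) u x
        - G u (christoffelOf G u y z) (christoffelOf G u x w) := by
  have hΓ := hasDerivAt_along ((hG.contDiffAt_christoffelOf hu y z).differentiableAt (by simp)) x
  have h1 := (hasDerivAt_along (hG.differentiableAt hu) x).bilin_apply hΓ (hasDerivAt_const 0 w)
  have h2 := hasDerivAt_along ((hG.contDiffAt_loweredChristoffel hu y z w).differentiableAt
    (by simp)) x
  have h3 : (fun t : ℝ ↦ G (u + t • x) (christoffelOf G (u + t • x) y z) w) =ᶠ[𝓝 0]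
      fun t ↦ loweredChristoffel G (u + t • x) y z w := by
    have : Filter.Tendsto (fun t : ℝ ↦ u + t • x) (𝓝 0) (𝓝 u) :=
      Continuous.tendsto' (by fun_prop) _ _ (by simp)
    filter_upwards [this (hG.isOpen.mem_nhds hu)] with p hp using hG.form_christoffelOf hp y z w
  have h4 := (h1.congr_of_eventuallyEq h3.symm).unique h2
  simp only [zero_smul, add_zero, map_zero] at h4
  have h5 := hG.fderiv_apply hu x (christoffelOf G u y z) w
  linarith

/-- Self-adjointness of the Jacobi operator `x ↦ R(x, y) y`, the source of the conserved Wronskian.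
After lowering an index, the products of Christoffel symbols are visibly symmetric in `x` and `w`;
the second derivatives of `G` are so because mixed partials commute (`hs`) and `G` is symmetric
(`ht`). -/
theorem form_curvatureOf [CompleteSpace E] (hu : u ∈ U) (x y w : E) :
    G u (curvatureOf G u x y y) w = G u (curvatureOf G u w y y) x := by
  have e (x w : E) : G u (curvatureOf G u x y y) w
      = fderiv ℝ (fun u ↦ loweredChristoffel G u y y w) u x
        - fderiv ℝ (fun u ↦ loweredChristoffel G u x y w) u y
        - G u (christoffelOf G u y y) (christoffelOf G u x w)
        + G u (christoffelOf G u x y) (christoffelOf G u y w) := by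
    have h1 := hG.form_fderiv_christoffelOf hu x y y w
    have h2 := hG.form_fderiv_christoffelOf hu y x y w
    simp only [curvatureOf, map_add, map_sub, add_apply, sub_apply]
    linarith
  have hs := hG.fderiv_fderiv_comm hu
  have ht (a b p q : E) : fderiv ℝ (fun u ↦ fderiv ℝ G u b p q) u a
      = fderiv ℝ (fun u ↦ fderiv ℝ G u b q p) u a := by
    congr 1
    refine Filter.EventuallyEq.fderiv_eq ?_
    filter_upwards [hG.isOpen.mem_nhds hu] with y hy using hG.fderiv_symm hy b p q
  rw [e, e]
  simp only [hG.fderiv_loweredChristoffel hu]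
  rw [hG.christoffelOf_symm hu w x, hG.symm u hu (christoffelOf G u w y),
    hG.christoffelOf_symm hu w y, hG.christoffelOf_symm hu x y]
  linear_combination hs x y y w + 1 / 2 * ht y x y w - 1 / 2 * hs x w y y - 1 / 2 * ht y y x w
    - hs w y y x + 1 / 2 * ht y w x y

/-- The Levi-Civita connection is natural under changes of coordinates. -/
theorem christoffelOf_pullback {G' : E → E →L[ℝ] E →L[ℝ] ℝ} {U' : Set E}
    (hG' : IsMetricOn G' U') {τ : E → E} (hu : u ∈ U) (hτu : τ u ∈ U')
    (hτ : ContDiffAt ℝ ∞ τ u) (hsurj : Function.Surjective (fderiv ℝ τ u))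
    (h : ∀ᶠ u in 𝓝 u, ∀ v w, G u v w = G' (τ u) (fderiv ℝ τ u v) (fderiv ℝ τ u w)) (v w : E) :
    fderiv ℝ τ u (christoffelOf G u v w) = fderiv ℝ (fderiv ℝ τ) u v w
      + christoffelOf G' (τ u) (fderiv ℝ τ u v) (fderiv ℝ τ u w) := by
  have hτ2 : DifferentiableAt ℝ (fderiv ℝ τ) u :=
    (hτ.fderiv_right (m := ∞) (by simp)).differentiableAt (by simp)
  have hs : IsSymmSndFDerivAt ℝ τ u := hτ.isSymmSndFDerivAt minSmoothness_le_infty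
  -- Differentiating the pullback relation produces two terms with the second derivative of `τ`. In
  -- the combination that defines the Christoffel symbols, all of these cancel except twice the one
  -- with `D²τ(v, w)`.
  have e (x v w : E) : fderiv ℝ G u x v w
      = fderiv ℝ G' (τ u) (fderiv ℝ τ u x) (fderiv ℝ τ u v) (fderiv ℝ τ u w)
        + G' (τ u) (fderiv ℝ (fderiv ℝ τ) u x v) (fderiv ℝ τ u w)
        + G' (τ u) (fderiv ℝ τ u v) (fderiv ℝ (fderiv ℝ τ) u x w) := by
    have hv (v : E) := (hasDerivAt_along hτ2 x).clm_apply (hasDerivAt_const 0 v)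
    have hx := hasDerivAt_along (hτ.differentiableAt (by simp)) x
    have h1 := (hasDerivAt_along (hG.differentiableAt hu) x).bilin_apply
      (hasDerivAt_const 0 v) (hasDerivAt_const 0 w)
    have h2 := (HasFDerivAt.comp_hasDerivAt_of_eq 0 (hG'.differentiableAt hτu).hasFDerivAt hx
      (by simp)).bilin_apply (hv v) (hv w)
    have h3 : (fun t : ℝ ↦ G (u + t • x) v w) =ᶠ[𝓝 0] fun t ↦ (G' ∘ fun t ↦ τ (u + t • x)) t
        (fderiv ℝ τ (u + t • x) v) (fderiv ℝ τ (u + t • x) w) := by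
      have : Filter.Tendsto (fun t : ℝ ↦ u + t • x) (𝓝 0) (𝓝 u) :=
        Continuous.tendsto' (by fun_prop) _ _ (by simp)
      filter_upwards [this h] with y hy using hy v w
    have h4 := (h1.congr_of_eventuallyEq h3.symm).unique h2
    simpa using h4
  refine eq_of_forall_form_eq (hG'.invertible _ hτu) fun x' ↦ ?_
  obtain ⟨x, rfl⟩ := hsurj x'
  rw [← h.self_of_nhds, hG.form_christoffelOf hu, map_add, add_apply,
    hG'.form_christoffelOf hτu, loweredChristoffel, loweredChristoffel, e, e, e,
    hs w v, hs x v, hs x w, hG'.symm _ hτu (fderiv ℝ (fderiv ℝ τ) u v x)]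
  rw [hG'.symm _ hτu (fderiv ℝ τ u v)]
  ring

end IsMetricOn

end Coordinates

/-! ### Covariant derivatives along curves and variations of geodesics in coordinates -/

section CoordinateCurves

variable {E : Type*} [NormedAddCommGroup E] [NormedSpace ℝ E]

/-- The covariant derivative `v̇ + Γ(ẋ, v)` of a field along a curve in coordinates. -/
def covAlong (G : E → E →L[ℝ] E →L[ℝ] ℝ) (x v : ℝ → E) (r : ℝ) : E :=
  deriv v r + christoffelOf G (x r) (deriv x r) (v r)

theorem two_le_infty : (2 : WithTop ℕ∞) ≤ ∞ :=
  WithTop.coe_le_coe.mpr (le_top : (2 : ℕ∞) ≤ ⊤)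

theorem fderiv_apply_comm {V F : Type*} [NormedAddCommGroup V] [NormedSpace ℝ V]
    [NormedAddCommGroup F] [NormedSpace ℝ F] {f : V → F} {u : V} (hf : ContDiffAt ℝ 2 f u)
    (a b : V) : fderiv ℝ (fun u ↦ fderiv ℝ f u b) u a = fderiv ℝ (fun u ↦ fderiv ℝ f u a) u b := by
  have e (a b : V) : fderiv ℝ (fun u ↦ fderiv ℝ f u b) u a = fderiv ℝ (fderiv ℝ f) u a b := by
    have h2 := (hf.fderiv_right (m := 1) (by norm_num)).differentiableAt (by simp)
    have h3 := hasDerivAt_along (h2.clm_apply (differentiableAt_const b)) a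
    simpa using h3.unique ((hasDerivAt_along h2 a).clm_apply (hasDerivAt_const 0 b))
  rw [e, e]
  exact hf.isSymmSndFDerivAt (by simp) a b

theorem hasDerivAt_slice {P F : Type*} [NormedAddCommGroup P] [NormedSpace ℝ P]
    [NormedAddCommGroup F] [NormedSpace ℝ F] {f : P × ℝ → F} {q : P} {s : ℝ}
    (hf : DifferentiableAt ℝ f (q, s)) :
    HasDerivAt (fun r ↦ f (q, r)) (fderiv ℝ f (q, s) (0, 1)) s :=
  HasFDerivAt.comp_hasDerivAt s hf.hasFDerivAt
    ((hasDerivAt_const s q).prodMk (hasDerivAt_id s))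

theorem ContDiffAt.eventually_infty {V F : Type*} [NormedAddCommGroup V] [NormedSpace ℝ V]
    [NormedAddCommGroup F] [NormedSpace ℝ F] {f : V → F} {u : V} (hf : ContDiffAt ℝ ∞ f u)
    (n : ℕ) : ∀ᶠ u in 𝓝 u, ContDiffAt ℝ n f u :=
  (hf.of_le (mod_cast le_top)).eventually (by simp)

theorem ContDiffAt.eventually_differentiableAt {V F : Type*} [NormedAddCommGroup V]
    [NormedSpace ℝ V] [NormedAddCommGroup F] [NormedSpace ℝ F] {f : V → F} {u : V}
    (hf : ContDiffAt ℝ ∞ f u) : ∀ᶠ u in 𝓝 u, DifferentiableAt ℝ f u := by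
  filter_upwards [hf.eventually_infty 1] with u hu using hu.differentiableAt (by simp)

theorem ContDiffAt.deriv_infty {F : Type*} [NormedAddCommGroup F] [NormedSpace ℝ F] {f : ℝ → F}
    {s : ℝ} (hf : ContDiffAt ℝ ∞ f s) : ContDiffAt ℝ ∞ (deriv f) s :=
  hf.fderiv_apply_const 1

namespace IsMetricOn

variable {G : E → E →L[ℝ] E →L[ℝ] ℝ} {U : Set E} (hG : IsMetricOn G U)
include hG

/-- Differentiating `dτ(v)` along the curve produces the second derivative of `τ`, which is the
correction term in `christoffelOf_pullback`. -/
theorem covAlong_pullback {G' : E → E →L[ℝ] E →L[ℝ] ℝ} {U' : Set E}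
    (hG' : IsMetricOn G' U') {τ : E → E} {x v : ℝ → E} {r : ℝ} (hu : x r ∈ U) (hτu : τ (x r) ∈ U')
    (hτ : ContDiffAt ℝ ∞ τ (x r)) (hsurj : Function.Surjective (fderiv ℝ τ (x r)))
    (h : ∀ᶠ u in 𝓝 (x r), ∀ v w, G u v w = G' (τ u) (fderiv ℝ τ u v) (fderiv ℝ τ u w))
    (hx : DifferentiableAt ℝ x r) (hv : DifferentiableAt ℝ v r) :
    covAlong G' (fun r ↦ τ (x r)) (fun r ↦ fderiv ℝ τ (x r) (v r)) r
      = fderiv ℝ τ (x r) (covAlong G x v r) := by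
  have hτ2 : DifferentiableAt ℝ (fderiv ℝ τ) (x r) :=
    (hτ.fderiv_right (m := ∞) (by simp)).differentiableAt (by simp)
  have h1 : HasDerivAt (fun r ↦ τ (x r)) _ r :=
    (hτ.differentiableAt (by simp)).hasFDerivAt.comp_hasDerivAt r hx.hasDerivAt
  have h2 : HasDerivAt (fun r ↦ fderiv ℝ τ (x r)) _ r :=
    hτ2.hasFDerivAt.comp_hasDerivAt r hx.hasDerivAt
  rw [covAlong, covAlong, map_add, hG.christoffelOf_pullback hG' hu hτu hτ hsurj h, h1.deriv,
    (h2.clm_apply hv.hasDerivAt).deriv]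
  abel

theorem hasDerivAt_form {x v w : ℝ → E} {r : ℝ} (hu : x r ∈ U) (hx : DifferentiableAt ℝ x r)
    (hv : DifferentiableAt ℝ v r) (hw : DifferentiableAt ℝ w r) :
    HasDerivAt (fun r ↦ G (x r) (v r) (w r))
      (G (x r) (covAlong G x v r) (w r) + G (x r) (v r) (covAlong G x w r)) r := by
  have h1 : HasDerivAt (fun r ↦ G (x r)) _ r :=
    (hG.differentiableAt hu).hasFDerivAt.comp_hasDerivAt r hx.hasDerivAt
  refine (h1.bilin_apply hv.hasDerivAt hw.hasDerivAt).congr_deriv ?_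
  rw [hG.fderiv_apply hu, covAlong, covAlong]
  simp only [map_add, add_apply]
  ring

theorem contDiffAt_covAlong [FiniteDimensional ℝ E] {x v : ℝ → E} {s : ℝ} (hu : x s ∈ U)
    (hx : ContDiffAt ℝ ∞ x s) (hv : ContDiffAt ℝ ∞ v s) : ContDiffAt ℝ ∞ (covAlong G x v) s :=
  hv.deriv_infty.add
    ((((hG.contDiffAt_christoffelMap hu).comp s hx).clm_apply hx.deriv_infty).clm_apply hv)

/-- The symmetry lemma `∇ₛ ∂_w X = ∇_w ∂ₛ X`. -/
theorem covAlong_comm {V : Type*} [NormedAddCommGroup V] [NormedSpace ℝ V] {X : V → E} {q : V}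
    (hX : ContDiffAt ℝ ∞ X q) (hu : X q ∈ U) (a b : V) :
    fderiv ℝ (fun q ↦ fderiv ℝ X q b) q a + christoffelOf G (X q) (fderiv ℝ X q a) (fderiv ℝ X q b)
      = fderiv ℝ (fun q ↦ fderiv ℝ X q a) q b
        + christoffelOf G (X q) (fderiv ℝ X q b) (fderiv ℝ X q a) := by
  rw [fderiv_apply_comm (hX.of_le two_le_infty), hG.christoffelOf_symm hu]

/-- The variation field of a family of geodesics is a Jacobi field. -/
theorem jacobi_of_variation [FiniteDimensional ℝ E] {P : Type*} [NormedAddCommGroup P]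
    [NormedSpace ℝ P] {X : P × ℝ → E} {q : P} {s : ℝ} (hX : ContDiffAt ℝ ∞ X (q, s))
    (hu : X (q, s) ∈ U)
    (hgeo : ∀ᶠ q' in 𝓝 q, covAlong G (fun r ↦ X (q', r)) (deriv fun r ↦ X (q', r)) s = 0) (w : P) :
    covAlong G (fun r ↦ X (q, r))
        (covAlong G (fun r ↦ X (q, r)) fun r ↦ fderiv ℝ X (q, r) (w, 0)) s
      + curvatureOf G (X (q, s)) (fderiv ℝ X (q, s) (w, 0)) (fderiv ℝ X (q, s) (0, 1))
          (fderiv ℝ X (q, s) (0, 1)) = 0 := by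
  have hΓ := (hG.contDiffAt_christoffelMap hu).comp (q, s) hX
  have hXa (a : P × ℝ) := hX.fderiv_apply_const a
  have hXab (a b : P × ℝ) := (hXa b).fderiv_apply_const a
  have slice : Filter.Tendsto (fun r : ℝ ↦ (q, r)) (𝓝 s) (𝓝 (q, s)) :=
    Continuous.tendsto (by fun_prop) s
  have sliceP : Filter.Tendsto (fun q' : P ↦ (q', s)) (𝓝 q) (𝓝 (q, s)) :=
    Continuous.tendsto (by fun_prop) q
  have hx' : ∀ᶠ u in 𝓝 (q, s), HasDerivAt (fun r ↦ X (u.1, r)) (fderiv ℝ X u (0, 1)) u.2 := by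
    filter_upwards [hX.eventually_differentiableAt] with u hu using hasDerivAt_slice hu
  -- the first covariant derivative near `s`
  let H : P × ℝ → E := fun u ↦ fderiv ℝ (fun u ↦ fderiv ℝ X u (w, 0)) u (0, 1)
    + christoffelMap G (X u) (fderiv ℝ X u (0, 1)) (fderiv ℝ X u (w, 0))
  have hH : (covAlong G (fun r ↦ X (q, r)) fun r ↦ fderiv ℝ X (q, r) (w, 0))
      =ᶠ[𝓝 s] fun r ↦ H (q, r) := by
    filter_upwards [slice hx', slice (hXa (w, 0)).eventually_differentiableAt] with r h1 h2
    simp only [covAlong, h1.deriv, (hasDerivAt_slice h2).deriv, H, christoffelMap_apply]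
  -- `K` is the covariant acceleration of the curves. It is known to vanish only at the fixed time
  -- `s`, for all nearby parameters; this suffices, as it is differentiated only in the parameter
  -- direction `w`.
  let K : P × ℝ → E := fun u ↦ fderiv ℝ (fun u ↦ fderiv ℝ X u (0, 1)) u (0, 1)
    + christoffelMap G (X u) (fderiv ℝ X u (0, 1)) (fderiv ℝ X u (0, 1))
  have hK : (fun q' ↦ K (q', s)) =ᶠ[𝓝 q] fun _ ↦ 0 := by
    filter_upwards [hgeo, sliceP hx'.eventually_nhds,
      sliceP (hXa (0, 1)).eventually_differentiableAt] with q' h0 h1 h2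
    have h3 : deriv (fun r ↦ X (q', r)) =ᶠ[𝓝 s] fun r ↦ fderiv ℝ X (q', r) (0, 1) := by
      have : Filter.Tendsto (fun r : ℝ ↦ (q', r)) (𝓝 s) (𝓝 (q', s)) :=
        Continuous.tendsto (by fun_prop) s
      filter_upwards [this h1] with r hr using hr.deriv
    rw [covAlong, h3.deriv_eq, h3.eq_of_nhds, (hasDerivAt_slice h2).deriv] at h0
    simpa only [K, christoffelMap_apply] using h0
  have d {F : Type _} [NormedAddCommGroup F] [NormedSpace ℝ F] {f : P × ℝ → F}
      (hf : ContDiffAt ℝ ∞ f (q, s)) (a : P × ℝ) :=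
    hasDerivAt_along (hf.differentiableAt (by simp)) a
  have dΓ (a : P × ℝ) : HasDerivAt (fun t : ℝ ↦ christoffelMap G (X ((q, s) + t • a)))
      (fderiv ℝ (christoffelMap G) (X (q, s)) (fderiv ℝ X (q, s) a)) 0 :=
    HasFDerivAt.comp_hasDerivAt_of_eq 0 ((hG.contDiffAt_christoffelMap hu).differentiableAt
      (by simp)).hasFDerivAt (d hX a) (by simp)
  have dH := (d (hXab (0, 1) (w, 0)) (0, 1)).add
    ((dΓ (0, 1)).bilin_apply (d (hXa (0, 1)) (0, 1)) (d (hXa (w, 0)) (0, 1)))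
  have dK := (d (hXab (0, 1) (0, 1)) (w, 0)).add
    ((dΓ (w, 0)).bilin_apply (d (hXa (0, 1)) (w, 0)) (d (hXa (0, 1)) (w, 0)))
  have hHs : ContDiffAt ℝ ∞ H (q, s) :=
    (hXab (0, 1) (w, 0)).add ((hΓ.clm_apply (hXa (0, 1))).clm_apply (hXa (w, 0)))
  have hH' := hasDerivAt_slice (hHs.differentiableAt (by simp))
  have hH'' := (d hHs (0, 1)).unique dH
  have hK' := dK.unique (((hasDerivAt_const (0 : ℝ) (0 : E)).congr_of_eventuallyEq (by
    have : Filter.Tendsto (fun t : ℝ ↦ q + t • w) (𝓝 0) (𝓝 q) :=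
      Continuous.tendsto' (by fun_prop) _ _ (by simp)
    filter_upwards [this hK] with t ht
    simpa [K] using ht)))
  have dΓc (a : E) (y z : E) : fderiv ℝ (fun u ↦ christoffelOf G u y z) (X (q, s)) a
      = fderiv ℝ (christoffelMap G) (X (q, s)) a y z := by
    have h1 := hasDerivAt_along (((hG.contDiffAt_christoffelMap hu)).differentiableAt (by simp)) a
    have h2 := h1.bilin_apply (hasDerivAt_const 0 y) (hasDerivAt_const 0 z)
    have : CompleteSpace E := FiniteDimensional.complete ℝ E
    have h3 := hasDerivAt_along ((hG.contDiffAt_christoffelOf hu y z).differentiableAt (by simp)) a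
    simpa [-christoffelMap_apply] using h3.unique h2
  have dΓs (a : E) (y z : E) : fderiv ℝ (fun u ↦ christoffelOf G u y z) (X (q, s)) a
      = fderiv ℝ (fun u ↦ christoffelOf G u z y) (X (q, s)) a := by
    congr 1
    refine Filter.EventuallyEq.fderiv_eq ?_
    filter_upwards [hG.isOpen.mem_nhds hu] with u hu using hG.christoffelOf_symm hu y z
  have hK0 : K (q, s) = 0 := hK.self_of_nhds
  -- The third derivatives `∂ₛ∂ₛ∂_w X` and `∂_w∂ₛ∂ₛ X` agree; these are the leading terms of the
  -- second covariant derivative of the variation field and of `∂_w K = 0`.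
  have c1 : fderiv ℝ (fun u ↦ fderiv ℝ (fun u ↦ fderiv ℝ X u (w, 0)) u (0, 1)) (q, s) (0, 1)
      = fderiv ℝ (fun u ↦ fderiv ℝ (fun u ↦ fderiv ℝ X u (0, 1)) u (0, 1)) (q, s) (w, 0) := by
    rw [← fderiv_apply_comm ((hXa (0, 1)).of_le two_le_infty) (0, 1) (w, 0)]
    congr 1
    refine Filter.EventuallyEq.fderiv_eq ?_
    filter_upwards [hX.eventually_infty 2] with u hu using fderiv_apply_comm hu _ _
  have c2 := fderiv_apply_comm (hX.of_le two_le_infty) (w, 0) (0, 1)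
  rw [covAlong, hH.deriv_eq, hH.eq_of_nhds, hH'.deriv, hH'',
    (hasDerivAt_slice (hX.differentiableAt (by simp))).deriv, curvatureOf, dΓc, dΓc, c1]
  simp only [zero_smul, add_zero, H, K, christoffelMap_apply, c2, christoffelOf_add_right] at hK' hK0 ⊢
  -- The geodesic equation replaces `∂ₛ∂ₛ X` by a Christoffel term. The difference from `∂_w K` is
  -- then purely algebraic in the Christoffel symbols and their first derivatives, and the curvature
  -- term cancels it.
  have c3 : fderiv ℝ (fun u ↦ fderiv ℝ X u (0, 1)) (q, s) (0, 1)
      = (-1 : ℝ) • christoffelOf G (X (q, s)) (fderiv ℝ X (q, s) (0, 1))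
          (fderiv ℝ X (q, s) (0, 1)) := by
    rw [neg_one_smul]
    exact eq_neg_of_add_eq_zero_left hK0
  rw [hG.christoffelOf_symm hu _ (fderiv ℝ X (q, s) (0, 1))] at hK'
  rw [c3, christoffelOf_smul_left, hG.christoffelOf_symm hu (fderiv ℝ X (q, s) (w, 0)) (fderiv _ _ _ _),
    hG.christoffelOf_symm hu (fderiv ℝ X (q, s) (w, 0)),
    ← dΓc _ (fderiv ℝ X (q, s) (w, 0)), dΓs, dΓc]
  rw [← hK']
  module

end IsMetricOn

end CoordinateCurves

theorem isInvertible_of_nondegenerate {E : Type*} [NormedAddCommGroup E] [NormedSpace ℝ E]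
    [FiniteDimensional ℝ E] {B : E →L[ℝ] E →L[ℝ] ℝ} (hB : ∀ u, (∀ w, B u w = 0) → u = 0) :
    B.IsInvertible := by
  have hinj : Function.Injective B := (injective_iff_map_eq_zero B).2 fun u hu ↦
    hB u fun w ↦ by simp [hu]
  have hd : Module.finrank ℝ E = Module.finrank ℝ (E →L[ℝ] ℝ) := by
    rw [← (LinearMap.toContinuousLinearMap (𝕜 := ℝ) (E := E) (F' := ℝ)).finrank_eq]
    exact (Subspace.dual_finrank_eq).symm
  exact ⟨(LinearEquiv.ofInjectiveOfFinrankEq (B : E →ₗ[ℝ] E →L[ℝ] ℝ) hinj hd).toContinuousLinearEquiv,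
    by ext; rfl⟩

theorem isInvertible_bilinearComp {E : Type*} [NormedAddCommGroup E] [NormedSpace ℝ E]
    [FiniteDimensional ℝ E] {B : E →L[ℝ] E →L[ℝ] ℝ} {D : E →L[ℝ] E} (hB : B.IsInvertible)
    (hD : D.IsInvertible) : (B.bilinearComp D D).IsInvertible := by
  refine isInvertible_of_nondegenerate fun v hv ↦ hD.injective ?_
  refine eq_of_forall_form_eq hB fun w ↦ ?_
  obtain ⟨w, rfl⟩ := hD.surjective w
  simpa using hv w

/-! ### Tangent vectors and vector fields in charts of the manifold -/

section Charts

variable {E : Type*} [NormedAddCommGroup E] [NormedSpace ℝ E]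
  {M : Type*} [TopologicalSpace M] [ChartedSpace E M]

@[simp]
theorem chartVec_add (p x : M) (v w : TangentSpace 𝓘(ℝ, E) x) :
    chartVec p x (v + w) = chartVec p x v + chartVec p x w :=
  map_add (mfderiv 𝓘(ℝ, E) 𝓘(ℝ, E) (extChartAt 𝓘(ℝ, E) p) x) v w

@[simp]
theorem chartVec_smul (p x : M) (c : ℝ) (v : TangentSpace 𝓘(ℝ, E) x) :
    chartVec p x (c • v) = c • chartVec p x v :=
  map_smul (mfderiv 𝓘(ℝ, E) 𝓘(ℝ, E) (extChartAt 𝓘(ℝ, E) p) x) c v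

@[simp]
theorem chartVec_zero (p x : M) : chartVec p x (0 : TangentSpace 𝓘(ℝ, E) x) = 0 :=
  map_zero (mfderiv 𝓘(ℝ, E) 𝓘(ℝ, E) (extChartAt 𝓘(ℝ, E) p) x)

variable [IsManifold 𝓘(ℝ, E) ∞ M]

theorem isManifold_one_of_infty (E M : Type*) [NormedAddCommGroup E] [NormedSpace ℝ E]
    [TopologicalSpace M] [ChartedSpace E M] [IsManifold 𝓘(ℝ, E) ∞ M] :
    IsManifold 𝓘(ℝ, E) 1 M :=
  IsManifold.of_le (n := ∞) (by simp)

theorem chartVec_bijective (p : M) {x : M} (hx : x ∈ (chartAt E p).source) :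
    Function.Bijective (chartVec p x : TangentSpace 𝓘(ℝ, E) x → E) := by
  have := isManifold_one_of_infty E M
  exact (isInvertible_mfderiv_extChartAt (by simpa using hx)).bijective

theorem mfderiv_extChartAt_symm_chartVec (p : M) {x : M} (hx : x ∈ (chartAt E p).source)
    (v : TangentSpace 𝓘(ℝ, E) x) :
    mfderiv 𝓘(ℝ, E) 𝓘(ℝ, E) (extChartAt 𝓘(ℝ, E) p).symm (extChartAt 𝓘(ℝ, E) p x)
      (chartVec p x v : E) = v := by
  have := isManifold_one_of_infty E M
  have h := mfderivWithin_extChartAt_symm_comp_mfderiv_extChartAt' (I := 𝓘(ℝ, E)) (x := p) (y := x)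
    (by simpa using hx)
  rw [modelWithCornersSelf_coe, range_id, mfderivWithin_univ] at h
  exact congrArg (fun L ↦ L v) h

/-- The fibre coordinate of the trivialization of the tangent bundle at `p` is the differential of
the chart at `p`, that is, `chartVec p`. -/
theorem contMDiffAt_tangent_iff {N : Type*} [NormedAddCommGroup N] [NormedSpace ℝ N] {c : N → M}
    {V : (q : N) → TangentSpace 𝓘(ℝ, E) (c q)} {q : N} {p : M} (hp : c q ∈ (chartAt E p).source) :
    ContMDiffAt 𝓘(ℝ, N) (𝓘(ℝ, E)).tangent ∞ (fun r ↦ (⟨c r, V r⟩ : TangentBundle 𝓘(ℝ, E) M)) q ↔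
      ContMDiffAt 𝓘(ℝ, N) 𝓘(ℝ, E) ∞ c q ∧ ContDiffAt ℝ ∞ (fun r ↦ chartVec p (c r) (V r)) q := by
  have := isManifold_one_of_infty E M
  rw [(trivializationAt E (TangentSpace 𝓘(ℝ, E)) p).contMDiffAt_iff
    ((Trivialization.mem_source _).2 (by simpa using hp))]
  refine and_congr_right fun hc ↦ ?_
  rw [← contMDiffAt_iff_contDiffAt]
  refine Filter.EventuallyEq.contMDiffAt_iff ?_
  filter_upwards [hc.continuousAt ((chartAt E p).open_source.mem_nhds hp)] with r hr
  rw [← Trivialization.continuousLinearMapAt_apply_of_mem (R := ℝ) _ (by simpa using hr),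
    TangentBundle.continuousLinearMapAt_trivializationAt hr]
  rfl

theorem contDiffAt_extChartAt_comp {N : Type*} [NormedAddCommGroup N] [NormedSpace ℝ N]
    {c : N → M} {q : N} (hc : ContMDiffAt 𝓘(ℝ, N) 𝓘(ℝ, E) ∞ c q) {p : M}
    (hp : c q ∈ (chartAt E p).source) :
    ContDiffAt ℝ ∞ (fun r ↦ extChartAt 𝓘(ℝ, E) p (c r)) q :=
  contMDiffAt_iff_contDiffAt.1 ((contMDiffAt_extChartAt' hp).comp q hc)

/-- The differential of a map into a manifold, read in a chart. -/
theorem chartVec_mfderiv {N : Type*} [NormedAddCommGroup N] [NormedSpace ℝ N]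
    {c : N → M} {q : N} (hc : MDifferentiableAt 𝓘(ℝ, N) 𝓘(ℝ, E) c q) {p : M}
    (hp : c q ∈ (chartAt E p).source) (w : N) :
    chartVec p (c q) (mfderiv 𝓘(ℝ, N) 𝓘(ℝ, E) c q w)
      = fderiv ℝ (fun r ↦ extChartAt 𝓘(ℝ, E) p (c r)) q w := by
  have h := mfderiv_comp q (mdifferentiableAt_extChartAt (I := 𝓘(ℝ, E)) hp) hc
  rw [← mfderiv_eq_fderiv]
  exact (congrArg (fun L ↦ L w) h).symm

theorem contDiffAt_transition (p q : M) {x : M} (hp : x ∈ (chartAt E p).source)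
    (hq : x ∈ (chartAt E q).source) :
    ContDiffAt ℝ ∞ (fun u ↦ extChartAt 𝓘(ℝ, E) q ((extChartAt 𝓘(ℝ, E) p).symm u))
      (extChartAt 𝓘(ℝ, E) p x) := by
  refine contDiffAt_extChartAt_comp ?_ ?_
  · exact (contMDiffOn_extChartAt_symm p).contMDiffAt (extChartAt_target_mem_nhds' (by simp [hp]))
  · simpa [hp] using hq

theorem chartVec_transition (p q : M) {x : M} (hp : x ∈ (chartAt E p).source)
    (hq : x ∈ (chartAt E q).source) (v : TangentSpace 𝓘(ℝ, E) x) :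
    chartVec q x v = fderiv ℝ (fun u ↦ extChartAt 𝓘(ℝ, E) q ((extChartAt 𝓘(ℝ, E) p).symm u))
      (extChartAt 𝓘(ℝ, E) p x) (chartVec p x v) := by
  have h1 : MDifferentiableAt 𝓘(ℝ, E) 𝓘(ℝ, E) (extChartAt 𝓘(ℝ, E) p).symm
      (extChartAt 𝓘(ℝ, E) p x) :=
    ((contMDiffOn_extChartAt_symm p).contMDiffAt (n := ∞)
      (extChartAt_target_mem_nhds' (by simp [hp]))).mdifferentiableAt (by simp)
  have hx : (extChartAt 𝓘(ℝ, E) p).symm (extChartAt 𝓘(ℝ, E) p x) = x :=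
    (extChartAt 𝓘(ℝ, E) p).left_inv (by simpa using hp)
  rw [← chartVec_mfderiv h1 (by rwa [hx]), mfderiv_extChartAt_symm_chartVec p hp]
  rw [hx]

end Charts

/-! ### The Lorentzian metric in a chart -/

namespace LorentzMetric

variable {E : Type*} [NormedAddCommGroup E] [NormedSpace ℝ E]
  {M : Type*} [TopologicalSpace M] [ChartedSpace E M] [IsManifold 𝓘(ℝ, E) ∞ M]
  (g : LorentzMetric E M)

theorem christoffel_eq (p : M) (u v w : E) :
    g.christoffel p u v w = christoffelOf (g.coordForm p) u v w := rfl

/-- A nonzero vector of the radical would be orthogonal to the timelike vector of the signature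
condition, hence have positive square, while its square is zero. -/
theorem form_isInvertible [FiniteDimensional ℝ E] (x : M) : (g.form x).IsInvertible := by
  refine isInvertible_of_nondegenerate (E := E) (B := g.form x) fun u hu ↦ ?_
  by_contra hne
  obtain ⟨v, -, hv⟩ := g.signature x
  exact (hv u ((g.symm x v u).trans (hu v)) hne).ne' (hu u)

theorem form_eq_coordForm (p : M) {x : M} (hx : x ∈ (chartAt E p).source)
    (v w : TangentSpace 𝓘(ℝ, E) x) :
    g.form x v w
      = g.coordForm p (extChartAt 𝓘(ℝ, E) p x) (chartVec p x v) (chartVec p x w) := by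
  have hx' : (extChartAt 𝓘(ℝ, E) p).symm (extChartAt 𝓘(ℝ, E) p x) = x :=
    (extChartAt 𝓘(ℝ, E) p).left_inv (by simpa using hx)
  change _ = g.form ((extChartAt 𝓘(ℝ, E) p).symm (extChartAt 𝓘(ℝ, E) p x))
    (mfderiv 𝓘(ℝ, E) 𝓘(ℝ, E) (extChartAt 𝓘(ℝ, E) p).symm (extChartAt 𝓘(ℝ, E) p x) (chartVec p x v : E))
    (mfderiv 𝓘(ℝ, E) 𝓘(ℝ, E) (extChartAt 𝓘(ℝ, E) p).symm (extChartAt 𝓘(ℝ, E) p x) (chartVec p x w : E))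
  rw [mfderiv_extChartAt_symm_chartVec p hx, mfderiv_extChartAt_symm_chartVec p hx, hx']

theorem isMetricOn_coordForm [FiniteDimensional ℝ E] (p : M) :
    IsMetricOn (g.coordForm p) (extChartAt 𝓘(ℝ, E) p).target := by
  have := isManifold_one_of_infty E M
  refine ⟨isOpen_extChartAt_target p, fun u hu ↦ ContDiffAt.contDiffWithinAt ?_,
    fun u _ v w ↦ g.symm _ _ _, fun u hu ↦ ?_⟩
  · refine .of_forall_clm_apply fun v ↦ .of_forall_clm_apply fun w ↦ ?_
    have hc : ContMDiffAt 𝓘(ℝ, E) 𝓘(ℝ, E) ∞ (extChartAt 𝓘(ℝ, E) p).symm u :=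
      (contMDiffOn_extChartAt_symm p).contMDiffAt ((isOpen_extChartAt_target p).mem_nhds hu)
    -- The coordinate vector fields are smooth sections, since their components in the chart are
    -- constant. Evaluating the smooth metric on them gives the smoothness of its matrix entries.
    have hs (v : E) : ContMDiffAt 𝓘(ℝ, E) (𝓘(ℝ, E)).tangent ∞
        (fun u ↦ (⟨(extChartAt 𝓘(ℝ, E) p).symm u,
          mfderiv 𝓘(ℝ, E) 𝓘(ℝ, E) (extChartAt 𝓘(ℝ, E) p).symm u v⟩ : TangentBundle 𝓘(ℝ, E) M)) u := by
      have hsrc {u : E} (hu : u ∈ (extChartAt 𝓘(ℝ, E) p).target) :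
          (extChartAt 𝓘(ℝ, E) p).symm u ∈ (chartAt E p).source := by
        simpa using (extChartAt 𝓘(ℝ, E) p).map_target hu
      refine (contMDiffAt_tangent_iff (hsrc hu)).2 ⟨hc, ?_⟩
      refine contDiffAt_const (c := v) |>.congr_of_eventuallyEq ?_
      filter_upwards [(isOpen_extChartAt_target (I := 𝓘(ℝ, E)) p).mem_nhds hu] with y hy
      rw [chartVec_mfderiv (((contMDiffOn_extChartAt_symm p).contMDiffAt (n := ∞)
        ((isOpen_extChartAt_target p).mem_nhds hy)).mdifferentiableAt (by simp)) (hsrc hy)]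
      have : (fun r ↦ extChartAt 𝓘(ℝ, E) p ((extChartAt 𝓘(ℝ, E) p).symm r)) =ᶠ[𝓝 y] id := by
        filter_upwards [(isOpen_extChartAt_target (I := 𝓘(ℝ, E)) p).mem_nhds hy] with z hz
          using (extChartAt 𝓘(ℝ, E) p).right_inv hz
      rw [this.fderiv_eq, fderiv_id]
      rfl
    have h : ContMDiffAt 𝓘(ℝ, E) ((𝓘(ℝ, E)).prod 𝓘(ℝ)) ∞
        (fun u ↦ TotalSpace.mk' ℝ (E := Bundle.Trivial M ℝ) ((extChartAt 𝓘(ℝ, E) p).symm u)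
          (g.coordForm p u v w)) u := by
      apply ContMDiffAt.clm_bundle_apply₂ (F₁ := E) (F₂ := E)
      · exact g.smooth.contMDiffAt.comp u hc
      · exact hs v
      · exact hs w
    rw [contMDiffAt_totalSpace] at h
    exact contMDiffAt_iff_contDiffAt.1 h.2
  · have hD : (mfderiv 𝓘(ℝ, E) 𝓘(ℝ, E) (extChartAt 𝓘(ℝ, E) p).symm u).IsInvertible := by
      simpa [mfderivWithin_univ] using isInvertible_mfderivWithin_extChartAt_symm (I := 𝓘(ℝ, E)) hu
    exact isInvertible_bilinearComp (E := E) (g.form_isInvertible _) hD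

end LorentzMetric

/-! ### Linearity of the covariant derivative and the curvature in coordinates -/

section CoordinateCurves

variable {E : Type*} [NormedAddCommGroup E] [NormedSpace ℝ E]

theorem covAlong_congr (G : E → E →L[ℝ] E →L[ℝ] ℝ) {x x' v v' : ℝ → E} {s : ℝ} (hx : x =ᶠ[𝓝 s] x')
    (hv : v =ᶠ[𝓝 s] v') : covAlong G x v s = covAlong G x' v' s := by
  rw [covAlong, covAlong, hx.deriv_eq, hv.deriv_eq, hx.eq_of_nhds, hv.eq_of_nhds]

theorem covAlong_add (G : E → E →L[ℝ] E →L[ℝ] ℝ) {x v w : ℝ → E} {s : ℝ}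
    (hv : DifferentiableAt ℝ v s) (hw : DifferentiableAt ℝ w s) :
    covAlong G x (fun r ↦ v r + w r) s = covAlong G x v s + covAlong G x w s := by
  have h : HasDerivAt (fun r ↦ v r + w r) _ s := hv.hasDerivAt.add hw.hasDerivAt
  rw [covAlong, covAlong, covAlong, h.deriv, christoffelOf_add_right]
  abel

theorem covAlong_smul (G : E → E →L[ℝ] E →L[ℝ] ℝ) {x v : ℝ → E} {f : ℝ → ℝ} {s : ℝ}
    (hf : DifferentiableAt ℝ f s) (hv : DifferentiableAt ℝ v s) :
    covAlong G x (fun r ↦ f r • v r) s = deriv f s • v s + f s • covAlong G x v s := by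
  have h : HasDerivAt (fun r ↦ f r • v r) _ s := hf.hasDerivAt.smul hv.hasDerivAt
  rw [covAlong, covAlong, h.deriv, christoffelOf_smul_right]
  module

theorem IsMetricOn.curvatureOf_add [CompleteSpace E] {G : E → E →L[ℝ] E →L[ℝ] ℝ} {U : Set E}
    (hG : IsMetricOn G U) {u : E} (hu : u ∈ U) (x x' y z : E) :
    curvatureOf G u (x + x') y z = curvatureOf G u x y z + curvatureOf G u x' y z := by
  have h (x : E) := (hG.contDiffAt_christoffelOf hu x z).differentiableAt (by simp)
  have h1 : HasFDerivAt (fun u ↦ christoffelOf G u (x + x') z) _ u :=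
    ((h x).hasFDerivAt.add (h x').hasFDerivAt).congr_of_eventuallyEq
      (.of_forall fun u ↦ christoffelOf_add_left G u x x' z)
  rw [curvatureOf, curvatureOf, curvatureOf, h1.fderiv]
  simp only [map_add, add_apply, christoffelOf_add_left,
    christoffelOf_add_right]
  abel

theorem IsMetricOn.curvatureOf_smul [CompleteSpace E] {G : E → E →L[ℝ] E →L[ℝ] ℝ} {U : Set E}
    (hG : IsMetricOn G U) {u : E} (hu : u ∈ U) (c : ℝ) (x y z : E) :
    curvatureOf G u (c • x) y z = c • curvatureOf G u x y z := by
  have h := (hG.contDiffAt_christoffelOf hu x z).differentiableAt (by simp)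
  have h1 : HasFDerivAt (fun u ↦ christoffelOf G u (c • x) z) _ u :=
    (h.hasFDerivAt.const_smul c).congr_of_eventuallyEq
      (.of_forall fun u ↦ christoffelOf_smul_left G c u x z)
  rw [curvatureOf, curvatureOf, h1.fderiv]
  simp only [map_smul, smul_apply, christoffelOf_smul_left,
    christoffelOf_smul_right]
  module

theorem curvatureOf_self (G : E → E →L[ℝ] E →L[ℝ] ℝ) (u x z : E) : curvatureOf G u x x z = 0 := by
  simp [curvatureOf]

end CoordinateCurves

/-! ### Smooth fields along curves and chart independence of the covariant derivative -/

section FieldsAlongCurves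

variable {E : Type*} [NormedAddCommGroup E] [NormedSpace ℝ E]
  {M : Type*} [TopologicalSpace M] [ChartedSpace E M]

theorem ContMDiffAt.eventually_mem_source {N : Type*} [NormedAddCommGroup N]
    [NormedSpace ℝ N] {c : N → M} {q : N} (hc : ContMDiffAt 𝓘(ℝ, N) 𝓘(ℝ, E) ∞ c q) {p : M}
    (hp : c q ∈ (chartAt E p).source) : ∀ᶠ r in 𝓝 q, c r ∈ (chartAt E p).source :=
  hc.continuousAt ((chartAt E p).open_source.mem_nhds hp)

variable [IsManifold 𝓘(ℝ, E) ∞ M]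

/-- A vector field along a curve is smooth at a parameter. -/
def SmoothFieldAt (γ : ℝ → M) (V : (s : ℝ) → TangentSpace 𝓘(ℝ, E) (γ s)) (s : ℝ) : Prop :=
  ContMDiffAt 𝓘(ℝ, ℝ) (𝓘(ℝ, E)).tangent ∞ (fun r ↦ (⟨γ r, V r⟩ : TangentBundle 𝓘(ℝ, E) M)) s

variable {γ : ℝ → M} {V W : (s : ℝ) → TangentSpace 𝓘(ℝ, E) (γ s)} {s : ℝ}

theorem smoothFieldAt_iff {p : M} (hp : γ s ∈ (chartAt E p).source) : SmoothFieldAt γ V s ↔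
    ContMDiffAt 𝓘(ℝ, ℝ) 𝓘(ℝ, E) ∞ γ s ∧ ContDiffAt ℝ ∞ (fun r ↦ chartVec p (γ r) (V r)) s :=
  contMDiffAt_tangent_iff hp

theorem SmoothFieldAt.curve (hV : SmoothFieldAt γ V s) : ContMDiffAt 𝓘(ℝ, ℝ) 𝓘(ℝ, E) ∞ γ s :=
  ((smoothFieldAt_iff (mem_chart_source E _)).1 hV).1

theorem SmoothFieldAt.chart (hV : SmoothFieldAt γ V s) {p : M} (hp : γ s ∈ (chartAt E p).source) :
    ContDiffAt ℝ ∞ (fun r ↦ chartVec p (γ r) (V r)) s :=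
  ((smoothFieldAt_iff hp).1 hV).2

theorem SmoothFieldAt.add (hV : SmoothFieldAt γ V s) (hW : SmoothFieldAt γ W s) :
    SmoothFieldAt γ (fun r ↦ V r + W r) s := by
  refine (smoothFieldAt_iff (mem_chart_source E _)).2 ⟨hV.curve, ?_⟩
  simpa using (hV.chart (mem_chart_source E _)).add (hW.chart (mem_chart_source E _))

theorem SmoothFieldAt.smul (hV : SmoothFieldAt γ V s) {f : ℝ → ℝ} (hf : ContDiffAt ℝ ∞ f s) :
    SmoothFieldAt γ (fun r ↦ f r • V r) s := by
  refine (smoothFieldAt_iff (mem_chart_source E _)).2 ⟨hV.curve, ?_⟩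
  simpa using! hf.smul (hV.chart (mem_chart_source E _))

theorem ContMDiffAt.eventually_mdifferentiableAt {N : Type*} [NormedAddCommGroup N]
    [NormedSpace ℝ N] {c : N → M} {q : N} (hc : ContMDiffAt 𝓘(ℝ, N) 𝓘(ℝ, E) ∞ c q) :
    ∀ᶠ r in 𝓝 q, MDifferentiableAt 𝓘(ℝ, N) 𝓘(ℝ, E) c r := by
  have := isManifold_one_of_infty E M
  have h : ContMDiffAt 𝓘(ℝ, N) 𝓘(ℝ, E) 1 c q := hc.of_le (by simp)
  filter_upwards [(contMDiffAt_iff_contMDiffAt_nhds (by simp)).1 h] with r hr using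
    hr.mdifferentiableAt (by simp)

theorem chartVec_velocity (hγ : MDifferentiableAt 𝓘(ℝ, ℝ) 𝓘(ℝ, E) γ s) {p : M}
    (hp : γ s ∈ (chartAt E p).source) :
    chartVec p (γ s) (velocity E γ s) = deriv (fun r ↦ extChartAt 𝓘(ℝ, E) p (γ r)) s :=
  chartVec_mfderiv hγ hp 1

theorem smoothFieldAt_velocity (hγ : ContMDiffAt 𝓘(ℝ, ℝ) 𝓘(ℝ, E) ∞ γ s) :
    SmoothFieldAt γ (velocity E γ) s := by
  refine (smoothFieldAt_iff (mem_chart_source E _)).2 ⟨hγ, ?_⟩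
  refine (contDiffAt_extChartAt_comp hγ (mem_chart_source E _)).deriv_infty.congr_of_eventuallyEq ?_
  filter_upwards [hγ.eventually_mdifferentiableAt, hγ.eventually_mem_source (mem_chart_source E _)]
    with r h1 h2 using chartVec_velocity h1 h2

namespace LorentzMetric

variable (g : LorentzMetric E M)

theorem covDeriv_congr (h : ∀ᶠ r in 𝓝 s, V r = W r) : g.covDeriv γ V s = g.covDeriv γ W s := by
  have h1 : (fun r ↦ chartVec (γ s) (γ r) (V r)) =ᶠ[𝓝 s] fun r ↦ chartVec (γ s) (γ r) (W r) := by
    filter_upwards [h] with r hr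
    rw [hr]
  rw [covDeriv, covDeriv, h1.deriv_eq, h.self_of_nhds]

variable [FiniteDimensional ℝ E]

/-- The covariant derivative along a curve is given by the same formula in every chart. -/
theorem chartVec_covDeriv {p : M} (hp : γ s ∈ (chartAt E p).source)
    (hγ : MDifferentiableAt 𝓘(ℝ, ℝ) 𝓘(ℝ, E) γ s)
    (hV : DifferentiableAt ℝ (fun r ↦ chartVec p (γ r) (V r)) s) :
    chartVec p (γ s) (g.covDeriv γ V s) = covAlong (g.coordForm p)
      (fun r ↦ extChartAt 𝓘(ℝ, E) p (γ r)) (fun r ↦ chartVec p (γ r) (V r)) s := by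
  set q := γ s with hq_def
  have hq : q ∈ (chartAt E q).source := mem_chart_source E q
  set τ : E → E := fun u ↦ extChartAt 𝓘(ℝ, E) q ((extChartAt 𝓘(ℝ, E) p).symm u) with hτ
  have hnear : ∀ᶠ r in 𝓝 s, γ r ∈ (chartAt E p).source ∩ (chartAt E q).source :=
    hγ.continuousAt (((chartAt E p).open_source.inter (chartAt E q).open_source).mem_nhds ⟨hp, hq⟩)
  have hx : DifferentiableAt ℝ (fun r ↦ extChartAt 𝓘(ℝ, E) p (γ r)) s :=
    ((mdifferentiableAt_extChartAt (I := 𝓘(ℝ, E)) hp).comp s hγ).differentiableAt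
  have hsurj : Function.Surjective (fderiv ℝ τ (extChartAt 𝓘(ℝ, E) p q)) := by
    intro w
    obtain ⟨v, rfl⟩ := (chartVec_bijective q hq).2 w
    exact ⟨chartVec p q v, (chartVec_transition p q hp hq v).symm⟩
  have hforms : ∀ᶠ u in 𝓝 (extChartAt 𝓘(ℝ, E) p q), ∀ v w, g.coordForm p u v w
      = g.coordForm q (τ u) (fderiv ℝ τ u v) (fderiv ℝ τ u w) := by
    have h1 : ∀ᶠ u in 𝓝 (extChartAt 𝓘(ℝ, E) p q), u ∈ (extChartAt 𝓘(ℝ, E) p).target :=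
      extChartAt_target_mem_nhds' ((extChartAt 𝓘(ℝ, E) p).map_source (by simpa using hp))
    have h2 : ∀ᶠ u in 𝓝 (extChartAt 𝓘(ℝ, E) p q),
        (extChartAt 𝓘(ℝ, E) p).symm u ∈ (chartAt E q).source := by
      refine (continuousAt_extChartAt_symm' (I := 𝓘(ℝ, E)) (x := p) (x' := q) (by simpa using hp)) ?_
      rw [(extChartAt 𝓘(ℝ, E) p).left_inv (by simpa using hp)]
      exact (chartAt E q).open_source.mem_nhds hq
    filter_upwards [h1, h2] with u hu1 hu2 v w
    have hu3 : (extChartAt 𝓘(ℝ, E) p).symm u ∈ (chartAt E p).source := by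
      simpa using (extChartAt 𝓘(ℝ, E) p).map_target hu1
    obtain ⟨y, hy, rfl⟩ : ∃ y ∈ (chartAt E p).source, extChartAt 𝓘(ℝ, E) p y = u :=
      ⟨_, hu3, (extChartAt 𝓘(ℝ, E) p).right_inv hu1⟩
    have hy' : (extChartAt 𝓘(ℝ, E) p).symm (extChartAt 𝓘(ℝ, E) p y) = y :=
      (extChartAt 𝓘(ℝ, E) p).left_inv (by simpa using hy)
    rw [hy'] at hu2
    obtain ⟨v, rfl⟩ := (chartVec_bijective p hy).2 v
    obtain ⟨w, rfl⟩ := (chartVec_bijective p hy).2 w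
    rw [← g.form_eq_coordForm p hy, ← chartVec_transition p q hy hu2,
      ← chartVec_transition p q hy hu2, g.form_eq_coordForm q hu2, hτ]
    simp only [hy']
  have hτq : τ (extChartAt 𝓘(ℝ, E) p q) ∈ (extChartAt 𝓘(ℝ, E) q).target := by
    simp only [hτ]
    rw [(extChartAt 𝓘(ℝ, E) p).left_inv (by simpa using hp)]
    exact mem_extChartAt_target q
  have key := (g.isMetricOn_coordForm p).covAlong_pullback (g.isMetricOn_coordForm q) (r := s)
    (x := fun r ↦ extChartAt 𝓘(ℝ, E) p (γ r)) (v := fun r ↦ chartVec p (γ r) (V r))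
    ((extChartAt 𝓘(ℝ, E) p).map_source (by simpa using hp)) hτq
    (contDiffAt_transition p q hp hq) hsurj hforms hx hV
  -- The covariant derivative is defined in the chart at `q = γ s`. The formula in the chart at `p`
  -- is written as the image of a tangent vector `c`, so that both sides can be compared in the
  -- chart at `q`, where `key` applies.
  obtain ⟨c, hc⟩ := (chartVec_bijective p hp).2 (covAlong (g.coordForm p)
      (fun r ↦ extChartAt 𝓘(ℝ, E) p (γ r)) (fun r ↦ chartVec p (γ r) (V r)) s)
  rw [← hc]
  congr 1
  refine (chartVec_bijective q hq).1 ?_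
  rw [chartVec_transition p q hp hq c, hc, ← key, chartVec_self]
  have e1 : (fun r ↦ τ (extChartAt 𝓘(ℝ, E) p (γ r))) =ᶠ[𝓝 s] fun r ↦ extChartAt 𝓘(ℝ, E) q (γ r) := by
    filter_upwards [hnear] with r hr
    simp only [hτ]
    rw [(extChartAt 𝓘(ℝ, E) p).left_inv (by simpa using hr.1)]
  have e2 : (fun r ↦ fderiv ℝ τ (extChartAt 𝓘(ℝ, E) p (γ r)) (chartVec p (γ r) (V r)))
      =ᶠ[𝓝 s] fun r ↦ chartVec q (γ r) (V r) := by
    filter_upwards [hnear] with r hr using (chartVec_transition p q hr.1 hr.2 (V r)).symm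
  rw [covAlong_congr _ e1 e2, covAlong, ← chartVec_velocity hγ hq]
  rfl

end LorentzMetric

end FieldsAlongCurves

/-! ### Product rules, Jacobi fields and their symplectic pairing on the manifold -/

section CovariantCalculus

variable {E : Type*} [NormedAddCommGroup E] [NormedSpace ℝ E]
  {M : Type*} [TopologicalSpace M] [ChartedSpace E M] [IsManifold 𝓘(ℝ, E) ∞ M]
  {γ : ℝ → M} {V W : (s : ℝ) → TangentSpace 𝓘(ℝ, E) (γ s)} {s : ℝ}

namespace LorentzMetric

variable (g : LorentzMetric E M)

theorem curvature_eq (p : M) (X Y Z : TangentSpace 𝓘(ℝ, E) p) : g.curvature p X Y Z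
    = curvatureOf (g.coordForm p) (extChartAt 𝓘(ℝ, E) p p) (chartVec p p X) (chartVec p p Y)
      (chartVec p p Z) := rfl

theorem curvature_self (p : M) (X Z : TangentSpace 𝓘(ℝ, E) p) : g.curvature p X X Z = 0 :=
  curvatureOf_self (g.coordForm p) (extChartAt 𝓘(ℝ, E) p p) (chartVec p p X : E) (chartVec p p Z : E)

variable {g} in
theorem IsJacobiOn.smooth {S : Set ℝ} (hV : g.IsJacobiOn γ V S) (hs : s ∈ S) :
    SmoothFieldAt γ V s := (hV s hs).1

variable [FiniteDimensional ℝ E]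

/-- The definition of `covDeriv` uses the chart at the moving point `γ r`. One fixed chart for all
nearby `r` is what allows a covariant derivative to be differentiated again. -/
theorem eventually_chartVec_covDeriv (hV : SmoothFieldAt γ V s) {p : M}
    (hp : γ s ∈ (chartAt E p).source) :
    ∀ᶠ r in 𝓝 s, chartVec p (γ r) (g.covDeriv γ V r) = covAlong (g.coordForm p)
      (fun r ↦ extChartAt 𝓘(ℝ, E) p (γ r)) (fun r ↦ chartVec p (γ r) (V r)) r := by
  filter_upwards [hV.curve.eventually_mdifferentiableAt, hV.curve.eventually_mem_source hp,
    (hV.chart hp).eventually_differentiableAt] with r h1 h2 h3 using g.chartVec_covDeriv h2 h1 h3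

theorem smoothFieldAt_covDeriv (hV : SmoothFieldAt γ V s) :
    SmoothFieldAt γ (g.covDeriv γ V) s := by
  have hp := mem_chart_source E (γ s)
  refine (smoothFieldAt_iff hp).2 ⟨hV.curve, ?_⟩
  exact ((g.isMetricOn_coordForm (γ s)).contDiffAt_covAlong (mem_extChartAt_target (γ s))
    (contDiffAt_extChartAt_comp hV.curve hp) (hV.chart hp)).congr_of_eventuallyEq
    (g.eventually_chartVec_covDeriv hV hp)

theorem eventually_covDeriv_add (hV : SmoothFieldAt γ V s) (hW : SmoothFieldAt γ W s) :
    ∀ᶠ r in 𝓝 s,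
      g.covDeriv γ (fun r ↦ V r + W r) r = g.covDeriv γ V r + g.covDeriv γ W r := by
  have hp := mem_chart_source E (γ s)
  filter_upwards [hV.curve.eventually_mem_source hp, g.eventually_chartVec_covDeriv hV hp,
    g.eventually_chartVec_covDeriv hW hp, g.eventually_chartVec_covDeriv (hV.add hW) hp,
    (hV.chart hp).eventually_differentiableAt, (hW.chart hp).eventually_differentiableAt]
    with r h1 h2 h3 h4 h5 h6
  refine (chartVec_bijective _ h1).1 ?_
  rw [h4, chartVec_add, h2, h3, ← covAlong_add _ h5 h6]
  simp only [chartVec_add]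

theorem eventually_covDeriv_smul (hV : SmoothFieldAt γ V s) {f : ℝ → ℝ}
    (hf : ContDiffAt ℝ ∞ f s) : ∀ᶠ r in 𝓝 s,
      g.covDeriv γ (fun r ↦ f r • V r) r = deriv f r • V r + f r • g.covDeriv γ V r := by
  have hp := mem_chart_source E (γ s)
  filter_upwards [hV.curve.eventually_mem_source hp, g.eventually_chartVec_covDeriv hV hp,
    g.eventually_chartVec_covDeriv (hV.smul hf) hp,
    (hV.chart hp).eventually_differentiableAt, hf.eventually_differentiableAt]
    with r h1 h2 h3 h4 h5
  refine (chartVec_bijective _ h1).1 ?_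
  rw [h3, chartVec_add, chartVec_smul, chartVec_smul, h2, ← covAlong_smul _ h5 h4]
  simp only [chartVec_smul]

theorem covDeriv_add (hV : SmoothFieldAt γ V s) (hW : SmoothFieldAt γ W s) :
    g.covDeriv γ (fun r ↦ V r + W r) s = g.covDeriv γ V s + g.covDeriv γ W s :=
  (g.eventually_covDeriv_add hV hW).self_of_nhds

theorem covDeriv_smul (hV : SmoothFieldAt γ V s) {f : ℝ → ℝ} (hf : ContDiffAt ℝ ∞ f s) :
    g.covDeriv γ (fun r ↦ f r • V r) s = deriv f s • V s + f s • g.covDeriv γ V s :=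
  (g.eventually_covDeriv_smul hV hf).self_of_nhds

/-- Metric compatibility of the covariant derivative along a curve. -/
theorem hasDerivAt_form (hV : SmoothFieldAt γ V s) (hW : SmoothFieldAt γ W s) :
    HasDerivAt (fun r ↦ g.form (γ r) (V r) (W r))
      (g.form (γ s) (g.covDeriv γ V s) (W s) + g.form (γ s) (V s) (g.covDeriv γ W s)) s := by
  have hp := mem_chart_source E (γ s)
  have h := (g.isMetricOn_coordForm (γ s)).hasDerivAt_form (mem_extChartAt_target (γ s))
    ((contDiffAt_extChartAt_comp hV.curve hp).differentiableAt (by simp))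
    ((hV.chart hp).differentiableAt (by simp)) ((hW.chart hp).differentiableAt (by simp))
  rw [← (g.eventually_chartVec_covDeriv hV hp).self_of_nhds,
    ← (g.eventually_chartVec_covDeriv hW hp).self_of_nhds, ← g.form_eq_coordForm _ hp,
    ← g.form_eq_coordForm _ hp] at h
  refine h.congr_of_eventuallyEq ?_
  filter_upwards [hV.curve.eventually_mem_source hp] with r hr
    using g.form_eq_coordForm _ hr _ _

/-- The covariant derivative of a smooth field that vanishes on a set of uniqueness is zero. -/
theorem covDeriv_eq_zero_of_eqOn {S : Set ℝ} (hV : SmoothFieldAt γ V s) (h0 : ∀ r ∈ S, V r = 0)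
    (hs : s ∈ S) (hS : UniqueDiffWithinAt ℝ S s) : g.covDeriv γ V s = 0 := by
  have hp := mem_chart_source E (γ s)
  have h1 := ((hV.chart hp).differentiableAt (by simp)).hasDerivAt.hasDerivWithinAt (s := S)
  have h2 : HasDerivWithinAt (fun r ↦ chartVec (γ s) (γ r) (V r)) 0 S s :=
    (hasDerivWithinAt_const s S (0 : E)).congr (fun r hr ↦ by simp [h0 r hr]) (by simp [h0 s hs])
  refine (chartVec_bijective _ hp).1 ?_
  rw [(g.eventually_chartVec_covDeriv hV hp).self_of_nhds, covAlong, hS.eq_deriv S h1 h2, h0 s hs,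
    chartVec_zero]
  have h := christoffelOf_smul_right (g.coordForm (γ s)) 0 (extChartAt 𝓘(ℝ, E) (γ s) (γ s))
    (deriv (fun r ↦ extChartAt 𝓘(ℝ, E) (γ s) (γ r)) s) 0
  simpa using h

theorem form_curvature (p : M) (X Y Z : TangentSpace 𝓘(ℝ, E) p) :
    g.form p (g.curvature p X Y Y) Z = g.form p (g.curvature p Z Y Y) X := by
  have : CompleteSpace E := FiniteDimensional.complete ℝ E
  have h := (g.isMetricOn_coordForm p).form_curvatureOf (mem_extChartAt_target p)
    (chartVec p p X) (chartVec p p Y) (chartVec p p Z)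
  rw [g.form_eq_coordForm p (mem_chart_source E p), g.form_eq_coordForm p (mem_chart_source E p),
    chartVec_self p (g.curvature _ _ _ _), chartVec_self p (g.curvature _ _ _ _)]
  exact h

theorem curvature_add (p : M) (X X' Y Z : TangentSpace 𝓘(ℝ, E) p) :
    g.curvature p (X + X') Y Z = g.curvature p X Y Z + g.curvature p X' Y Z := by
  have : CompleteSpace E := FiniteDimensional.complete ℝ E
  simp only [curvature_eq, chartVec_add]
  exact (g.isMetricOn_coordForm p).curvatureOf_add (mem_extChartAt_target p) _ _ _ _

theorem curvature_smul (p : M) (c : ℝ) (X Y Z : TangentSpace 𝓘(ℝ, E) p) :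
    g.curvature p (c • X) Y Z = c • g.curvature p X Y Z := by
  have : CompleteSpace E := FiniteDimensional.complete ℝ E
  simp only [curvature_eq, chartVec_smul]
  exact (g.isMetricOn_coordForm p).curvatureOf_smul (mem_extChartAt_target p) _ _ _ _

variable {g}

theorem IsJacobiOn.add {S : Set ℝ} (hV : g.IsJacobiOn γ V S) (hW : g.IsJacobiOn γ W S) :
    g.IsJacobiOn γ (fun r ↦ V r + W r) S := by
  intro s hs
  have h1 := hV.smooth hs
  have h2 := hW.smooth hs
  refine ⟨h1.add h2, ?_⟩
  rw [g.covDeriv_congr (g.eventually_covDeriv_add h1 h2),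
    g.covDeriv_add (g.smoothFieldAt_covDeriv h1) (g.smoothFieldAt_covDeriv h2), curvature_add,
    add_add_add_comm, (hV s hs).2, (hW s hs).2, add_zero]

/-- The velocity is parallel and the coefficient is affine, so the second covariant derivative
vanishes; the curvature term vanishes because `R(γ̇, γ̇) = 0`. -/
theorem IsGeodesicOn.isJacobiOn_smul_velocity {a b : ℝ} (hab : a < b)
    (hγ : g.IsGeodesicOn γ (Icc a b)) (c d : ℝ) :
    g.IsJacobiOn γ (fun r ↦ (c + r * d) • velocity E γ r) (Icc a b) := by
  intro s hs
  have hv := smoothFieldAt_velocity (hγ s hs).1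
  have hf : ContDiffAt ℝ ∞ (fun r : ℝ ↦ c + r * d) s := by fun_prop
  have hd (r : ℝ) : HasDerivAt (fun r : ℝ ↦ c + r * d) d r := by
    simpa using ((hasDerivAt_id r).mul_const d).const_add c
  have hdf : deriv (fun r : ℝ ↦ c + r * d) = fun _ ↦ d := funext fun r ↦ (hd r).deriv
  have hDv := g.smoothFieldAt_covDeriv hv
  -- The geodesic equation holds on the closed interval only, so at the end points its derivative is
  -- obtained from one side.
  have h0 := g.covDeriv_eq_zero_of_eqOn hDv (fun r hr ↦ (hγ r hr).2) hs
    (uniqueDiffOn_Icc hab s hs)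
  refine ⟨hv.smul hf, ?_⟩
  rw [g.covDeriv_congr (g.eventually_covDeriv_smul hv hf), hdf,
    g.covDeriv_add (hv.smul contDiffAt_const) (hDv.smul hf), g.covDeriv_smul hv contDiffAt_const,
    g.covDeriv_smul hDv hf, (hγ s hs).2, h0, curvature_smul, curvature_self]
  simp only [deriv_const, smul_zero, zero_smul, add_zero]

variable (g) in
/-- The symplectic pairing of two vector fields along a curve. -/
def wronskian (γ : ℝ → M) (V W : (s : ℝ) → TangentSpace 𝓘(ℝ, E) (γ s)) (s : ℝ) : ℝ :=
  g.form (γ s) (g.covDeriv γ V s) (W s) - g.form (γ s) (V s) (g.covDeriv γ W s)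

/-- By metric compatibility the derivative is `g(V'', W) - g(V, W'')`, and the Jacobi equation turns
it into two curvature terms that cancel because the Jacobi operator is self-adjoint. -/
theorem IsJacobiOn.wronskian_eq {a b : ℝ} (hV : g.IsJacobiOn γ V (Icc a b))
    (hW : g.IsJacobiOn γ W (Icc a b)) (hs : s ∈ Icc a b) :
    g.wronskian γ V W s = g.wronskian γ V W a := by
  have h (s : ℝ) (hs : s ∈ Icc a b) : HasDerivAt (g.wronskian γ V W) 0 s := by
    have h1 := hV.smooth hs
    have h2 := hW.smooth hs
    refine ((g.hasDerivAt_form (g.smoothFieldAt_covDeriv h1) h2).sub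
      (g.hasDerivAt_form h1 (g.smoothFieldAt_covDeriv h2))).congr_deriv ?_
    rw [eq_neg_of_add_eq_zero_left (hV s hs).2, eq_neg_of_add_eq_zero_left (hW s hs).2]
    have h3 := g.form_curvature (γ s) (V s) (velocity E γ s) (W s)
    rw [g.symm _ (V s) (-_)]
    simp only [map_neg, neg_apply]
    linarith
  exact constant_of_has_deriv_right_zero (fun s hs ↦ (h s hs).continuousAt.continuousWithinAt)
    (fun s hs ↦ (h s (Ico_subset_Icc_self hs)).hasDerivWithinAt) s hs

end LorentzMetric

end CovariantCalculus

theorem IsMetricOn.curvatureOf_smul_smul {E : Type*} [NormedAddCommGroup E] [NormedSpace ℝ E]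
    [CompleteSpace E] {G : E → E →L[ℝ] E →L[ℝ] ℝ} {U : Set E}
    (hG : IsMetricOn G U) {u : E} (hu : u ∈ U) (c : ℝ) (x y : E) :
    curvatureOf G u x (c • y) (c • y) = c • c • curvatureOf G u x y y := by
  have h (x : E) := ((hG.contDiffAt_christoffelOf hu x y).differentiableAt (by simp)).hasFDerivAt
  have h1 : HasFDerivAt (fun u ↦ christoffelOf G u (c • y) (c • y)) _ u :=
    (((h y).const_smul c).const_smul c).congr_of_eventuallyEq
      (.of_forall fun u ↦ by simp [christoffelOf_smul_left, christoffelOf_smul_right])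
  have h2 : HasFDerivAt (fun u ↦ christoffelOf G u x (c • y)) _ u :=
    ((h x).const_smul c).congr_of_eventuallyEq
      (.of_forall fun u ↦ christoffelOf_smul_right G c u x y)
  rw [curvatureOf, curvatureOf, h1.fderiv, h2.fderiv]
  simp only [map_smul, smul_apply, christoffelOf_smul_left, christoffelOf_smul_right]
  module

/-! ### Affine changes of parameter -/

section Reparametrization

variable {E : Type*} [NormedAddCommGroup E] [NormedSpace ℝ E]
  {M : Type*} [TopologicalSpace M] [ChartedSpace E M]
  {γ : ℝ → M} {V : (s : ℝ) → TangentSpace 𝓘(ℝ, E) (γ s)} {a c r : ℝ}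

theorem deriv_comp_affine {F : Type*} [NormedAddCommGroup F] [NormedSpace ℝ F] (f : ℝ → F)
    (a c r : ℝ) : deriv (fun r ↦ f (a + r * c)) r = c • deriv f (a + r * c) := by
  have h := deriv_comp_mul_left c (fun y ↦ f (a + y)) r
  simp only [deriv_comp_const_add, mul_comm c] at h
  exact h

theorem tendsto_affine (a c r : ℝ) :
    Filter.Tendsto (fun r : ℝ ↦ a + r * c) (𝓝 r) (𝓝 (a + r * c)) :=
  Continuous.tendsto (by fun_prop) r

theorem velocity_affine (hγ : MDifferentiableAt 𝓘(ℝ, ℝ) 𝓘(ℝ, E) γ (a + r * c)) :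
    velocity E (fun r ↦ γ (a + r * c)) r = c • velocity E γ (a + r * c) := by
  have hd : HasDerivAt (fun r : ℝ ↦ a + r * c) c r := by
    simpa using ((hasDerivAt_id r).mul_const c).const_add a
  have h := (hγ.hasMFDerivAt.comp r hd.hasFDerivAt.hasMFDerivAt).mfderiv
  have h2 : velocity E (fun r ↦ γ (a + r * c)) r
      = mfderiv 𝓘(ℝ, ℝ) 𝓘(ℝ, E) γ (a + r * c) ((1 : ℝ) • c) := congrArg (fun L ↦ L (1 : ℝ)) h
  have aux (L : ℝ →L[ℝ] E) : L ((1 : ℝ) • c) = c • L 1 := by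
    rw [one_smul, ← map_smul, smul_eq_mul, mul_one]
  exact h2.trans (aux (mfderiv 𝓘(ℝ, ℝ) 𝓘(ℝ, E) γ (a + r * c)))

variable [IsManifold 𝓘(ℝ, E) ∞ M]

theorem SmoothFieldAt.affine (hV : SmoothFieldAt γ V (a + r * c)) :
    SmoothFieldAt (fun r ↦ γ (a + r * c)) (fun r ↦ V (a + r * c)) r := by
  have h : ContMDiffAt 𝓘(ℝ, ℝ) 𝓘(ℝ, ℝ) ∞ (fun r : ℝ ↦ a + r * c) r :=
    ContDiffAt.contMDiffAt (by fun_prop)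
  have hV' : ContMDiffAt 𝓘(ℝ, ℝ) (𝓘(ℝ, E)).tangent ∞
      (fun r ↦ (⟨γ r, V r⟩ : TangentBundle 𝓘(ℝ, E) M)) (a + r * c) := hV
  exact ContMDiffAt.comp r hV' h

namespace LorentzMetric

variable {g : LorentzMetric E M}

theorem covDeriv_affine (hγ : MDifferentiableAt 𝓘(ℝ, ℝ) 𝓘(ℝ, E) γ (a + r * c)) :
    g.covDeriv (fun r ↦ γ (a + r * c)) (fun r ↦ V (a + r * c)) r
      = c • g.covDeriv γ V (a + r * c) := by
  have h := deriv_comp_affine (fun r' ↦ chartVec (γ (a + r * c)) (γ r') (V r')) a c r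
  rw [covDeriv, covDeriv, h, velocity_affine hγ, chartVec_smul]
  simp only [christoffel_eq, christoffelOf_smul_left]
  exact (smul_add c _ _).symm

variable [FiniteDimensional ℝ E]

theorem curvature_smul_smul (p : M) (X Y : TangentSpace 𝓘(ℝ, E) p) (c : ℝ) :
    g.curvature p X (c • Y) (c • Y) = c • c • g.curvature p X Y Y := by
  have : CompleteSpace E := FiniteDimensional.complete ℝ E
  simp only [curvature_eq, chartVec_smul]
  exact (g.isMetricOn_coordForm p).curvatureOf_smul_smul (mem_extChartAt_target p) _ _ _

theorem IsGeodesicOn.affine {S T : Set ℝ} (hγ : g.IsGeodesicOn γ S)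
    (hT : ∀ r ∈ T, a + r * c ∈ S) : g.IsGeodesicOn (fun r ↦ γ (a + r * c)) T := by
  intro r hr
  have h1 := smoothFieldAt_velocity (hγ _ (hT r hr)).1
  refine ⟨h1.affine.curve, ?_⟩
  have h2 : ∀ᶠ r' in 𝓝 r, velocity E (fun r ↦ γ (a + r * c)) r' = c • velocity E γ (a + r' * c) := by
    filter_upwards [tendsto_affine a c r h1.curve.eventually_mdifferentiableAt] with r' hr'
      using velocity_affine hr'
  rw [g.covDeriv_congr h2, covDeriv_affine (V := fun s ↦ c • velocity E γ s)
    h1.curve.eventually_mdifferentiableAt.self_of_nhds, g.covDeriv_smul h1 contDiffAt_const,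
    (hγ _ (hT r hr)).2]
  simp

theorem IsJacobiOn.affine {S T : Set ℝ} (hV : g.IsJacobiOn γ V S)
    (hT : ∀ r ∈ T, a + r * c ∈ S) :
    g.IsJacobiOn (fun r ↦ γ (a + r * c)) (fun r ↦ V (a + r * c)) T := by
  intro r hr
  have h1 := hV.smooth (hT r hr)
  refine ⟨h1.affine, ?_⟩
  have h2 : ∀ᶠ r' in 𝓝 r, g.covDeriv (fun r ↦ γ (a + r * c)) (fun r ↦ V (a + r * c)) r'
      = c • g.covDeriv γ V (a + r' * c) := by
    filter_upwards [tendsto_affine a c r h1.curve.eventually_mdifferentiableAt] with r' hr'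
      using covDeriv_affine hr'
  have h3 := h1.curve.eventually_mdifferentiableAt.self_of_nhds
  rw [g.covDeriv_congr h2, covDeriv_affine (V := fun s ↦ c • g.covDeriv γ V s) h3,
    g.covDeriv_smul (g.smoothFieldAt_covDeriv h1) contDiffAt_const, velocity_affine h3,
    curvature_smul_smul]
  have h4 := (hV _ (hT r hr)).2
  simp only [deriv_const, zero_smul, zero_add]
  rw [← smul_add, ← smul_add, h4, smul_zero, smul_zero]

end LorentzMetric

end Reparametrization

theorem hasDerivAt_line {P F : Type*} [NormedAddCommGroup P] [NormedSpace ℝ P]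
    [NormedAddCommGroup F] [NormedSpace ℝ F] {f : P × ℝ → F} {q : P} {s : ℝ}
    (hf : DifferentiableAt ℝ f (q, s)) (w : P) :
    HasDerivAt (fun t : ℝ ↦ f (q + t • w, s)) (fderiv ℝ f (q, s) (w, 0)) 0 := by
  simpa using hasDerivAt_along hf (w, 0)

/-! ### Variation fields of families of curves on the manifold -/

section Variations

variable {E : Type*} [NormedAddCommGroup E] [NormedSpace ℝ E]
  {M : Type*} [TopologicalSpace M] [ChartedSpace E M]
  {P : Type*} [NormedAddCommGroup P] [NormedSpace ℝ P] {Q : P × ℝ → M} {q : P} {s : ℝ}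

variable (E) in
/-- The variation field of a family of curves in the direction `w` of the parameter space. -/
def variationField (Q : P × ℝ → M) (q w : P) (s : ℝ) : TangentSpace 𝓘(ℝ, E) (Q (q, s)) :=
  mfderiv 𝓘(ℝ, P) 𝓘(ℝ, E) (fun q' ↦ Q (q', s)) q w

theorem mdifferentiableAt_slice_left
    (hQ : MDifferentiableAt 𝓘(ℝ, P × ℝ) 𝓘(ℝ, E) Q (q, s)) :
    MDifferentiableAt 𝓘(ℝ, P) 𝓘(ℝ, E) (fun q' ↦ Q (q', s)) q := by
  have h : DifferentiableAt ℝ (fun q' : P ↦ (q', s)) q := by fun_prop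
  exact MDifferentiableAt.comp q hQ h.mdifferentiableAt

theorem mdifferentiableAt_slice_right
    (hQ : MDifferentiableAt 𝓘(ℝ, P × ℝ) 𝓘(ℝ, E) Q (q, s)) :
    MDifferentiableAt 𝓘(ℝ, ℝ) 𝓘(ℝ, E) (fun r ↦ Q (q, r)) s := by
  have h : DifferentiableAt ℝ (fun r : ℝ ↦ (q, r)) s := by fun_prop
  exact MDifferentiableAt.comp s hQ h.mdifferentiableAt

theorem contMDiffAt_slice_right (hQ : ContMDiffAt 𝓘(ℝ, P × ℝ) 𝓘(ℝ, E) ∞ Q (q, s)) :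
    ContMDiffAt 𝓘(ℝ, ℝ) 𝓘(ℝ, E) ∞ (fun r ↦ Q (q, r)) s := by
  have h : ContDiffAt ℝ ∞ (fun r : ℝ ↦ (q, r)) s := by fun_prop
  exact ContMDiffAt.comp s hQ h.contMDiffAt

variable [IsManifold 𝓘(ℝ, E) ∞ M]

theorem differentiableAt_extChartAt_comp
    (hQ : MDifferentiableAt 𝓘(ℝ, P × ℝ) 𝓘(ℝ, E) Q (q, s)) {p : M}
    (hp : Q (q, s) ∈ (chartAt E p).source) :
    DifferentiableAt ℝ (fun u ↦ extChartAt 𝓘(ℝ, E) p (Q u)) (q, s) :=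
  ((mdifferentiableAt_extChartAt (I := 𝓘(ℝ, E)) hp).comp (q, s) hQ).differentiableAt

theorem chartVec_variationField (hQ : MDifferentiableAt 𝓘(ℝ, P × ℝ) 𝓘(ℝ, E) Q (q, s)) {p : M}
    (hp : Q (q, s) ∈ (chartAt E p).source) (w : P) :
    chartVec p (Q (q, s)) (variationField E Q q w s)
      = fderiv ℝ (fun u ↦ extChartAt 𝓘(ℝ, E) p (Q u)) (q, s) (w, 0) := by
  refine (chartVec_mfderiv (mdifferentiableAt_slice_left hQ) hp w).trans ?_
  have h0 : HasFDerivAt (fun q' : P ↦ (q', s)) ((ContinuousLinearMap.id ℝ P).prod 0) q :=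
    (hasFDerivAt_id q).prodMk (hasFDerivAt_const s q)
  have h := HasFDerivAt.comp q (differentiableAt_extChartAt_comp hQ hp).hasFDerivAt h0
  exact congrArg (fun L ↦ L w) h.fderiv

theorem chartVec_velocity_slice (hQ : MDifferentiableAt 𝓘(ℝ, P × ℝ) 𝓘(ℝ, E) Q (q, s)) {p : M}
    (hp : Q (q, s) ∈ (chartAt E p).source) :
    chartVec p (Q (q, s)) (velocity E (fun r ↦ Q (q, r)) s)
      = fderiv ℝ (fun u ↦ extChartAt 𝓘(ℝ, E) p (Q u)) (q, s) (0, 1) :=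
  (chartVec_velocity (mdifferentiableAt_slice_right hQ) hp).trans
    (hasDerivAt_slice (differentiableAt_extChartAt_comp hQ hp)).deriv

theorem smoothFieldAt_variationField (hQ : ContMDiffAt 𝓘(ℝ, P × ℝ) 𝓘(ℝ, E) ∞ Q (q, s)) (w : P) :
    SmoothFieldAt (fun r ↦ Q (q, r)) (variationField E Q q w) s := by
  have hp := mem_chart_source E (Q (q, s))
  have slice : Filter.Tendsto (fun r : ℝ ↦ (q, r)) (𝓝 s) (𝓝 (q, s)) :=
    Continuous.tendsto (by fun_prop) s
  refine (smoothFieldAt_iff hp).2 ⟨contMDiffAt_slice_right hQ, ?_⟩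
  have h1 := (contDiffAt_extChartAt_comp hQ hp).fderiv_apply_const (w, 0)
  have h2 : ContDiffAt ℝ ∞ (fun r : ℝ ↦ (q, r)) s := by fun_prop
  refine (ContDiffAt.comp s h1 h2).congr_of_eventuallyEq ?_
  filter_upwards [slice hQ.eventually_mdifferentiableAt, slice (hQ.eventually_mem_source hp)]
    with r h1 h2 using chartVec_variationField h1 h2 w

namespace LorentzMetric

variable {g : LorentzMetric E M} [FiniteDimensional ℝ E]

/-- The variation field of a family of geodesics is a Jacobi field. -/
theorem isJacobiOn_variationField {S : Set ℝ}
    (hQ : ∀ s ∈ S, ContMDiffAt 𝓘(ℝ, P × ℝ) 𝓘(ℝ, E) ∞ Q (q, s))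
    (hgeo : ∀ᶠ q' in 𝓝 q, g.IsGeodesicOn (fun r ↦ Q (q', r)) S) (w : P) :
    g.IsJacobiOn (fun r ↦ Q (q, r)) (variationField E Q q w) S := by
  intro s hs
  have hQs := hQ s hs
  have hV := smoothFieldAt_variationField hQs w
  refine ⟨hV, ?_⟩
  set p := Q (q, s) with hp_def
  have hp : Q (q, s) ∈ (chartAt E p).source := mem_chart_source E p
  have slice : Filter.Tendsto (fun r : ℝ ↦ (q, r)) (𝓝 s) (𝓝 (q, s)) :=
    Continuous.tendsto (by fun_prop) s
  have sliceP : Filter.Tendsto (fun q' : P ↦ (q', s)) (𝓝 q) (𝓝 (q, s)) :=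
    Continuous.tendsto (by fun_prop) q
  have hX := contDiffAt_extChartAt_comp hQs hp
  have hgeo' : ∀ᶠ q' in 𝓝 q, covAlong (g.coordForm p)
      (fun r ↦ extChartAt 𝓘(ℝ, E) p (Q (q', r)))
      (deriv fun r ↦ extChartAt 𝓘(ℝ, E) p (Q (q', r))) s = 0 := by
    filter_upwards [hgeo, sliceP (hQs.eventually_mem_source hp)] with q' h1 h2
    have h3 := smoothFieldAt_velocity (h1 s hs).1
    have h4 := (g.eventually_chartVec_covDeriv h3 h2).self_of_nhds
    rw [(h1 s hs).2, chartVec_zero] at h4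
    rw [h4]
    refine covAlong_congr _ .rfl ?_
    filter_upwards [h3.curve.eventually_mdifferentiableAt, h3.curve.eventually_mem_source h2]
      with r h5 h6 using (chartVec_velocity h5 h6).symm
  have key := (g.isMetricOn_coordForm p).jacobi_of_variation hX (mem_extChartAt_target p) hgeo' w
  refine (chartVec_bijective p hp).1 ?_
  rw [chartVec_add, (g.eventually_chartVec_covDeriv (g.smoothFieldAt_covDeriv hV) hp).self_of_nhds,
    chartVec_zero, ← key]
  congr 1
  · refine covAlong_congr _ .rfl ?_
    -- The outer covariant derivative differentiates the inner one, so the chart expression of the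
    -- field has to hold in a neighbourhood of every `r` close to `s`.
    have h1 : ∀ᶠ r in 𝓝 s, (fun r ↦ chartVec p (Q (q, r)) (variationField E Q q w r))
        =ᶠ[𝓝 r] fun r ↦ fderiv ℝ (fun u ↦ extChartAt 𝓘(ℝ, E) p (Q u)) (q, r) (w, 0) := by
      refine Filter.Eventually.eventually_nhds ?_
      filter_upwards [slice hQs.eventually_mdifferentiableAt, slice (hQs.eventually_mem_source hp)]
        with r h1 h2 using chartVec_variationField h1 h2 w
    filter_upwards [g.eventually_chartVec_covDeriv hV hp, h1] with r h2 h3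
    rw [h2]
    exact covAlong_congr _ .rfl h3
  · rw [chartVec_self, curvature_eq,
      chartVec_variationField hQs.eventually_mdifferentiableAt.self_of_nhds hp,
      chartVec_velocity_slice hQs.eventually_mdifferentiableAt.self_of_nhds hp]

/-- The symmetry lemma: the covariant derivatives of a family of curves commute. -/
theorem chartVec_covDeriv_variationField
    (hQ : ContMDiffAt 𝓘(ℝ, P × ℝ) 𝓘(ℝ, E) ∞ Q (q, s)) (w : P) {p : M}
    (hp : Q (q, s) ∈ (chartAt E p).source) :
    chartVec p (Q (q, s)) (g.covDeriv (fun r ↦ Q (q, r)) (variationField E Q q w) s)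
      = covAlong (g.coordForm p) (fun t ↦ extChartAt 𝓘(ℝ, E) p (Q (q + t • w, s)))
        (fun t ↦ chartVec p (Q (q + t • w, s)) (velocity E (fun r ↦ Q (q + t • w, r)) s)) 0 := by
  have hX := contDiffAt_extChartAt_comp hQ hp
  have slice : Filter.Tendsto (fun r : ℝ ↦ (q, r)) (𝓝 s) (𝓝 (q, s)) :=
    Continuous.tendsto (by fun_prop) s
  have line : Filter.Tendsto (fun t : ℝ ↦ (q + t • w, s)) (𝓝 0) (𝓝 (q, s)) :=
    Continuous.tendsto' (by fun_prop) _ _ (by simp)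
  have e1 : (fun r ↦ chartVec p (Q (q, r)) (variationField E Q q w r))
      =ᶠ[𝓝 s] fun r ↦ fderiv ℝ (fun u ↦ extChartAt 𝓘(ℝ, E) p (Q u)) (q, r) (w, 0) := by
    filter_upwards [slice hQ.eventually_mdifferentiableAt, slice (hQ.eventually_mem_source hp)]
      with r h1 h2 using chartVec_variationField h1 h2 w
  have e2 : (fun t ↦ chartVec p (Q (q + t • w, s)) (velocity E (fun r ↦ Q (q + t • w, r)) s))
      =ᶠ[𝓝 (0 : ℝ)] fun t ↦ fderiv ℝ (fun u ↦ extChartAt 𝓘(ℝ, E) p (Q u)) (q + t • w, s) (0, 1) := by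
    filter_upwards [line hQ.eventually_mdifferentiableAt, line (hQ.eventually_mem_source hp)]
      with r h1 h2 using chartVec_velocity_slice h1 h2
  have d1 := hasDerivAt_slice ((hX.fderiv_apply_const (w, 0)).differentiableAt (by simp))
  have d2 := hasDerivAt_line ((hX.fderiv_apply_const (0, 1)).differentiableAt (by simp)) w
  rw [(g.eventually_chartVec_covDeriv (smoothFieldAt_variationField hQ w) hp).self_of_nhds,
    covAlong_congr (g.coordForm p) .rfl e1,
    covAlong_congr (g.coordForm p) (x := fun t : ℝ ↦ extChartAt 𝓘(ℝ, E) p (Q (q + t • w, s)))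
      (s := 0) .rfl e2, covAlong, covAlong, d1.deriv, d2.deriv,
    (hasDerivAt_slice (hX.differentiableAt (by simp))).deriv,
    (hasDerivAt_line (hX.differentiableAt (by simp)) w).deriv]
  simp only [zero_smul, add_zero]
  exact (g.isMetricOn_coordForm p).covAlong_comm hX
    ((extChartAt 𝓘(ℝ, E) p).map_source (by simpa using hp)) _ _

/-- In a family of curves of constant causal character, the derivative of the variation field
is orthogonal to the curve. -/
theorem form_covDeriv_variationField
    (hQ : ContMDiffAt 𝓘(ℝ, P × ℝ) 𝓘(ℝ, E) ∞ Q (q, s)) (w : P) {k : ℝ}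
    (hk : ∀ᶠ q' in 𝓝 q, g.form (Q (q', s)) (velocity E (fun r ↦ Q (q', r)) s)
      (velocity E (fun r ↦ Q (q', r)) s) = k) :
    g.form (Q (q, s)) (g.covDeriv (fun r ↦ Q (q, r)) (variationField E Q q w) s)
      (velocity E (fun r ↦ Q (q, r)) s) = 0 := by
  have hp := mem_chart_source E (Q (q, s))
  have hX := contDiffAt_extChartAt_comp hQ hp
  have line : Filter.Tendsto (fun t : ℝ ↦ (q + t • w, s)) (𝓝 0) (𝓝 (q, s)) :=
    Continuous.tendsto' (by fun_prop) _ _ (by simp)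
  have lineP : Filter.Tendsto (fun t : ℝ ↦ q + t • w) (𝓝 0) (𝓝 q) :=
    Continuous.tendsto' (by fun_prop) _ _ (by simp)
  have e2 : (fun t ↦ chartVec (Q (q, s)) (Q (q + t • w, s))
        (velocity E (fun r ↦ Q (q + t • w, r)) s)) =ᶠ[𝓝 (0 : ℝ)]
      fun t ↦ fderiv ℝ (fun u ↦ extChartAt 𝓘(ℝ, E) (Q (q, s)) (Q u)) (q + t • w, s) (0, 1) := by
    filter_upwards [line hQ.eventually_mdifferentiableAt, line (hQ.eventually_mem_source hp)]
      with r h1 h2 using chartVec_velocity_slice h1 h2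
  have d2 := (hasDerivAt_line ((hX.fderiv_apply_const (0, 1)).differentiableAt (by simp))
    w).congr_of_eventuallyEq e2
  -- The constant `g(γ̇, γ̇) = k` is differentiated along the line `q + t w`. This gives `2 g(∇_w
  -- γ̇, γ̇) = 0`, and the symmetry lemma identifies `∇_w γ̇` with the derivative of the variation
  -- field along the curve.
  have d := (g.isMetricOn_coordForm (Q (q, s))).hasDerivAt_form (r := 0)
    (x := fun t ↦ extChartAt 𝓘(ℝ, E) (Q (q, s)) (Q (q + t • w, s))) (by simp)
    (hasDerivAt_line (hX.differentiableAt (by simp)) w).differentiableAt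
    d2.differentiableAt d2.differentiableAt
  have d0 := d.unique ((hasDerivAt_const (0 : ℝ) k).congr_of_eventuallyEq (by
    filter_upwards [lineP hk, line (hQ.eventually_mem_source hp)] with t h1 h2
    rw [← g.form_eq_coordForm _ h2, h1]))
  rw [← chartVec_covDeriv_variationField hQ w hp] at d0
  have e3 : (chartVec (Q (q, s)) (Q (q + (0 : ℝ) • w, s))
        (velocity E (fun r ↦ Q (q + (0 : ℝ) • w, r)) s) : E)
      = chartVec (Q (q, s)) (Q (q, s)) (velocity E (fun r ↦ Q (q, r)) s) := by
    refine e2.self_of_nhds.trans (.trans ?_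
      (chartVec_velocity_slice hQ.eventually_mdifferentiableAt.self_of_nhds hp).symm)
    simp only [zero_smul, add_zero]
  rw [e3, zero_smul, add_zero, ← g.form_eq_coordForm _ hp, ← g.form_eq_coordForm _ hp] at d0
  have h5 := g.symm (Q (q, s)) (velocity E (fun r ↦ Q (q, r)) s)
    (g.covDeriv (fun r ↦ Q (q, r)) (variationField E Q q w) s)
  linarith

end LorentzMetric

end Variations

/-! ### Linear algebra of the Cauchy data -/

section SymplecticAlgebra

open Module

variable {V W Λ : Type*} [AddCommGroup V] [Module ℝ V] [AddCommGroup W] [Module ℝ W]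
  [AddCommGroup Λ] [Module ℝ Λ]

/-- This is `(n^⊥)^⊥ = ℝ n`: the functional `B v` vanishes on the kernel of `B n`, hence is a
multiple of it. -/
theorem LinearMap.BilinForm.exists_eq_smul_of_orthogonal {B : LinearMap.BilinForm ℝ V}
    (hB : B.Nondegenerate) {n v : V} (h : ∀ w, B n w = 0 → B v w = 0) : ∃ c : ℝ, v = c • n := by
  have key : ∃ c : ℝ, B v = c • B n := by
    by_cases h0 : ∀ w, B n w = 0
    · exact ⟨0, LinearMap.ext fun w ↦ by simpa using h w (h0 w)⟩
    · push Not at h0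
      obtain ⟨u, hu⟩ := h0
      refine ⟨B v u / B n u, LinearMap.ext fun w ↦ ?_⟩
      have := h (w - (B n w / B n u) • u) (by simp [hu])
      simp only [map_sub, map_smul, smul_eq_mul] at this
      simp only [LinearMap.smul_apply, smul_eq_mul]
      linear_combination this
  obtain ⟨c, hc⟩ := key
  refine ⟨c, sub_eq_zero.1 (hB.1 _ fun w ↦ ?_)⟩
  simp [hc]

/-- A dimension count: the target `V × n^⊥` has dimension `3 + 2 = 5 = dim Λ`, so the injective map
`Φ` fills it. -/
theorem LinearMap.BilinForm.exists_apply_eq_of_orthogonal {B : LinearMap.BilinForm ℝ V}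
    (hV : finrank ℝ V = 3) (hΛ : finrank ℝ Λ = 5) (hB : B.Nondegenerate) {n : V} (hn : n ≠ 0)
    {Φ : Λ →ₗ[ℝ] V × V} (hΦ : Function.Injective Φ) (hΦn : ∀ k, B n (Φ k).2 = 0) {v w : V}
    (hw : B n w = 0) : ∃ k, Φ k = (v, w) := by
  have : FiniteDimensional ℝ V := .of_finrank_pos (by omega)
  have hn' : B n ≠ 0 := fun h ↦ hn (hB.1 n fun w ↦ by rw [h, LinearMap.zero_apply])
  have hker := Module.Dual.finrank_ker_add_one_of_ne_zero hn'
  have hfin : finrank ℝ Λ = finrank ℝ (V × LinearMap.ker (B n)) := by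
    rw [finrank_prod]
    omega
  let f : Λ →ₗ[ℝ] V × LinearMap.ker (B n) :=
    (LinearMap.fst ℝ V V ∘ₗ Φ).prod ((LinearMap.snd ℝ V V ∘ₗ Φ).codRestrict _ hΦn)
  have hf : Function.Injective f := fun k l h ↦ hΦ <| Prod.ext
    (congrArg (fun u : V × LinearMap.ker (B n) ↦ u.1) h)
    (congrArg (fun u : V × LinearMap.ker (B n) ↦ (u.2 : V)) h)
  have : FiniteDimensional ℝ Λ := .of_finrank_pos (by omega)
  obtain ⟨k, hk⟩ := (LinearMap.injective_iff_surjective_of_finrank_eq_finrank hfin).1 hf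
    (v, ⟨w, hw⟩)
  exact ⟨k, Prod.ext
    (congrArg (fun u : V × LinearMap.ker (B n) ↦ u.1) hk)
    (congrArg (fun u : V × LinearMap.ker (B n) ↦ (u.2 : V)) hk)⟩

/-- Two families of Cauchy data with the same symplectic pairing: if the first one is injective,
then so is the second one. -/
theorem LinearMap.BilinForm.injective_of_symplectic {B : LinearMap.BilinForm ℝ V}
    {B' : LinearMap.BilinForm ℝ W} (hV : finrank ℝ V = 3) (hΛ : finrank ℝ Λ = 5)
    (hB : B.Nondegenerate) {n : V} {n' : W} (hn : n ≠ 0) (hn' : n' ≠ 0)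
    {Φ : Λ →ₗ[ℝ] V × V} {Φ' : Λ →ₗ[ℝ] W × W} (hΦ : Function.Injective Φ)
    (hΦn : ∀ k, B n (Φ k).2 = 0)
    (hω : ∀ k l, B' (Φ' k).2 (Φ' l).1 - B' (Φ' k).1 (Φ' l).2
      = B (Φ k).2 (Φ l).1 - B (Φ k).1 (Φ l).2)
    {κ : Λ} (hκ : Φ κ = (n, 0)) (hκ' : Φ' κ = (n', 0)) : Function.Injective Φ' := by
  rw [injective_iff_map_eq_zero]
  intro k hk
  -- If `Φ' k = 0`, then `k` lies in the radical of the common pairing. Seen through `Φ`, the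
  -- radical of the symplectic form on the hyperplane `V × n^⊥` is the line of `(n, 0) = Φ κ`:
  -- testing with data `(w, 0)` kills the second component, and testing with `(0, w)`, `w ⊥ n`,
  -- leaves a multiple of `n` in the first. As `Φ' κ = (n', 0)` is not zero, `k = 0`.
  have h (l : Λ) : B (Φ k).2 (Φ l).1 = B (Φ k).1 (Φ l).2 := by
    have := hω k l
    simp only [hk, Prod.fst_zero, Prod.snd_zero, map_zero, LinearMap.zero_apply, sub_zero] at this
    linarith
  have h2 : (Φ k).2 = 0 := hB.1 _ fun w ↦ by
    obtain ⟨l, hl⟩ := exists_apply_eq_of_orthogonal hV hΛ hB hn hΦ hΦn (v := w) (map_zero (B n))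
    simpa [hl] using h l
  obtain ⟨c, hc⟩ := exists_eq_smul_of_orthogonal hB (n := n) (v := (Φ k).1) fun w hw ↦ by
    obtain ⟨l, hl⟩ := exists_apply_eq_of_orthogonal hV hΛ hB hn hΦ hΦn (v := 0) hw
    simpa [hl, h2] using (h l).symm
  have hkc : k = c • κ := hΦ (Prod.ext (by simp [hc, hκ]) (by simp [h2, hκ]))
  rw [hkc, map_smul, hκ', Prod.smul_mk, Prod.mk_eq_zero] at hk
  rw [hkc, (smul_eq_zero.1 hk.1).resolve_right hn', zero_smul]

/-- Covectors that induce the same functional on the values of two families of Cauchy data with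
the same symplectic pairing are joined by an element that vanishes, up to a multiple of the null
direction, at both ends. -/
theorem LinearMap.BilinForm.exists_of_symplectic {B : LinearMap.BilinForm ℝ V}
    {B' : LinearMap.BilinForm ℝ W} (hV : finrank ℝ V = 3) (hW : finrank ℝ W = 3)
    (hΛ : finrank ℝ Λ = 5) (hB : B.Nondegenerate) (hB' : B'.Nondegenerate) {n : V} {n' : W}
    (hn : n ≠ 0) (hn' : n' ≠ 0) {Φ : Λ →ₗ[ℝ] V × V} {Φ' : Λ →ₗ[ℝ] W × W}
    (hΦ : Function.Injective Φ) (hΦ' : Function.Injective Φ')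
    (hΦn : ∀ k, B n (Φ k).2 = 0) (hΦn' : ∀ k, B' n' (Φ' k).2 = 0)
    (hω : ∀ k l, B' (Φ' k).2 (Φ' l).1 - B' (Φ' k).1 (Φ' l).2
      = B (Φ k).2 (Φ l).1 - B (Φ k).1 (Φ l).2)
    {x : V} {y : W} (hx : B n x = 0) (hxy : ∀ l, B x (Φ l).1 = B' y (Φ' l).1) :
    ∃ (k : Λ) (c : ℝ), Φ k = (0, x) ∧ Φ' k = (c • n', y) := by
  obtain ⟨k, hk⟩ := exists_apply_eq_of_orthogonal hV hΛ hB hn hΦ hΦn (v := 0) hx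
  -- For `k` with data `(0, x)` under `Φ`, the pairing with `l` is `B x (Φ l).1`, which equals `B' y
  -- (Φ' l).1` by assumption. Since `Φ'` also fills `W × n'^⊥`, this determines the data of `k`
  -- under `Φ'` up to the multiple of `n'`.
  have h (l : Λ) : B' (Φ' k).2 (Φ' l).1 - B' (Φ' k).1 (Φ' l).2 = B' y (Φ' l).1 := by
    rw [hω, ← hxy, hk]
    simp
  have h2 : (Φ' k).2 = y := sub_eq_zero.1 (hB'.1 _ fun w ↦ by
    obtain ⟨l, hl⟩ := exists_apply_eq_of_orthogonal hW hΛ hB' hn' hΦ' hΦn' (v := w)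
      (map_zero (B' n'))
    have := h l
    simp only [hl, map_zero, sub_zero] at this
    simp [this])
  obtain ⟨c, hc⟩ := exists_eq_smul_of_orthogonal hB' (n := n') (v := (Φ' k).1) fun w hw ↦ by
    obtain ⟨l, hl⟩ := exists_apply_eq_of_orthogonal hW hΛ hB' hn' hΦ' hΦn' (v := 0) hw
    simpa [hl] using h l
  exact ⟨k, c, hk, Prod.ext hc h2⟩

end SymplecticAlgebra

/-! ### The five-dimensional space of Jacobi fields of the light ray family -/

section LightRays

open Module

variable {E : Type*} [NormedAddCommGroup E] [NormedSpace ℝ E]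
  {M : Type*} [TopologicalSpace M] [ChartedSpace E M] [IsManifold 𝓘(ℝ, E) ∞ M]

namespace LorentzMetric

/-- The metric at a point, as an algebraic bilinear form. -/
def bilinForm (g : LorentzMetric E M) (x : M) : LinearMap.BilinForm ℝ (TangentSpace 𝓘(ℝ, E) x) :=
  LinearMap.mk₂ ℝ (fun v w ↦ g.form x v w) (by simp) (by simp) (by simp) (by simp)

theorem form_sharp [FiniteDimensional ℝ E] (g : LorentzMetric E M) (p : Covector E M)
    (w : TangentSpace 𝓘(ℝ, E) p.1) : g.form p.1 (g.sharp p) w = p.2 w :=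
  congrArg (fun L : TangentSpace 𝓘(ℝ, E) p.1 →L[ℝ] ℝ ↦ L w)
    ((g.form_isInvertible p.1).self_apply_inverse p.2)

theorem bilinForm_nondegenerate [FiniteDimensional ℝ E] (g : LorentzMetric E M) (x : M) :
    (g.bilinForm x).Nondegenerate := by
  have h (v : TangentSpace 𝓘(ℝ, E) x) (hv : ∀ w, g.form x v w = 0) : v = 0 :=
    (g.form_isInvertible x).injective (by ext w; simp [hv w])
  exact ⟨h, fun v hv ↦ h v fun w ↦ (g.symm x v w).trans (hv w)⟩

end LorentzMetric

namespace LightRayFamily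

variable {g : LorentzMetric E M} (F : LightRayFamily g) {q : (Fin 2 → ℝ) × ℝ} {s : ℝ}

/-- The derivative of the family in the direction `w` of the parameters `(z, a)`. -/
def paramField (q w : (Fin 2 → ℝ) × ℝ) (s : ℝ) : TangentSpace 𝓘(ℝ, E) (F.γ q s) :=
  variationField E (fun u : ((Fin 2 → ℝ) × ℝ) × ℝ ↦ F.γ u.1 u.2) q w s

/-- The Jacobi fields that are spanned by the derivatives of the family in the parameters `(z, a)`
and in affine changes of the parameter of the geodesics. -/
def jacobiField (q : (Fin 2 → ℝ) × ℝ) (k : ((Fin 2 → ℝ) × ℝ) × ℝ × ℝ) (s : ℝ) :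
    TangentSpace 𝓘(ℝ, E) (F.γ q s) :=
  F.paramField q k.1 s + (k.2.1 + s * k.2.2) • velocity E (F.γ q) s

theorem eventually_mem (hq : q ∈ F.Z ×ˢ F.A) : ∀ᶠ q' in 𝓝 q, q' ∈ F.Z ×ˢ F.A :=
  (F.isOpen_Z.prod F.isOpen_A).mem_nhds hq

theorem contMDiffAt_flow (hq : q ∈ F.Z ×ˢ F.A) (hs : s ∈ Icc 0 F.ℓ) :
    ContMDiffAt 𝓘(ℝ, ((Fin 2 → ℝ) × ℝ) × ℝ) 𝓘(ℝ, E) ∞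
      (fun u : ((Fin 2 → ℝ) × ℝ) × ℝ ↦ F.γ u.1 u.2) (q, s) :=
  F.smooth_γ q.1 hq.1 q.2 hq.2 s hs

theorem isGeodesicOn (hq : q ∈ F.Z ×ˢ F.A) : g.IsGeodesicOn (F.γ q) (Icc 0 F.ℓ) :=
  F.geodesic q.1 hq.1 q.2 hq.2

theorem paramField_add (w w' : (Fin 2 → ℝ) × ℝ) :
    F.paramField q (w + w') s = F.paramField q w s + F.paramField q w' s :=
  map_add _ w w'

theorem paramField_smul (c : ℝ) (w : (Fin 2 → ℝ) × ℝ) :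
    F.paramField q (c • w) s = c • F.paramField q w s :=
  map_smul _ c w

theorem jacobiField_add (k l : ((Fin 2 → ℝ) × ℝ) × ℝ × ℝ) :
    F.jacobiField q (k + l) s = F.jacobiField q k s + F.jacobiField q l s := by
  simp only [jacobiField, Prod.fst_add, Prod.snd_add, paramField_add]
  module

theorem jacobiField_smul (c : ℝ) (k : ((Fin 2 → ℝ) × ℝ) × ℝ × ℝ) :
    F.jacobiField q (c • k) s = c • F.jacobiField q k s := by
  simp only [jacobiField, Prod.smul_fst, Prod.smul_snd, paramField_smul, smul_eq_mul]
  module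

theorem jacobiField_velocity (c d : ℝ) :
    F.jacobiField q (0, (c, d)) s = (c + s * d) • velocity E (F.γ q) s := by
  have := F.paramField_smul (q := q) (s := s) 0 0
  simp only [zero_smul] at this
  simp only [jacobiField, this, zero_add]

theorem zero_mem_Icc : (0 : ℝ) ∈ Icc 0 F.ℓ := left_mem_Icc.2 F.ℓ_pos.le

theorem mem_source_Ψ (hq : q ∈ F.Z ×ˢ F.A) : ((0 : ℝ), q.1) ∈ F.Ψ.source := by
  rw [F.source_Ψ]
  exact ⟨⟨by linarith [F.T_pos], F.T_pos⟩, hq.1⟩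

theorem chartVec_velocity_zero (hq : q ∈ F.Z ×ˢ F.A) (p : M) :
    (chartVec p (F.γ q 0) (velocity E (F.γ q) 0) : E)
      = chartVec p (F.Ψ (0, q.1)) (mfderiv 𝓘(ℝ, ℝ × (Fin 2 → ℝ)) 𝓘(ℝ, E) F.Ψ ((0 : ℝ), q.1)
        ((1 : ℝ), F.θ q)) :=
  congrArg (fun v : TangentBundle 𝓘(ℝ, E) M ↦ (chartVec p v.1 v.2 : E))
    (F.initial q.1 hq.1 q.2 hq.2)

theorem γ_zero (hq : q ∈ F.Z ×ˢ F.A) : F.γ q 0 = F.Ψ (0, q.1) :=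
  congrArg (fun v : TangentBundle 𝓘(ℝ, E) M ↦ v.1) (F.initial q.1 hq.1 q.2 hq.2)

theorem mdifferentiableAt_Ψ (hq : q ∈ F.Z ×ˢ F.A) :
    MDifferentiableAt 𝓘(ℝ, ℝ × (Fin 2 → ℝ)) 𝓘(ℝ, E) F.Ψ ((0 : ℝ), q.1) :=
  ((F.smooth_Ψ _ (F.mem_source_Ψ hq)).contMDiffAt
    (F.Ψ.open_source.mem_nhds (F.mem_source_Ψ hq))).mdifferentiableAt (by simp)

theorem mfderiv_Ψ_injective (hq : q ∈ F.Z ×ˢ F.A) : Function.Injective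
    (mfderiv 𝓘(ℝ, ℝ × (Fin 2 → ℝ)) 𝓘(ℝ, E) F.Ψ ((0 : ℝ), q.1)) := by
  have h : F.Ψ.MDifferentiable 𝓘(ℝ, ℝ × (Fin 2 → ℝ)) 𝓘(ℝ, E) :=
    ⟨F.smooth_Ψ.mdifferentiableOn (by simp), F.smooth_Ψ_symm.mdifferentiableOn (by simp)⟩
  exact h.mfderiv_injective (F.mem_source_Ψ hq)

/-- The derivative of the coordinates `(t, z)`, seen in the chart around `γ_{z,a}(0)`. -/
def initialDeriv (q : (Fin 2 → ℝ) × ℝ) : ℝ × (Fin 2 → ℝ) →L[ℝ] E :=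
  fderiv ℝ (fun v : ℝ × (Fin 2 → ℝ) ↦ extChartAt 𝓘(ℝ, E) (F.γ q 0) (F.Ψ v)) ((0 : ℝ), q.1)

theorem Ψ_mem_source (hq : q ∈ F.Z ×ˢ F.A) :
    F.Ψ ((0 : ℝ), q.1) ∈ (chartAt E (F.γ q 0)).source := by
  rw [← F.γ_zero hq]
  exact mem_chart_source E _

theorem chartVec_mfderiv_Ψ (hq : q ∈ F.Z ×ˢ F.A) (v : ℝ × (Fin 2 → ℝ)) :
    (chartVec (F.γ q 0) (F.Ψ ((0 : ℝ), q.1))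
      (mfderiv 𝓘(ℝ, ℝ × (Fin 2 → ℝ)) 𝓘(ℝ, E) F.Ψ ((0 : ℝ), q.1) v) : E)
      = F.initialDeriv q v :=
  chartVec_mfderiv (F.mdifferentiableAt_Ψ hq) (F.Ψ_mem_source hq) v

theorem initialDeriv_injective (hq : q ∈ F.Z ×ˢ F.A) :
    Function.Injective (F.initialDeriv q) := by
  have h := (chartVec_bijective _ (F.Ψ_mem_source hq)).1.comp (F.mfderiv_Ψ_injective hq)
  intro v w hvw
  rw [← F.chartVec_mfderiv_Ψ hq, ← F.chartVec_mfderiv_Ψ hq] at hvw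
  exact h hvw

theorem chartVec_velocity_initial (hq : q ∈ F.Z ×ˢ F.A) :
    (chartVec (F.γ q 0) (F.γ q 0) (velocity E (F.γ q) 0) : E)
      = F.initialDeriv q ((1 : ℝ), F.θ q) :=
  (F.chartVec_velocity_zero hq _).trans (F.chartVec_mfderiv_Ψ hq _)

theorem velocity_zero_ne (hq : q ∈ F.Z ×ˢ F.A) : velocity E (F.γ q) 0 ≠ 0 := by
  intro h
  have h1 := F.chartVec_velocity_initial hq
  rw [h, chartVec_zero] at h1
  have h2 := (map_eq_zero_iff _ (F.initialDeriv_injective hq)).1 h1.symm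
  simp at h2

/-- The initial points `Ψ(0, z)` do not depend on `a`, so only the `z`-component of the direction
contributes. -/
theorem chartVec_paramField_initial (hq : q ∈ F.Z ×ˢ F.A) (w : (Fin 2 → ℝ) × ℝ) :
    (chartVec (F.γ q 0) (F.γ q 0) (F.paramField q w 0) : E)
      = F.initialDeriv q ((0 : ℝ), w.1) := by
  have hflow := F.contMDiffAt_flow hq F.zero_mem_Icc
  have hp := mem_chart_source E (F.γ q 0)
  refine (chartVec_mfderiv (mdifferentiableAt_slice_left
    hflow.eventually_mdifferentiableAt.self_of_nhds) hp w).trans ?_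
  have h1 : (fun q' ↦ extChartAt 𝓘(ℝ, E) (F.γ q 0) (F.γ q' 0))
      =ᶠ[𝓝 q] fun q' ↦ extChartAt 𝓘(ℝ, E) (F.γ q 0) (F.Ψ ((0 : ℝ), q'.1)) :=
    (F.eventually_mem hq).mono fun q' h ↦ by simp only [F.γ_zero h]
  have hX : DifferentiableAt ℝ
      (fun v : ℝ × (Fin 2 → ℝ) ↦ extChartAt 𝓘(ℝ, E) (F.γ q 0) (F.Ψ v)) ((0 : ℝ), q.1) :=
    ((mdifferentiableAt_extChartAt (I := 𝓘(ℝ, E)) (F.Ψ_mem_source hq)).comp _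
      (F.mdifferentiableAt_Ψ hq)).differentiableAt
  have h2 : HasFDerivAt (fun q' : (Fin 2 → ℝ) × ℝ ↦ ((0 : ℝ), q'.1))
      ((0 : (Fin 2 → ℝ) × ℝ →L[ℝ] ℝ).prod (ContinuousLinearMap.fst ℝ (Fin 2 → ℝ) ℝ)) q :=
    (hasFDerivAt_const (0 : ℝ) q).prodMk hasFDerivAt_fst
  have h3 := (HasFDerivAt.comp q hX.hasFDerivAt h2).congr_of_eventuallyEq h1
  exact congrArg (fun L : (Fin 2 → ℝ) × ℝ →L[ℝ] E ↦ L w) h3.fderiv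

theorem fieldM_eq (hq : q ∈ F.Z ×ˢ F.A) (hs : s ∈ Icc 0 F.ℓ) (j : Fin 2) :
    F.fieldM j q.1 q.2 s = F.paramField q (Pi.single j 1, 0) s := by
  have hflow := (F.contMDiffAt_flow hq hs).eventually_mdifferentiableAt.self_of_nhds
  have h : HasFDerivAt (fun z' : Fin 2 → ℝ ↦ (z', q.2))
      ((ContinuousLinearMap.id ℝ (Fin 2 → ℝ)).prod 0) q.1 :=
    (hasFDerivAt_id q.1).prodMk (hasFDerivAt_const q.2 q.1)
  have h1 := ((mdifferentiableAt_slice_left hflow).hasMFDerivAt.comp q.1 h.hasMFDerivAt).mfderiv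
  exact congrArg (fun L : (Fin 2 → ℝ) →L[ℝ] E ↦ L (Pi.single j 1)) h1

theorem fieldJ_eq (hq : q ∈ F.Z ×ˢ F.A) (hs : s ∈ Icc 0 F.ℓ) :
    F.fieldJ q.1 q.2 s = F.paramField q (0, 1) s := by
  have hflow := (F.contMDiffAt_flow hq hs).eventually_mdifferentiableAt.self_of_nhds
  have h : HasFDerivAt (fun a' : ℝ ↦ (q.1, a'))
      ((0 : ℝ →L[ℝ] (Fin 2 → ℝ)).prod (ContinuousLinearMap.id ℝ ℝ)) q.2 :=
    (hasFDerivAt_const q.1 q.2).prodMk (hasFDerivAt_id q.2)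
  have h1 := ((mdifferentiableAt_slice_left hflow).hasMFDerivAt.comp q.2 h.hasMFDerivAt).mfderiv
  exact congrArg (fun L : ℝ →L[ℝ] E ↦ L 1) h1

theorem paramField_eq (hq : q ∈ F.Z ×ˢ F.A) (hs : s ∈ Icc 0 F.ℓ) (w : (Fin 2 → ℝ) × ℝ) :
    F.paramField q w s = w.1 0 • F.fieldM 0 q.1 q.2 s + w.1 1 • F.fieldM 1 q.1 q.2 s
      + w.2 • F.fieldJ q.1 q.2 s := by
  have hw : w = w.1 0 • (Pi.single 0 1, 0) + w.1 1 • (Pi.single 1 1, 0) + w.2 • (0, 1) := by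
    refine Prod.ext (funext fun j ↦ ?_) (by simp)
    fin_cases j <;> simp
  rw [F.fieldM_eq hq hs, F.fieldM_eq hq hs, F.fieldJ_eq hq hs, ← paramField_smul,
    ← paramField_smul, ← paramField_smul, ← paramField_add, ← paramField_add, ← hw]

variable [FiniteDimensional ℝ E]

theorem isJacobiOn_paramField (hq : q ∈ F.Z ×ˢ F.A) (w : (Fin 2 → ℝ) × ℝ) :
    g.IsJacobiOn (F.γ q) (F.paramField q w) (Icc 0 F.ℓ) :=
  g.isJacobiOn_variationField (fun _ hs ↦ F.contMDiffAt_flow hq hs)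
    ((F.eventually_mem hq).mono fun _ h ↦ F.isGeodesicOn h) w

theorem isJacobiOn_jacobiField (hq : q ∈ F.Z ×ˢ F.A) (k : ((Fin 2 → ℝ) × ℝ) × ℝ × ℝ) :
    g.IsJacobiOn (F.γ q) (F.jacobiField q k) (Icc 0 F.ℓ) :=
  (F.isJacobiOn_paramField hq k.1).add
    ((F.isGeodesicOn hq).isJacobiOn_smul_velocity F.ℓ_pos k.2.1 k.2.2)

theorem covDeriv_jacobiField (hq : q ∈ F.Z ×ˢ F.A) (hs : s ∈ Icc 0 F.ℓ)
    (k : ((Fin 2 → ℝ) × ℝ) × ℝ × ℝ) : g.covDeriv (F.γ q) (F.jacobiField q k) s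
      = g.covDeriv (F.γ q) (F.paramField q k.1) s + k.2.2 • velocity E (F.γ q) s := by
  have hv := smoothFieldAt_velocity ((F.isGeodesicOn hq) s hs).1
  have hf : ContDiffAt ℝ ∞ (fun r : ℝ ↦ k.2.1 + r * k.2.2) s := by fun_prop
  have hd : HasDerivAt (fun r : ℝ ↦ k.2.1 + r * k.2.2) k.2.2 s := by
    simpa using ((hasDerivAt_id s).mul_const k.2.2).const_add k.2.1
  refine (g.covDeriv_add ((F.isJacobiOn_paramField hq k.1).smooth hs) (hv.smul hf)).trans ?_
  rw [g.covDeriv_smul hv hf, ((F.isGeodesicOn hq) s hs).2, hd.deriv, smul_zero, add_zero]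

/-- The Cauchy data at `s` of the Jacobi fields of the family. -/
def cauchyData (hq : q ∈ F.Z ×ˢ F.A) (hs : s ∈ Icc 0 F.ℓ) : ((Fin 2 → ℝ) × ℝ) × ℝ × ℝ →ₗ[ℝ]
    TangentSpace 𝓘(ℝ, E) (F.γ q s) × TangentSpace 𝓘(ℝ, E) (F.γ q s) where
  toFun k := (F.jacobiField q k s, g.covDeriv (F.γ q) (F.jacobiField q k) s)
  map_add' k l := by
    have hk := (F.isJacobiOn_jacobiField hq k).smooth hs
    have hl := (F.isJacobiOn_jacobiField hq l).smooth hs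
    refine Prod.ext (F.jacobiField_add k l) (Eq.trans ?_ (g.covDeriv_add hk hl))
    exact g.covDeriv_congr (.of_forall fun r ↦ F.jacobiField_add k l)
  map_smul' c k := by
    have hk := (F.isJacobiOn_jacobiField hq k).smooth hs
    refine Prod.ext (F.jacobiField_smul c k) ?_
    have h1 := g.covDeriv_congr (γ := F.γ q) (s := s)
      (.of_forall fun r ↦ F.jacobiField_smul (q := q) (s := r) c k)
    refine h1.trans ((g.covDeriv_smul hk contDiffAt_const).trans ?_)
    simp

theorem cauchyData_apply (hq : q ∈ F.Z ×ˢ F.A) (hs : s ∈ Icc 0 F.ℓ)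
    (k : ((Fin 2 → ℝ) × ℝ) × ℝ × ℝ) : F.cauchyData hq hs k
      = (F.jacobiField q k s, g.covDeriv (F.γ q) (F.jacobiField q k) s) := rfl

/-- The square is `-1 + |θ|² = 0` at the start, and it is constant along a geodesic. -/
theorem form_velocity (hq : q ∈ F.Z ×ˢ F.A) (hs : s ∈ Icc 0 F.ℓ) :
    g.form (F.γ q s) (velocity E (F.γ q) s) (velocity E (F.γ q) s) = 0 := by
  have h0 : g.form (F.γ q 0) (velocity E (F.γ q) 0) (velocity E (F.γ q) 0) = 0 := by
    refine (congrArg (fun v : TangentBundle 𝓘(ℝ, E) M ↦ g.form v.1 v.2 v.2)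
      (F.initial q.1 hq.1 q.2 hq.2)).trans ?_
    refine (F.semigeodesic _ (F.mem_source_Ψ hq) 1 (F.θ q)).trans ?_
    rw [F.unit_θ q.1 hq.1 q.2 hq.2]
    norm_num
  have h (r : ℝ) (hr : r ∈ Icc 0 F.ℓ) : HasDerivAt
      (fun r ↦ g.form (F.γ q r) (velocity E (F.γ q) r) (velocity E (F.γ q) r)) 0 r := by
    obtain ⟨h1, h2⟩ := F.isGeodesicOn hq r hr
    have h3 := smoothFieldAt_velocity h1
    refine (g.hasDerivAt_form h3 h3).congr_deriv ?_
    simp [h2]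
  rw [← h0]
  exact constant_of_has_deriv_right_zero (fun r hr ↦ (h r hr).continuousAt.continuousWithinAt)
    (fun r hr ↦ (h r (Ico_subset_Icc_self hr)).hasDerivWithinAt) s hs

/-- All nearby geodesics of the family are lightlike, so the square of the velocity is constant
under variation. The multiple of `γ̇` in the derivative does not matter, since `γ̇` is orthogonal to
itself. -/
theorem form_velocity_covDeriv (hq : q ∈ F.Z ×ˢ F.A) (hs : s ∈ Icc 0 F.ℓ)
    (k : ((Fin 2 → ℝ) × ℝ) × ℝ × ℝ) : g.form (F.γ q s) (velocity E (F.γ q) s)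
      (g.covDeriv (F.γ q) (F.jacobiField q k) s) = 0 := by
  have h := g.form_covDeriv_variationField (F.contMDiffAt_flow hq hs) k.1 (k := 0)
    ((F.eventually_mem hq).mono fun _ h ↦ F.form_velocity h hs)
  rw [F.covDeriv_jacobiField hq hs, map_add, map_smul, F.form_velocity hq hs, smul_zero, add_zero,
    g.symm]
  exact h

theorem form_velocity_jacobiField (hq : q ∈ F.Z ×ˢ F.A) (hs : s ∈ Icc 0 F.ℓ)
    (k : ((Fin 2 → ℝ) × ℝ) × ℝ × ℝ) :
    g.form (F.γ q s) (velocity E (F.γ q) s) (F.jacobiField q k s)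
      = g.form (F.γ q 0) (velocity E (F.γ q) 0) (F.jacobiField q k 0) := by
  have h (r : ℝ) (hr : r ∈ Icc 0 F.ℓ) : HasDerivAt
      (fun r ↦ g.form (F.γ q r) (velocity E (F.γ q) r) (F.jacobiField q k r)) 0 r := by
    obtain ⟨h1, h2⟩ := F.isGeodesicOn hq r hr
    refine (g.hasDerivAt_form (smoothFieldAt_velocity h1)
      ((F.isJacobiOn_jacobiField hq k).smooth hr)).congr_deriv ?_
    simp [h2, F.form_velocity_covDeriv hq hr]
  exact constant_of_has_deriv_right_zero (fun r hr ↦ (h r hr).continuousAt.continuousWithinAt)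
    (fun r hr ↦ (h r (Ico_subset_Icc_self hr)).hasDerivWithinAt) s hs

/-- A variation in `a` alone fixes the initial point. By the symmetry lemma the covariant derivative
is then the plain derivative of the initial velocity `dΨ(1, θ)` in one tangent space, without a
Christoffel term. -/
theorem chartVec_covDeriv_initial (hq : q ∈ F.Z ×ˢ F.A) (β : ℝ) :
    (chartVec (F.γ q 0) (F.γ q 0) (g.covDeriv (F.γ q) (F.paramField q (0, β)) 0) : E)
      = F.initialDeriv q ((0 : ℝ), β • deriv (fun b ↦ F.θ (q.1, b)) q.2) := by
  have hp := mem_chart_source E (F.γ q 0)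
  refine (g.chartVec_covDeriv_variationField (F.contMDiffAt_flow hq F.zero_mem_Icc)
    (0, β) hp).trans ?_
  have hline (t : ℝ) : q + t • ((0 : Fin 2 → ℝ), β) = (q.1, q.2 + t * β) := by
    ext <;> simp
  have hev : ∀ᶠ t : ℝ in 𝓝 0, (q.1, q.2 + t * β) ∈ F.Z ×ˢ F.A :=
    (Continuous.tendsto' (by fun_prop) _ _ (by simp) :
      Filter.Tendsto (fun t : ℝ ↦ (q.1, q.2 + t * β)) (𝓝 0) (𝓝 q)) (F.eventually_mem hq)
  have h1 : (fun t : ℝ ↦ extChartAt 𝓘(ℝ, E) (F.γ q 0) (F.γ (q + t • (0, β)) 0))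
      =ᶠ[𝓝 0] fun _ ↦ extChartAt 𝓘(ℝ, E) (F.γ q 0) (F.Ψ ((0 : ℝ), q.1)) := by
    filter_upwards [hev] with t ht
    rw [hline, F.γ_zero ht]
  have h2 : (fun t : ℝ ↦ (chartVec (F.γ q 0) (F.γ (q + t • (0, β)) 0)
        (velocity E (F.γ (q + t • (0, β))) 0) : E))
      =ᶠ[𝓝 0] fun t ↦ F.initialDeriv q ((1 : ℝ), F.θ (q.1, q.2 + t * β)) := by
    filter_upwards [hev] with t ht
    rw [hline, F.chartVec_velocity_zero ht]
    exact F.chartVec_mfderiv_Ψ hq _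
  have hθ : DifferentiableAt ℝ (fun b ↦ F.θ (q.1, b)) q.2 := by
    have h3 := ((F.smooth_θ q hq).contDiffAt (F.eventually_mem hq)).differentiableAt (by simp)
    exact DifferentiableAt.comp q.2 h3 (by fun_prop)
  have hθ' : HasDerivAt (fun t : ℝ ↦ F.θ (q.1, q.2 + t * β))
      (β • deriv (fun b ↦ F.θ (q.1, b)) q.2) 0 := by
    have h3 : HasDerivAt (fun t : ℝ ↦ q.2 + t * β) β 0 := by
      simpa using ((hasDerivAt_id (0 : ℝ)).mul_const β).const_add q.2
    have h5 : HasDerivAt (fun b ↦ F.θ (q.1, b)) (deriv (fun b ↦ F.θ (q.1, b)) q.2)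
        (q.2 + 0 * β) := by simpa using hθ.hasDerivAt
    exact h5.scomp (0 : ℝ) h3
  have h4 := (F.initialDeriv q).hasFDerivAt.comp_hasDerivAt 0
    ((hasDerivAt_const (0 : ℝ) (1 : ℝ)).prodMk hθ')
  refine (covAlong_congr _ h1 h2).trans ?_
  rw [covAlong, deriv_const]
  refine (congrArg₂ (· + ·) h4.deriv ?_).trans (add_zero _)
  simpa using christoffelOf_smul_left (g.coordForm (F.γ q 0)) 0
    (extChartAt 𝓘(ℝ, E) (F.γ q 0) (F.Ψ ((0 : ℝ), q.1))) 0
    (F.initialDeriv q ((1 : ℝ), F.θ (q.1, q.2 + 0 * β)))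

/-- In the coordinates `(t, z)` the value at `0` is `(c, b + c θ)`, whose vanishing gives `c = 0`
and `b = 0`. The derivative is then `(d, β ∂ₐθ + d θ)`, whose vanishing gives `d = 0` and, because
`∂ₐθ ≠ 0`, also `β = 0`. -/
theorem cauchyData_injective_initial (hq : q ∈ F.Z ×ˢ F.A) :
    Function.Injective (F.cauchyData hq F.zero_mem_Icc) := by
  rw [injective_iff_map_eq_zero]
  rintro ⟨⟨b, β⟩, c, d⟩ hk
  rw [cauchyData_apply, Prod.mk_eq_zero] at hk
  obtain ⟨hk1, hk2⟩ := hk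
  have h1 : F.initialDeriv q (c, b + c • F.θ q) = 0 := by
    have h := congrArg (fun v : TangentSpace 𝓘(ℝ, E) (F.γ q 0) ↦
      (chartVec (F.γ q 0) (F.γ q 0) v : E)) hk1
    simp only [jacobiField, zero_mul, add_zero, chartVec_add, chartVec_smul, chartVec_zero] at h
    rw [F.chartVec_paramField_initial hq, F.chartVec_velocity_initial hq, ← map_smul,
      ← map_add] at h
    simpa using h
  have h2 := (map_eq_zero_iff _ (F.initialDeriv_injective hq)).1 h1
  rw [Prod.mk_eq_zero] at h2
  obtain ⟨rfl, h2⟩ := h2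
  obtain rfl : b = 0 := by simpa using h2
  have h3 : F.initialDeriv q (d, β • deriv (fun b ↦ F.θ (q.1, b)) q.2 + d • F.θ q) = 0 := by
    rw [F.covDeriv_jacobiField hq F.zero_mem_Icc] at hk2
    have h := congrArg (fun v : TangentSpace 𝓘(ℝ, E) (F.γ q 0) ↦
      (chartVec (F.γ q 0) (F.γ q 0) v : E)) hk2
    simp only [chartVec_add, chartVec_smul, chartVec_zero] at h
    rw [F.chartVec_covDeriv_initial hq, F.chartVec_velocity_initial hq, ← map_smul,
      ← map_add] at h
    simpa using h
  have h4 := (map_eq_zero_iff _ (F.initialDeriv_injective hq)).1 h3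
  rw [Prod.mk_eq_zero] at h4
  obtain ⟨rfl, h4⟩ := h4
  rw [zero_smul, add_zero, smul_eq_zero] at h4
  rw [h4.resolve_right (F.deriv_θ_ne q.1 hq.1 q.2 hq.2)]
  rfl

theorem finrank_param : finrank ℝ (((Fin 2 → ℝ) × ℝ) × ℝ × ℝ) = 5 := by simp

theorem cauchyData_affine (hq : q ∈ F.Z ×ˢ F.A) (hs : s ∈ Icc 0 F.ℓ) (c d : ℝ) :
    F.cauchyData hq hs (0, (c, d))
      = ((c + s * d) • velocity E (F.γ q) s, d • velocity E (F.γ q) s) := by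
  have hv := smoothFieldAt_velocity ((F.isGeodesicOn hq) s hs).1
  have hf : ContDiffAt ℝ ∞ (fun r : ℝ ↦ c + r * d) s := by fun_prop
  have hd : HasDerivAt (fun r : ℝ ↦ c + r * d) d s := by
    simpa using ((hasDerivAt_id s).mul_const d).const_add c
  refine Prod.ext (F.jacobiField_velocity c d) ?_
  refine (g.covDeriv_congr (.of_forall fun r ↦ F.jacobiField_velocity (s := r) c d)).trans ?_
  rw [g.covDeriv_smul hv hf, ((F.isGeodesicOn hq) s hs).2, hd.deriv, smul_zero, add_zero]

theorem cauchyData_velocity (hq : q ∈ F.Z ×ˢ F.A) (hs : s ∈ Icc 0 F.ℓ) :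
    F.cauchyData hq hs (0, (1, 0)) = (velocity E (F.γ q) s, 0) := by
  simp [cauchyData_affine]

/-- The product `g(γ̇, K)` is constant for each field `K` of the family. If `γ̇(s) = 0`, it vanishes
at `0` as well; since `K(0)` is arbitrary there, nondegeneracy gives `γ̇(0) = 0`, which is false. -/
theorem velocity_ne (hE : finrank ℝ E = 3) (hq : q ∈ F.Z ×ˢ F.A) (hs : s ∈ Icc 0 F.ℓ) :
    velocity E (F.γ q) s ≠ 0 := by
  intro h
  have hn := F.velocity_zero_ne hq
  refine hn ((g.bilinForm_nondegenerate (F.γ q 0)).1 _ fun w ↦ ?_)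
  obtain ⟨k, hk⟩ := LinearMap.BilinForm.exists_apply_eq_of_orthogonal hE finrank_param
    (g.bilinForm_nondegenerate (F.γ q 0)) hn (F.cauchyData_injective_initial hq)
    (F.form_velocity_covDeriv hq F.zero_mem_Icc) (v := w) (map_zero _)
  have h1 := F.form_velocity_jacobiField hq hs k
  rw [h, map_zero] at h1
  have h2 : F.jacobiField q k 0 = w := congrArg Prod.fst hk
  rw [h2] at h1
  exact h1.symm

theorem cauchyData_symplectic (hq : q ∈ F.Z ×ˢ F.A) {s t : ℝ} (hs : s ∈ Icc 0 F.ℓ)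
    (ht : t ∈ Icc 0 F.ℓ) (k l : ((Fin 2 → ℝ) × ℝ) × ℝ × ℝ) :
    g.bilinForm (F.γ q t) (F.cauchyData hq ht k).2 (F.cauchyData hq ht l).1
        - g.bilinForm (F.γ q t) (F.cauchyData hq ht k).1 (F.cauchyData hq ht l).2
      = g.bilinForm (F.γ q s) (F.cauchyData hq hs k).2 (F.cauchyData hq hs l).1
        - g.bilinForm (F.γ q s) (F.cauchyData hq hs k).1 (F.cauchyData hq hs l).2 := by
  have hk := F.isJacobiOn_jacobiField hq k
  have hl := F.isJacobiOn_jacobiField hq l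
  exact (hk.wronskian_eq hl ht).trans (hk.wronskian_eq hl hs).symm

/-- Conservation of the Wronskian carries injectivity from `0` to `s`, in the role of the uniqueness
theorem for the Jacobi equation. -/
theorem cauchyData_injective (hE : finrank ℝ E = 3) (hq : q ∈ F.Z ×ˢ F.A) (hs : s ∈ Icc 0 F.ℓ) :
    Function.Injective (F.cauchyData hq hs) :=
  LinearMap.BilinForm.injective_of_symplectic hE finrank_param
    (g.bilinForm_nondegenerate (F.γ q 0)) (F.velocity_zero_ne hq) (F.velocity_ne hE hq hs)
    (F.cauchyData_injective_initial hq) (F.form_velocity_covDeriv hq F.zero_mem_Icc)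
    (F.cauchyData_symplectic hq F.zero_mem_Icc hs) (F.cauchyData_velocity hq F.zero_mem_Icc)
    (F.cauchyData_velocity hq hs)

end LightRayFamily

end LightRays

/-! ### Common elements of the canonical relation and linked covectors -/

section Linking

open Module

variable {E : Type*} [NormedAddCommGroup E] [NormedSpace ℝ E]
  {M : Type*} [TopologicalSpace M] [ChartedSpace E M] [IsManifold 𝓘(ℝ, E) ∞ M]
  {g : LorentzMetric E M} (F : LightRayFamily g) {q : (Fin 2 → ℝ) × ℝ} {s s₁ s₂ : ℝ}

namespace LightRayFamily

theorem mem_C_iff {p : Covector E M} {c : ParamCovector} : c ∈ F.C p ↔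
    c.z ∈ F.Z ∧ c.a ∈ F.A ∧ p.1 ∈ F.Ω ∧ p.2 ≠ 0 ∧
    ∃ s ∈ Ioo 0 F.ℓ, ∃ ξ : TangentSpace 𝓘(ℝ, E) (F.γ (c.z, c.a) s) →L[ℝ] ℝ,
      p = ⟨F.γ (c.z, c.a) s, ξ⟩ ∧ ξ (velocity E (F.γ (c.z, c.a)) s) = 0 ∧
      (∀ j, c.ζ j = ξ (F.fieldM j c.z c.a s)) ∧ c.α = ξ (F.fieldJ c.z c.a s) :=
  Iff.rfl

theorem segment_mem_Icc (hs₁ : s₁ ∈ Ioo 0 F.ℓ) (hs₂ : s₂ ∈ Ioo 0 F.ℓ) {r : ℝ}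
    (hr : r ∈ Icc (0 : ℝ) 1) : s₁ + r * (s₂ - s₁) ∈ Icc 0 F.ℓ := by
  have h := (convex_Icc 0 F.ℓ).add_smul_sub_mem (Ioo_subset_Icc_self hs₁)
    (Ioo_subset_Icc_self hs₂) hr
  simpa using h

/-- Since `ξ` annihilates `γ̇`, its values on the whole family are determined by the components `ζ`
and `α`. -/
theorem apply_jacobiField (hq : q ∈ F.Z ×ˢ F.A) (hs : s ∈ Icc 0 F.ℓ)
    {ξ : TangentSpace 𝓘(ℝ, E) (F.γ q s) →L[ℝ] ℝ} (hξ : ξ (velocity E (F.γ q) s) = 0)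
    (k : ((Fin 2 → ℝ) × ℝ) × ℝ × ℝ) : ξ (F.jacobiField q k s)
      = k.1.1 0 * ξ (F.fieldM 0 q.1 q.2 s) + k.1.1 1 * ξ (F.fieldM 1 q.1 q.2 s)
        + k.1.2 * ξ (F.fieldJ q.1 q.2 s) := by
  rw [jacobiField, F.paramField_eq hq hs]
  simp only [map_add, map_smul, hξ, smul_eq_mul, mul_zero, add_zero]

theorem mdifferentiableAt_γ (hq : q ∈ F.Z ×ˢ F.A) (hs : s ∈ Icc 0 F.ℓ) :
    MDifferentiableAt 𝓘(ℝ, ℝ) 𝓘(ℝ, E) (F.γ q) s :=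
  (F.isGeodesicOn hq s hs).1.mdifferentiableAt (by simp)

variable [FiniteDimensional ℝ E]

/-- The field of `k` vanishes at `s₁` and is `c γ̇` at `s₂`. With `δ = s₂ - s₁`, of either sign,
subtracting `(c / δ) (s - s₁) γ̇` makes it vanish at both ends and lowers its derivative by `(c / δ)
γ̇` at both ends. -/
theorem linkedAlong_of_cauchyData (hE : finrank ℝ E = 3) (hq : q ∈ F.Z ×ˢ F.A)
    (hs₁ : s₁ ∈ Ioo 0 F.ℓ) (hs₂ : s₂ ∈ Ioo 0 F.ℓ) (hne : s₁ ≠ s₂)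
    {ξ : TangentSpace 𝓘(ℝ, E) (F.γ q s₁) →L[ℝ] ℝ} {η : TangentSpace 𝓘(ℝ, E) (F.γ q s₂) →L[ℝ] ℝ}
    (hξ : g.IsSpacelike ⟨F.γ q s₁, ξ⟩) {k : ((Fin 2 → ℝ) × ℝ) × ℝ × ℝ} {c : ℝ}
    (h₁ : F.cauchyData hq (Ioo_subset_Icc_self hs₁) k = (0, g.sharp ⟨F.γ q s₁, ξ⟩))
    (h₂ : F.cauchyData hq (Ioo_subset_Icc_self hs₂) k
      = (c • velocity E (F.γ q) s₂, g.sharp ⟨F.γ q s₂, η⟩)) :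
    F.LinkedAlong ⟨F.γ q s₁, ξ⟩ ⟨F.γ q s₂, η⟩ q.1 q.2 := by
  obtain ⟨δ, hδ_def⟩ : ∃ δ, s₂ - s₁ = δ := ⟨_, rfl⟩
  have hδ : δ ≠ 0 := hδ_def ▸ sub_ne_zero.2 hne.symm
  have hmem {r : ℝ} (hr : r ∈ Icc (0 : ℝ) 1) : s₁ + r * δ ∈ Icc 0 F.ℓ :=
    hδ_def ▸ F.segment_mem_Icc hs₁ hs₂ hr
  have e0 : s₁ + 0 * δ = s₁ := by ring
  have e1 : s₁ + 1 * δ = s₂ := by rw [← hδ_def]; ring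
  -- The added element is the field `(c / δ) (s₁ - s) γ̇`. The factor `δ⁻¹` compensates the factor
  -- `δ` that the covariant derivative acquires on the segment parametrized over `[0, 1]`.
  set k' := δ⁻¹ • (k + (0, (c / δ * s₁, -(c / δ))))
  have h₁' : F.cauchyData hq (Ioo_subset_Icc_self hs₁) k'
      = (0, δ⁻¹ • (g.sharp ⟨F.γ q s₁, ξ⟩ - (c / δ) • velocity E (F.γ q) s₁)) := by
    rw [map_smul, map_add, h₁, cauchyData_affine]
    refine Prod.ext ?_ ?_
    · simp [mul_comm]
    · simp [sub_eq_add_neg]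
  have h₂' : F.cauchyData hq (Ioo_subset_Icc_self hs₂) k'
      = (0, δ⁻¹ • (g.sharp ⟨F.γ q s₂, η⟩ - (c / δ) • velocity E (F.γ q) s₂)) := by
    have hc : c + (c / δ * s₁ + s₂ * -(c / δ)) = 0 := by
      field_simp
      rw [← hδ_def]
      ring
    rw [map_smul, map_add, h₂, cauchyData_affine]
    refine Prod.ext ?_ ?_
    · rw [Prod.smul_fst, Prod.fst_add, ← add_smul, hc, zero_smul, smul_zero]
    · simp [sub_eq_add_neg]
  have hgeo := (F.isGeodesicOn hq).affine (a := s₁) (c := δ) (T := Icc 0 1) fun r hr ↦ hmem hr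
  have hjac := (F.isJacobiOn_jacobiField hq k').affine (a := s₁) (c := δ) (T := Icc 0 1)
    fun r hr ↦ hmem hr
  have hvel {r : ℝ} (hr : r ∈ Icc (0 : ℝ) 1) :=
    velocity_affine (F.mdifferentiableAt_γ hq (hmem hr))
  have hcov {r : ℝ} (hr : r ∈ Icc (0 : ℝ) 1) :=
    g.covDeriv_affine (V := F.jacobiField q k') (F.mdifferentiableAt_γ hq (hmem hr))
  have z0 : (0 : ℝ) ∈ Icc (0 : ℝ) 1 := by simp
  have z1 : (1 : ℝ) ∈ Icc (0 : ℝ) 1 := by simp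
  have J0 : F.jacobiField q k' (s₁ + 0 * δ) = 0 := by
    rw [e0]
    exact congrArg Prod.fst h₁'
  have J1 : F.jacobiField q k' (s₁ + 1 * δ) = 0 := by
    rw [e1]
    exact congrArg Prod.fst h₂'
  have D1 : g.covDeriv (F.γ q) (F.jacobiField q k') s₁
      = δ⁻¹ • (g.sharp ⟨F.γ q s₁, ξ⟩ - (c / δ) • velocity E (F.γ q) s₁) := congrArg Prod.snd h₁'
  have D2 : g.covDeriv (F.γ q) (F.jacobiField q k') s₂
      = δ⁻¹ • (g.sharp ⟨F.γ q s₂, η⟩ - (c / δ) • velocity E (F.γ q) s₂) := congrArg Prod.snd h₂'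
  -- The points `γ (s₁ + 0 * δ)` and `γ s₁` agree only after rewriting, so the vectors are compared
  -- in the tangent bundle. The coefficient `λ` is `c / δ / δ` because the velocity of the segment
  -- is `δ γ̇`.
  have aux {y y' : M} (h : y' = y) (x v : TangentSpace 𝓘(ℝ, E) y) :
      (⟨y, x⟩ : TangentBundle 𝓘(ℝ, E) M) = ⟨y', (δ • δ⁻¹ • (x - (c / δ) • v)
        + (c / δ / δ) • δ • v : TangentSpace 𝓘(ℝ, E) y)⟩ := by
    subst h
    rw [smul_inv_smul₀ hδ, smul_smul, div_mul_cancel₀ _ hδ, sub_add_cancel]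
  have key : g.Linked ⟨F.γ q s₁, ξ⟩ ⟨F.γ q s₂, η⟩ (fun r ↦ F.γ q (s₁ + r * δ)) := by
    refine ⟨⟨hgeo, fun r hr ↦ ?_⟩, congrArg (F.γ q) e0, congrArg (F.γ q) e1,
      ⟨_, hjac, J0, J1, ?_⟩, _, c / δ / δ, hjac, J0, J1, ?_, ?_⟩
    · rw [hvel hr]
      refine ⟨smul_ne_zero hδ (F.velocity_ne hE hq (hmem hr)), ?_⟩
      have := F.form_velocity hq (hmem hr)
      simp [this]
    -- If the field were zero on the segment, its initial derivative would vanish and `ξ_*` would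
    -- equal `(c / δ) γ̇`, which is not spacelike.
    · by_contra! h0
      have h := g.covDeriv_eq_zero_of_eqOn (hjac.smooth z0) h0 z0
        (uniqueDiffOn_Icc zero_lt_one 0 z0)
      rw [hcov z0, smul_eq_zero_iff_right hδ, e0, D1, smul_eq_zero_iff_right (inv_ne_zero hδ),
        sub_eq_zero] at h
      have h3 := hξ
      rw [LorentzMetric.IsSpacelike, h] at h3
      have := F.form_velocity hq (Ioo_subset_Icc_self hs₁)
      simp [this] at h3
    · rw [hcov z0, hvel z0, e0, D1]
      exact aux (congrArg (F.γ q) e0) _ _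
    · rw [hcov z1, hvel z1, e1, D2]
      exact aux (congrArg (F.γ q) e1) _ _
  rw [← hδ_def] at key
  exact ⟨s₁, hs₁, s₂, hs₂, key⟩

theorem linkedAlong_of_mem (hE : finrank ℝ E = 3) {p₁ p₂ : Covector E M}
    (hp₁ : g.IsSpacelike p₁) (hne : p₁ ≠ p₂) {c : ParamCovector}
    (h₁ : c ∈ F.C p₁) (h₂ : c ∈ F.C p₂) : F.LinkedAlong p₁ p₂ c.z c.a := by
  obtain ⟨hz, ha, -, -, s₁, hs₁, ξ, rfl, hξ, hξM, hξJ⟩ := F.mem_C_iff.1 h₁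
  obtain ⟨-, -, -, -, s₂, hs₂, η, rfl, hη, hηM, hηJ⟩ := F.mem_C_iff.1 h₂
  have hq : (c.z, c.a) ∈ F.Z ×ˢ F.A := ⟨hz, ha⟩
  have hs₁' := Ioo_subset_Icc_self hs₁
  have hs₂' := Ioo_subset_Icc_self hs₂
  -- Equality of the `ζ` and `α` components says that `ξ` and `η` take the same values on all fields
  -- of the family.
  have hpair (l) : ξ (F.jacobiField (c.z, c.a) l s₁) = η (F.jacobiField (c.z, c.a) l s₂) := by
    rw [F.apply_jacobiField hq hs₁' hξ, F.apply_jacobiField hq hs₂' hη]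
    simp only at hξM hξJ hηM hηJ ⊢
    rw [← hξM, ← hξM, ← hξJ, ← hηM, ← hηM, ← hηJ]
  rcases eq_or_ne s₁ s₂ with rfl | hs
  -- At equal times the values of the fields fill the tangent space, so the covectors coincide. A
  -- return of the geodesic to the same point at another time belongs to the second case.
  · refine (hne (Sigma.ext rfl (heq_of_eq (ContinuousLinearMap.ext fun v ↦ ?_)))).elim
    obtain ⟨k, hk⟩ := LinearMap.BilinForm.exists_apply_eq_of_orthogonal hE finrank_param
      (g.bilinForm_nondegenerate _) (F.velocity_ne hE hq hs₁') (F.cauchyData_injective hE hq hs₁')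
      (F.form_velocity_covDeriv hq hs₁') (v := v) (map_zero _)
    have hk1 : F.jacobiField (c.z, c.a) k s₁ = v := congrArg Prod.fst hk
    rw [← hk1]
    exact hpair k
  · obtain ⟨k, d, hk₁, hk₂⟩ := LinearMap.BilinForm.exists_of_symplectic hE hE finrank_param
      (g.bilinForm_nondegenerate _) (g.bilinForm_nondegenerate _) (F.velocity_ne hE hq hs₁')
      (F.velocity_ne hE hq hs₂') (F.cauchyData_injective hE hq hs₁')
      (F.cauchyData_injective hE hq hs₂') (F.form_velocity_covDeriv hq hs₁')
      (F.form_velocity_covDeriv hq hs₂') (F.cauchyData_symplectic hq hs₁' hs₂')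
      (x := g.sharp ⟨_, ξ⟩) (y := g.sharp ⟨_, η⟩)
      ((g.symm _ _ _).trans ((g.form_sharp ⟨_, ξ⟩ _).trans hξ))
      fun l ↦ (g.form_sharp ⟨_, ξ⟩ _).trans ((hpair l).trans (g.form_sharp ⟨_, η⟩ _).symm)
    exact F.linkedAlong_of_cauchyData hE hq hs₁ hs₂ hs hp₁ hk₁ hk₂

theorem covector_ne_zero {p : Covector E M} (hp : g.IsSpacelike p) : p.2 ≠ 0 := by
  intro h
  have h1 := g.form_sharp p (g.sharp p)
  rw [h] at h1
  exact hp.ne' h1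

/-- For a linking field `J` with `v` and `w` proportional to its end derivatives, `h` is the
equality of Wronskians. The common element is read off from `ξ` at `s₁`; `h` shows that `η` gives
the same components at `s₂`. -/
theorem exists_mem_of_form_jacobiField_eq (hq : q ∈ F.Z ×ˢ F.A) (hs₁ : s₁ ∈ Ioo 0 F.ℓ)
    (hs₂ : s₂ ∈ Ioo 0 F.ℓ) (hne : s₁ ≠ s₂) {ξ : TangentSpace 𝓘(ℝ, E) (F.γ q s₁) →L[ℝ] ℝ}
    {η : TangentSpace 𝓘(ℝ, E) (F.γ q s₂) →L[ℝ] ℝ} (hΩ₁ : F.γ q s₁ ∈ F.Ω) (hΩ₂ : F.γ q s₂ ∈ F.Ω)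
    (hξ0 : ξ ≠ 0) (hη0 : η ≠ 0) {v : TangentSpace 𝓘(ℝ, E) (F.γ q s₁)}
    {w : TangentSpace 𝓘(ℝ, E) (F.γ q s₂)} {b : ℝ}
    (hξ : g.sharp ⟨F.γ q s₁, ξ⟩ = v + b • velocity E (F.γ q) s₁)
    (hη : g.sharp ⟨F.γ q s₂, η⟩ = w + b • velocity E (F.γ q) s₂)
    (h : ∀ k, g.form (F.γ q s₂) w (F.jacobiField q k s₂)
      = g.form (F.γ q s₁) v (F.jacobiField q k s₁)) :
    ∃ c ∈ F.C ⟨F.γ q s₁, ξ⟩ ∩ F.C ⟨F.γ q s₂, η⟩, c.z = q.1 ∧ c.a = q.2 := by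
  have hs₁' := Ioo_subset_Icc_self hs₁
  have hs₂' := Ioo_subset_Icc_self hs₂
  -- The fields `γ̇` and `s γ̇` give `g(w, γ̇) = g(v, γ̇)` and `s₂ g(w, γ̇) = s₁ g(v, γ̇)`. As `s₁ ≠
  -- s₂`, both products vanish, so `ξ` and `η` annihilate `γ̇`.
  have hn₁ := h (0, (1, 0))
  have hn₂ := h (0, (0, 1))
  simp only [jacobiField_velocity, mul_zero, add_zero, one_smul, mul_one, zero_add, map_smul,
    smul_eq_mul] at hn₁ hn₂
  have hv : g.form (F.γ q s₁) v (velocity E (F.γ q) s₁) = 0 := by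
    rw [hn₁] at hn₂
    by_contra h0
    exact hne (mul_right_cancel₀ h0 hn₂).symm
  have hξ' (u) : ξ u = g.form (F.γ q s₁) v u + b * g.form (F.γ q s₁) (velocity E (F.γ q) s₁) u := by
    refine (g.form_sharp ⟨_, ξ⟩ u).symm.trans ?_
    rw [hξ, map_add, map_smul]
    rfl
  have hη' (u) : η u = g.form (F.γ q s₂) w u + b * g.form (F.γ q s₂) (velocity E (F.γ q) s₂) u := by
    refine (g.form_sharp ⟨_, η⟩ u).symm.trans ?_
    rw [hη, map_add, map_smul]
    rfl
  -- The multiples of `γ̇` contribute equally at both times because `g(γ̇, K)` is constant along the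
  -- geodesic.
  have hpair (u : (Fin 2 → ℝ) × ℝ) : ξ (F.paramField q u s₁) = η (F.paramField q u s₂) := by
    have : ξ (F.jacobiField q (u, 0) s₁) = η (F.jacobiField q (u, 0) s₂) := by
      rw [hξ', hη', h, F.form_velocity_jacobiField hq hs₁', F.form_velocity_jacobiField hq hs₂']
    simpa [jacobiField] using this
  refine ⟨⟨q.1, q.2, fun j ↦ ξ (F.fieldM j q.1 q.2 s₁), ξ (F.fieldJ q.1 q.2 s₁)⟩,
    ⟨⟨hq.1, hq.2, hΩ₁, hξ0, s₁, hs₁, ξ, rfl, ?_, fun _ ↦ rfl, rfl⟩,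
      ⟨hq.1, hq.2, hΩ₂, hη0, s₂, hs₂, η, rfl, ?_, fun j ↦ ?_, ?_⟩⟩, rfl, rfl⟩
  · refine (hξ' _).trans ?_
    rw [hv, F.form_velocity hq hs₁', mul_zero, add_zero]
  · refine (hη' _).trans ?_
    rw [hn₁, hv, F.form_velocity hq hs₂', mul_zero, add_zero]
  · change ξ (F.fieldM j q.1 q.2 s₁) = η (F.fieldM j q.1 q.2 s₂)
    rw [F.fieldM_eq hq hs₁', F.fieldM_eq hq hs₂', hpair]
  · change ξ (F.fieldJ q.1 q.2 s₁) = η (F.fieldJ q.1 q.2 s₂)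
    rw [F.fieldJ_eq hq hs₁', F.fieldJ_eq hq hs₂', hpair]

theorem exists_mem_of_linkedAlong {p₁ p₂ : Covector E M} (hΩ₁ : p₁.1 ∈ F.Ω) (hΩ₂ : p₂.1 ∈ F.Ω)
    (hp₁ : g.IsSpacelike p₁) (hp₂ : g.IsSpacelike p₂) (hq : q ∈ F.Z ×ˢ F.A)
    (h : F.LinkedAlong p₁ p₂ q.1 q.2) : ∃ c ∈ F.C p₁ ∩ F.C p₂, c.z = q.1 ∧ c.a = q.2 := by
  obtain ⟨s₁, hs₁, s₂, hs₂, h⟩ := h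
  replace h : g.Linked p₁ p₂ (fun r ↦ F.γ q (s₁ + r * (s₂ - s₁))) := h
  obtain ⟨⟨-, hlight⟩, hx, hy, -, J, b, hJ, J0, J1, hξJ, hηJ⟩ := h
  obtain ⟨x, ξ⟩ := p₁
  obtain ⟨y, η⟩ := p₂
  dsimp only at hx hy
  subst hx hy
  have z0 : (0 : ℝ) ∈ Icc (0 : ℝ) 1 := by simp
  have z1 : (1 : ℝ) ∈ Icc (0 : ℝ) 1 := by simp
  have hvel {r : ℝ} (hr : r ∈ Icc (0 : ℝ) 1) :=
    velocity_affine (F.mdifferentiableAt_γ hq (F.segment_mem_Icc hs₁ hs₂ hr))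
  -- The velocity of the segment is `(s₂ - s₁) γ̇`, and it is not zero because the segment is a
  -- lightlike geodesic.
  have hδ : s₂ - s₁ ≠ 0 := fun h0 ↦ (hlight 0 z0).1 ((hvel z0).trans (smul_eq_zero.2 (.inl h0)))
  have hξ := eq_of_heq (TotalSpace.mk.inj hξJ).2
  have hη := eq_of_heq (TotalSpace.mk.inj hηJ).2
  rw [hvel z0, smul_smul] at hξ
  rw [hvel z1, smul_smul] at hη
  -- The times keep the unsimplified form `s₁ + 0 * (s₂ - s₁)` and `s₁ + 1 * (s₂ - s₁)`, in which
  -- the base points of the covectors and of `J` occur.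
  refine F.exists_mem_of_form_jacobiField_eq hq (s₁ := s₁ + 0 * (s₂ - s₁))
    (s₂ := s₁ + 1 * (s₂ - s₁)) (by rwa [zero_mul, add_zero]) (by rwa [one_mul, add_sub_cancel])
    (fun h0 ↦ hδ (by linarith)) hΩ₁ hΩ₂ (covector_ne_zero hp₁) (covector_ne_zero hp₂) hξ hη
    fun k ↦ ?_
  -- As `J` vanishes at both ends, its Wronskian with a reparametrized field `K` of the family
  -- reduces there to `g(J', K)`.
  have h := hJ.wronskian_eq ((F.isJacobiOn_jacobiField hq k).affine (a := s₁) (c := s₂ - s₁)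
    (T := Icc 0 1) fun r hr ↦ F.segment_mem_Icc hs₁ hs₂ hr) z1
  simp only [LorentzMetric.wronskian] at h
  rw [J0, J1] at h
  simpa using h

end LightRayFamily

end Linking

end

theorem mainTheorem6 {E : Type*} [NormedAddCommGroup E] [NormedSpace ℝ E]
    (hE : Module.finrank ℝ E = 3) {M : Type*} [TopologicalSpace M] [ChartedSpace E M]
    [IsManifold 𝓘(ℝ, E) ∞ M] [T2Space M] [SigmaCompactSpace M]
    (g : LorentzMetric E M) (F : LightRayFamily g) (p₁ p₂ : Covector E M)
    (hp₁ : p₁.1 ∈ F.Ω) (hp₂ : p₂.1 ∈ F.Ω)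
    (hs₁ : g.IsSpacelike p₁) (hs₂ : g.IsSpacelike p₂) (hne : p₁ ≠ p₂) :
    (∀ z ∈ F.Z, ∀ a ∈ F.A,
      (∃ q ∈ F.C p₁ ∩ F.C p₂, q.z = z ∧ q.a = a) ↔ F.LinkedAlong p₁ p₂ z a) ∧
    ((F.C p₁).Nonempty → F.C p₁ = F.C p₂ →
      ∃ z ∈ F.Z, ∃ a ∈ F.A, F.LinkedAlong p₁ p₂ z a) ∧
    ((∃! q, q ∈ F.C p₁) → (∃! q, q ∈ F.C p₂) →
      (F.C p₁ = F.C p₂ ↔ ∃ z ∈ F.Z, ∃ a ∈ F.A, F.LinkedAlong p₁ p₂ z a)) := by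
  have : FiniteDimensional ℝ E := .of_finrank_pos (by omega)
  have key : ∀ z ∈ F.Z, ∀ a ∈ F.A,
      (∃ q ∈ F.C p₁ ∩ F.C p₂, q.z = z ∧ q.a = a) ↔ F.LinkedAlong p₁ p₂ z a := by
    refine fun z hz a ha ↦ ⟨?_, fun h ↦
      F.exists_mem_of_linkedAlong (q := (z, a)) hp₁ hp₂ hs₁ hs₂ ⟨hz, ha⟩ h⟩
    rintro ⟨q, hq, rfl, rfl⟩
    exact F.linkedAlong_of_mem hE hs₁ hne hq.1 hq.2
  have common : (F.C p₁).Nonempty → F.C p₁ = F.C p₂ →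
      ∃ z ∈ F.Z, ∃ a ∈ F.A, F.LinkedAlong p₁ p₂ z a := by
    rintro ⟨q, hq⟩ h
    exact ⟨q.z, hq.1, q.a, hq.2.1, F.linkedAlong_of_mem hE hs₁ hne hq (h ▸ hq)⟩
  refine ⟨key, common, fun h₁ h₂ ↦ ⟨common h₁.exists, ?_⟩⟩
  rintro ⟨z, hz, a, ha, h⟩
  -- Linking gives one common element, and single-valuedness makes it the only element of each of
  -- the two sets.
  obtain ⟨q, ⟨hq₁, hq₂⟩, -⟩ := (key z hz a ha).2 h
  ext q'
  exact ⟨fun h' ↦ h₁.unique h' hq₁ ▸ hq₂, fun h' ↦ h₂.unique h' hq₂ ▸ hq₁⟩
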